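/- **Setting.** Let $\beta_\Theta>0$, $\theta^*\in[-\beta_\Theta,\beta_\Theta]$, and let $d$ be a distance function on $\mathbb R$: a metric such that $x<y<z$ implies $d(x,y)<d(x,z)$ and $d(y,z)<d(x,z)$ (so every utility $-d(\cdot,\theta^*)$ is strictly unimodal). The utility is $u(\theta)=-d(\theta,\theta^*)$. Fix $\Delta>0$; for $\theta\in[-\beta_\Theta,\beta_\Theta]$ let $c_\Delta^-(\theta)<\theta<c_\Delta^+(\theta)$ be points with $d(c^\pm_\Delta(\theta),\theta)=\Delta/2$. In each comparison at $\theta$ the human chooses the option with the larger $u(\cdot)+\xi$, where the noises $\xi$ are independent over options and comparisons and Gumbel distributed with scale $\gamma>0$, i.e. $\Pr(\xi\le x)=\exp(-e^{-x/\gamma})$. The answer is $\tilde Z=+1$ if $c^+_\Delta(\theta)$ is chosen and $-1$ otherwise. *Vertical moves.* Fix $\eta\in(0,1)$ and $\hbar_m=(2m(\ln(m+1)-\ln\eta))^{1/2}$. The test at $\theta$ forms the partial sums $S_m$ of successive answers and makes $\tau_1^\uparrow(\theta)=\inf\{m\ge1:|S_m|\ge\hbar_m\}$ comparisons; if this is finite,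 its verdict is the sign of $S_{\tau_1^\uparrow(\theta)}$. *Horizontal moves.* Fix $p\in(1/2,1-\eta/2)$ and a positive probability density $\rho_0$ on $[-\beta_\Theta,\beta_\Theta]$. The query point $\theta_k$ is the median of $\rho_k$; after verdict $+1$ at $\theta_k$, $\rho_{k+1}$ is $2p\rho_k$ on $\{\theta'\ge\theta_k\}$ and $2(1-p)\rho_k$ on $\{\theta'<\theta_k\}$; after verdict $-1$ the two factors are exchanged. If the test at $\theta_k$ never stops, no further move is made. Put $T^\uparrow(\theta_k)=\tau^\uparrow_1(\theta_k)$. *Assumptions.* Let $a>0$, $\lambda_\Delta>0$, $0<\kappa\le1$, $\varsigma\le 1$. (i) Prior: $\int_{\theta^*-a}^{\theta^*}\rho_0\ge a^\varsigma$ if $a<\theta^*+\beta_\Theta$, and $\int_{\theta^*}^{\theta^*+a}\rho_0\ge a^\varsigma$ if $a<\beta_\Theta-\theta^*$. (ii) Utility gap: $|u(c_\Delta^+(\theta))-u(c_\Delta^-(\theta))|\ge\lambda_\Delta|\theta-\theta^*|^\kappa$ for all $\theta\in[-\beta_\Theta,\beta_\Theta]$ with $|\theta-\theta^*|\le a$.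 *Thresholds.* Let $c=\min\{\lambda_\Delta/(8\gamma\ln2),\,1/(6a^\kappa)\}$, $\tau_0=\max\{s\ge1:\hbar_s/s\ge c\varepsilon^\kappa/2\}$ ($0$ if there is no such $s$), $$\tau^\uparrow(\delta,\varepsilon)=\max\Big\{\tau_0,\ \frac{8\log(1/\delta)}{c^2\varepsilon^{2\kappa}}\Big\},$$ and, for constants $r_1,r_2,r_R,\alpha,\beta_1,\beta_2>0$, $$\tau^\rightarrow(\delta,\varepsilon)=\max\Big\{\frac{4\varsigma(1+\varsigma)\log\frac{8}{\delta\varepsilon^\varsigma}}{r_2\alpha},\ \frac{4\log\frac{8}{\delta\varepsilon^\varsigma}}{r_2\alpha},\ \frac{2\log(8\beta_1/\delta)}{r_1},\ \frac{\log(8\beta_2/\delta)}{r_R}\Big\}.$$ **Theorem (Vertical moves in Phase II).** There are constants $r_1,r_2,r_R,\alpha,\beta_1,\beta_2>0$, depending only on $p,\eta,\Delta,\gamma$, such that in every setting as above the following holds. 1. Let $\delta\in(0,1)$, $\varepsilon>0$, and let $T^\rightarrow$ be a number of horizontal moves, deterministic or random, such that each event $\{T^\rightarrow=k\}$ is determined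 by the noises of the first $k$ tests (before the first comparison at $\theta_k$). Then, with probability at least $1-\delta$: if the $T^\rightarrow$ horizontal moves have been made, $T^\rightarrow\ge\tau^\rightarrow(\delta/2,a)$ and $T^\uparrow(\theta_{T^\rightarrow})\ge\tau^\uparrow(\delta/2,\varepsilon)$, then $|\theta_{T^\rightarrow}-\theta^*|\le\varepsilon$. 2. $\tau^\uparrow(\delta,\varepsilon)=O\big((\log(1/\delta)+\log(1/\varepsilon))\,\varepsilon^{-2\kappa}\big)$: there is $C>0$, depending only on $\eta,\gamma,\lambda_\Delta,a,\kappa$ (and possibly $p,\Delta$), such that $\tau^\uparrow(\delta,\varepsilon)\le C(\log(1/\delta)+\log(1/\varepsilon))\varepsilon^{-2\kappa}$ for all $\delta\in(0,1)$ and $\varepsilon\in(0,1/2]$. -/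

import Mathlib

open MeasureTheory ProbabilityTheory

noncomputable section

namespace MAPB

/-! ## Utility model of a human comparison in one dimension -/

/-- A distance function on the line: a metric for which moving further away in one direction
strictly increases the distance, so that each utility `-d(·, θ*)` is strictly unimodal. -/
structure IsDistance (d : ℝ → ℝ → ℝ) : Prop where
  nonneg : ∀ x y, 0 ≤ d x y
  eq_zero_iff : ∀ x y, d x y = 0 ↔ x = y
  symm : ∀ x y, d x y = d y x
  triangle : ∀ x y z, d x z ≤ d x y + d y z
  mono_right : ∀ x y z, x < y → y < z → d x y < d x z
  mono_left : ∀ x y z, x < y → y < z → d y z < d x z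

/-- The utility `u(θ) = -d(θ, θ*)`. -/
def utility (d : ℝ → ℝ → ℝ) (θs θ : ℝ) : ℝ := -d θ θs

/-- `cm θ` and `cp θ` are the two points offered to the human when `θ` is queried: they lie on
opposite sides of `θ`, both at distance `Δ / 2` from it. -/
def IsComparisonPair (d : ℝ → ℝ → ℝ) (Δ β : ℝ) (cm cp : ℝ → ℝ) : Prop :=
  ∀ θ ∈ Set.Icc (-β) β,
    cm θ < θ ∧ θ < cp θ ∧ d (cm θ) θ = Δ / 2 ∧ d (cp θ) θ = Δ / 2

/-- `X` has the Gumbel distribution with scale `γ`. -/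
def HasGumbelLaw {Ω : Type*} [MeasurableSpace Ω] (P : Measure Ω) (X : Ω → ℝ) (γ : ℝ) : Prop :=
  Measurable X ∧ ∀ x : ℝ, P.real {ω | X ω ≤ x} = Real.exp (-Real.exp (-x / γ))

/-- The random utility noise: `ξ (k, i, true)` and `ξ (k, i, false)` are the noises in the perceived
utilities of the right and of the left option in the `i`-th comparison at the `k`-th query point.
All of them are independent and Gumbel with scale `γ`. -/
def IsNoise {Ω : Type*} [MeasurableSpace Ω] (P : Measure Ω) (γ : ℝ)
    (ξ : ℕ × ℕ × Bool → Ω → ℝ) : Prop :=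
  (∀ j, HasGumbelLaw P (ξ j) γ) ∧ iIndepFun ξ P

/-- The sign of the `i`-th comparison at `θ` in horizontal step `k`, for the noise values `x`:
`+1` if the human prefers `cp θ`, and `-1` if the human prefers `cm θ`. -/
def response (d : ℝ → ℝ → ℝ) (θs : ℝ) (cm cp : ℝ → ℝ) (x : ℕ × ℕ × Bool → ℝ)
    (k : ℕ) (θ : ℝ) (i : ℕ) : ℝ :=
  if utility d θs (cm θ) + x (k, i, false) < utility d θs (cp θ) + x (k, i, true) then 1 else -1

/-! ## Vertical moves: the test of power one -/

/-- The random walk `S_m` with steps `z 0, z 1, …`. -/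
def walk (z : ℕ → ℝ) (m : ℕ) : ℝ := ∑ i ∈ Finset.range m, z i

/-- The boundary `ħ_m = (2 m (ln (m + 1) - ln η))^{1/2}`. -/
def barrier (η : ℝ) (m : ℕ) : ℝ :=
  Real.sqrt (2 * m * (Real.log (m + 1) - Real.log η))

/-- The number of comparisons made by the test: the first `m ≥ 1` with `|S_m| ≥ ħ_m`, and `⊤` if
there is none. -/
def testTime (η : ℝ) (z : ℕ → ℝ) : ℕ∞ :=
  ⨅ m ∈ {m : ℕ | 1 ≤ m ∧ barrier η m ≤ |walk z m|}, (m : ℕ∞)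

/-- The verdict of the test: the sign of the walk when the test stops, and `0` if it never stops. -/
def testSignal (η : ℝ) (z : ℕ → ℝ) : SignType :=
  if testTime η z = ⊤ then 0 else SignType.sign (walk z (testTime η z).toNat)

/-! ## Horizontal moves: probabilistic bisection -/

/-- The median of a probability density on `[-β, β]`. -/
def median (β : ℝ) (ρ : ℝ → ℝ) : ℝ :=
  sInf {x | x ∈ Set.Icc (-β) β ∧ 1 / 2 ≤ ∫ t in (-β)..x, ρ t}

/-- The update of the density `ρ` after the query point `θ` has received the verdict `s`. -/
def update (p θ : ℝ) (s : SignType) (ρ : ℝ → ℝ) : ℝ → ℝ := fun t =>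
  match s with
  | SignType.pos => if θ ≤ t then 2 * p * ρ t else 2 * (1 - p) * ρ t
  | SignType.neg => if θ ≤ t then 2 * (1 - p) * ρ t else 2 * p * ρ t
  | SignType.zero => ρ t

/-- The density `ρ_k` after `k` horizontal moves, when the comparisons at the point `θ` in step `k`
are answered by `Z k θ 0, Z k θ 1, …`. -/
def density (β p η : ℝ) (ρ₀ : ℝ → ℝ) (Z : ℕ → ℝ → ℕ → ℝ) : ℕ → ℝ → ℝ
  | 0 => ρ₀
  | k + 1 =>
      update p (median β (density β p η ρ₀ Z k))
        (testSignal η (Z k (median β (density β p η ρ₀ Z k))))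
        (density β p η ρ₀ Z k)

/-- The query point `θ_k`: the median of `ρ_k`. -/
def queryPoint (β p η : ℝ) (ρ₀ : ℝ → ℝ) (Z : ℕ → ℝ → ℕ → ℝ) (k : ℕ) : ℝ :=
  median β (density β p η ρ₀ Z k)

/-- `T^↑(θ_k)`: the number of comparisons that the test at the `k`-th query point makes. -/
def verticalMoves (β p η : ℝ) (ρ₀ : ℝ → ℝ) (Z : ℕ → ℝ → ℕ → ℝ) (k : ℕ) : ℕ∞ :=
  testTime η (Z k (queryPoint β p η ρ₀ Z k))

/-- `k` horizontal moves are made: the tests at the first `k` query points all stop. -/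
def MakesMoves (β p η : ℝ) (ρ₀ : ℝ → ℝ) (Z : ℕ → ℝ → ℕ → ℝ) (k : ℕ) : Prop :=
  ∀ j < k, verticalMoves β p η ρ₀ Z j ≠ ⊤

/-- `ρ₀` is a positive probability density on `[-β, β]`. -/
def IsPrior (β : ℝ) (ρ₀ : ℝ → ℝ) : Prop :=
  (∀ t ∈ Set.Icc (-β) β, 0 < ρ₀ t) ∧ IntegrableOn ρ₀ (Set.Icc (-β) β) ∧
    ∫ t in Set.Icc (-β) β, ρ₀ t = 1

/-- The prior puts mass at least `a ^ ς` on the part of the `a`-neighbourhood of `θ*` on either side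
of `θ*`. A side on which no point of `[-β, β]` is further than `a` from `θ*` is exempt. -/
def PriorMass (β θs a ς : ℝ) (ρ₀ : ℝ → ℝ) : Prop :=
  (a < θs + β → a ^ ς ≤ ∫ t in (θs - a)..θs, ρ₀ t) ∧
    (a < β - θs → a ^ ς ≤ ∫ t in θs..(θs + a), ρ₀ t)

/-- The events decided by the first `k` tests, that is, before the first comparison at `θ_k`. -/
@[reducible] def pastInfo {Ω : Type*} (ξ : ℕ × ℕ × Bool → Ω → ℝ) (k : ℕ) : MeasurableSpace Ω :=
  ⨆ j : {j : ℕ × ℕ × Bool // j.1 < k}, MeasurableSpace.comap (ξ j) inferInstance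

/-! ## The thresholds -/

/-- The utility-gap assumption on the `a`-neighbourhood of `θ*`. -/
def UtilityGap (d : ℝ → ℝ → ℝ) (β θs a lam κ : ℝ) (cm cp : ℝ → ℝ) : Prop :=
  ∀ θ ∈ Set.Icc (-β) β, |θ - θs| ≤ a →
    lam * |θ - θs| ^ κ ≤ |utility d θs (cp θ) - utility d θs (cm θ)|

/-- `c = min {λ / (8 γ ln 2), 1 / (6 a^κ)}`. -/
def gapConst (γ lam a κ : ℝ) : ℝ := min (lam / (8 * γ * Real.log 2)) (1 / (6 * a ^ κ))

/-- `τ_0 = max {s : ħ_s / s ≥ c ε^κ / 2}`. The set is finite, since `ħ_s / s` tends to `0`. If it is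
empty, the value is `0`. -/
def tauZero (η c κ ε : ℝ) : ℕ := sSup {s : ℕ | 1 ≤ s ∧ c * ε ^ κ / 2 ≤ barrier η s / s}

/-- `τ^↑(δ, ε) = max {τ_0, 8 log (1/δ) / (c² ε^{2κ})}`. -/
def tauUp (η c κ δ ε : ℝ) : ℝ :=
  max (tauZero η c κ ε : ℝ) (8 * Real.log (1 / δ) / (c ^ 2 * ε ^ (2 * κ)))

/-- `τ^→(δ, ε)`, the number of horizontal moves for precision `ε` and confidence `1 - δ`. -/
def tauRight (ς r₁ r₂ rR α β₁ β₂ δ ε : ℝ) : ℝ :=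
  max
    (max (4 * ς * (1 + ς) * Real.log (8 / (δ * ε ^ ς)) / (r₂ * α))
      (4 * Real.log (8 / (δ * ε ^ ς)) / (r₂ * α)))
    (max (2 * Real.log (8 * β₁ / δ) / r₁) (Real.log (8 * β₂ / δ) / rR))

end MAPB

end

namespace MAPB

/-! ### The Lyapunov function of probabilistic bisection -/

/-! The failure probability `δ` is split between two events. In `farEvent` some query point from
move `n` on, with `n` the rounded-up value of `τ^→`, is farther than `a` from `θ*`. In `slowEvent`
the point reached at time `T` lies between `ε` and `a` from `θ*`, and yet its walk is still inside
the boundary one step before `τ^↑`. Outside both events, a test that lasts `τ^↑` comparisons can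
only occur within `ε` of `θ*`.

Horizontal moves. A verdict is wrong with probability in `[w₀, w₁]`, where `w₁ = η / 2 < 1 - p` and
`w₀ > 0` (`prob_neg_mem`, `prob_pos_mem`). The upper bound compares the walk with a fair one, for
which the uniform mixture of Bernoulli likelihood ratios is a martingale that exceeds `1 / η`
outside the boundary (`one_le_mixtureRatio`, `lossProb_half_add_swap`); symmetry gives the factor `1
/ 2`. The lower bound comes from a fixed number of answers that all go the wrong way. Consider an
interval with one end at `θ*` and the other at distance `a`. Let `ℓ` be the mass beyond its far end
and `R` the mass on the other side of `θ*`. If the query point is beyond the far end, then `ℓ ≥ 1/2`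
and the ratio `ℓ / (1 - ℓ - R)` is at least `1`. In mean this ratio contracts at a rate proportional
to `1/2 - R` while the query point is on the interval's side of `θ*`, and it does not change when
the query point is on the other side. A weight `G R` repairs the degenerate range of `R`: the
product contracts by a fixed factor `r < 1` in every case (`exists_isWeight`, `left_potential_step`,
`right_potential_step`). Markov's inequality and a geometric series bound `farEvent`
(`sum_prob_far_le`, `prob_farEvent_le`).

Vertical moves. At a distance in `(ε, a]` the utility gap gives the walk a drift of at least `2 c
ε^κ`, whereas past `τ_0` the boundary is below `c ε^κ / 2` per step. Hoeffding's inequality then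
makes a long test unlikely (`prob_abs_walk_lt_barrier_le`), and independence of the current test
from the past carries this over to a random `T` (`prob_slowEvent_le`).

The adaptive process is handled by summing over words of verdicts: once the word is fixed, the
density and the query point are deterministic. -/

/-- The ratio of the mass `ℓ` beyond an interval to the mass `1 - ℓ - R` of the interval, weighted
by a function `G` of the mass `R` on the other side. -/
noncomputable def potential (G : ℝ → ℝ) (ℓ R : ℝ) : ℝ := ℓ / (1 - ℓ - R) * G R

/-- The rate at which the mass ratio contracts. -/
noncomputable def contractionRate (p w₁ : ℝ) : ℝ := (1 - p - w₁) * (2 * p - 1) / (p * (1 - p))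

lemma contractionRate_pos {p w₁ : ℝ} (hp : 1 / 2 < p) (hp1 : p < 1) (hw : w₁ < 1 - p) :
    0 < contractionRate p w₁ := by
  have h1 : 0 < 1 - p - w₁ := by linarith
  have h2 : 0 < 2 * p - 1 := by linarith
  have h3 : 0 < 1 - p := by linarith
  unfold contractionRate; positivity

/-- A mass multiplied by `2p` after a correct and by `2(1-p)` after a wrong verdict has its
reciprocal multiplied by this quantity in mean. It increases with `w` and equals `1` at `w = 1 - p`,
which is why error probabilities must stay below `1 - p`. -/
lemma sum_inv_factors_le {p w w₁ : ℝ} (hp : 1 / 2 < p) (hp1 : p < 1) (hw : w ≤ w₁) :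
    (1 - w) / (2 * p) + w / (2 * (1 - p)) ≤ 1 - contractionRate p w₁ / 2 := by
  have h3 : 0 < 1 - p := by linarith
  have e : 1 - contractionRate p w₁ / 2 - ((1 - w) / (2 * p) + w / (2 * (1 - p)))
      = (w₁ - w) * (2 * p - 1) / (2 * p * (1 - p)) := by
    unfold contractionRate; field_simp; ring
  have : 0 ≤ (w₁ - w) * (2 * p - 1) / (2 * p * (1 - p)) :=
    div_nonneg (mul_nonneg (by linarith) (by linarith)) (by positivity)
  linarith

/-- The mass ratio contracts in expectation if the query point is beyond the interval. -/
lemma ratio_contracts_far {p w w₁ ℓ R : ℝ} (hp : 1 / 2 < p) (hp1 : p < 1) (hw : w ≤ w₁)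
    (hw1 : w₁ < 1 - p) (hℓ : 1 / 2 ≤ ℓ) (hR : 0 ≤ R) (hA : ℓ + R < 1) :
    (1 - w) * ((1 - 2 * p * (1 - ℓ)) / (2 * p * (1 - ℓ - R)))
      + w * ((1 - 2 * (1 - p) * (1 - ℓ)) / (2 * (1 - p) * (1 - ℓ - R)))
      ≤ (1 - contractionRate p w₁ * (1 / 2 - R)) * (ℓ / (1 - ℓ - R)) := by
  have hA' : 0 < 1 - ℓ - R := by linarith
  have h3 : 0 < 1 - p := by linarith
  have hc := contractionRate_pos hp hp1 hw1
  have e : (1 - w) * ((1 - 2 * p * (1 - ℓ)) / (2 * p * (1 - ℓ - R)))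
      + w * ((1 - 2 * (1 - p) * (1 - ℓ)) / (2 * (1 - p) * (1 - ℓ - R)))
      = ((1 - w) / (2 * p) + w / (2 * (1 - p)) - (1 - ℓ)) / (1 - ℓ - R) := by
    field_simp; ring
  rw [e, ← mul_div_assoc]
  apply div_le_div_of_nonneg_right _ hA'.le
  have := sum_inv_factors_le hp hp1 hw
  nlinarith [mul_nonneg hc.le (by linarith : (0:ℝ) ≤ 1 - ℓ), mul_nonneg hc.le (mul_nonneg hR (by linarith : (0:ℝ) ≤ ℓ))]

/-- Convexity of the reciprocal between the points `X` and `1`. -/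
lemma inv_weighted_le {X t : ℝ} (hX : 0 < X) (ht : 0 ≤ t) (ht1 : t ≤ 1) :
    1 / (t * X + (1 - t)) ≤ t / X + (1 - t) := by
  have h : 0 < t * X + (1 - t) := by
    rcases eq_or_lt_of_le ht with h | h
    · subst h; norm_num
    · nlinarith [mul_pos h hX]
  rw [div_le_iff₀ h]
  have e : (t / X + (1 - t)) * (t * X + (1 - t)) = 1 + t * (1 - t) * ((X - 1) ^ 2 / X) := by
    field_simp; ring
  rw [e]
  have : 0 ≤ t * (1 - t) * ((X - 1) ^ 2 / X) := by
    have : 0 ≤ 1 - t := by linarith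
    positivity
  linarith

/-- The mass ratio contracts in expectation if the query point is in the interval. -/
lemma ratio_contracts_mid {p w w₁ ℓ R : ℝ} (hp : 1 / 2 < p) (hp1 : p < 1) (hw0 : 0 ≤ w)
    (hw : w ≤ w₁) (hw1 : w₁ < 1 - p) (hℓ0 : 0 ≤ ℓ) (hℓ : ℓ ≤ 1 / 2) (hR0 : 0 ≤ R) (hR : R ≤ 1 / 2)
    (hA : ℓ + R < 1) :
    (1 - w) * ((2 * (1 - p) * ℓ) / (1 - 2 * (1 - p) * ℓ - 2 * p * R))
      + w * ((2 * p * ℓ) / (1 - 2 * p * ℓ - 2 * (1 - p) * R))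
      ≤ (1 - contractionRate p w₁ * (1 / 2 - R)) * (ℓ / (1 - ℓ - R)) := by
  have hA' : 0 < 1 - ℓ - R := by linarith
  have h3 : 0 < 1 - p := by linarith
  have h0 : 0 < p := by linarith
  have hc := contractionRate_pos hp hp1 hw1
  set A := 1 - ℓ - R with hAd
  -- `t` is the fraction of the interval's mass between the query point and `θ*`. That part is
  -- scaled by `2q` and the rest by `2(1-q)`, where `q` is `p` or `1 - p` according to the verdict.
  set t := (1 / 2 - R) / A with htd
  have htA : t * A = 1 / 2 - R := by rw [htd]; field_simp
  have ht0 : 0 ≤ t := div_nonneg (by linarith) hA'.le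
  have ht1 : t ≤ 1 := by rw [htd, div_le_one hA']; linarith
  have key : ∀ q : ℝ, 0 < q → q < 1 →
      (2 * (1 - q) * ℓ) / (1 - 2 * (1 - q) * ℓ - 2 * q * R)
        ≤ (t * ((1 - q) / q) + (1 - t)) * (ℓ / A) := by
    intro q hq0 hq1
    have hq : 0 < 1 - q := by linarith
    have hX : 0 < q / (1 - q) := by positivity
    have h := inv_weighted_le hX ht0 ht1
    have e1 : 1 - 2 * (1 - q) * ℓ - 2 * q * R = (t * (q / (1 - q)) + (1 - t)) * (2 * (1 - q) * A) := by
      have : (t * (q / (1 - q)) + (1 - t)) * (2 * (1 - q) * A)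
          = 2 * q * (t * A) + 2 * (1 - q) * (A - t * A) := by field_simp
      rw [this, htA, hAd]; ring
    have e2 : t / (q / (1 - q)) = t * ((1 - q) / q) := by field_simp
    rw [e2] at h
    have hpos : 0 < t * (q / (1 - q)) + (1 - t) := by
      rcases eq_or_lt_of_le ht0 with h | h
      · rw [← h]; norm_num
      · nlinarith [mul_pos h hX]
    rw [e1]
    calc 2 * (1 - q) * ℓ / ((t * (q / (1 - q)) + (1 - t)) * (2 * (1 - q) * A))
        = 1 / (t * (q / (1 - q)) + (1 - t)) * (ℓ / A) := by field_simp
      _ ≤ _ := mul_le_mul_of_nonneg_right h (by positivity)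
  have k1 := key p h0 hp1
  have k2 := key (1 - p) h3 (by linarith)
  simp only [sub_sub_cancel] at k2
  have hw' : 0 ≤ 1 - w := by linarith
  have hYn : 0 ≤ ℓ / A := by positivity
  calc _ ≤ (1 - w) * ((t * ((1 - p) / p) + (1 - t)) * (ℓ / A))
        + w * ((t * (p / (1 - p)) + (1 - t)) * (ℓ / A)) := by gcongr
    _ = (1 - t * (1 - (1 - w) * ((1 - p) / p) - w * (p / (1 - p)))) * (ℓ / A) := by ring
    _ ≤ _ := by
      apply mul_le_mul_of_nonneg_right _ hYn
      have e : 1 - (1 - w) * ((1 - p) / p) - w * (p / (1 - p))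
          = contractionRate p w₁ + (w₁ - w) * (2 * p - 1) / (p * (1 - p)) := by
        unfold contractionRate; field_simp; ring
      have e2 : 0 ≤ (w₁ - w) * (2 * p - 1) / (p * (1 - p)) :=
        div_nonneg (mul_nonneg (by linarith) (by linarith)) (by positivity)
      have htR : 1 / 2 - R ≤ t := by
        rw [← htA]; nlinarith
      rw [e]
      nlinarith [mul_le_mul_of_nonneg_left htR hc.le, mul_nonneg ht0 e2]

/-- A correct verdict never raises the ratio. This is needed in addition to contraction in mean,
because a correct verdict can raise the weight `G`. -/
lemma ratio_decreases_far {p ℓ R : ℝ} (hp : 1 / 2 < p) (hA : ℓ + R < 1) :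
    (1 - 2 * p * (1 - ℓ)) / (2 * p * (1 - ℓ - R)) ≤ ℓ / (1 - ℓ - R) := by
  have hA' : 0 < 1 - ℓ - R := by linarith
  rw [div_le_div_iff₀ (by positivity) hA']
  nlinarith

lemma ratio_decreases_mid {p ℓ R : ℝ} (hp : 1 / 2 < p) (hp1 : p < 1)
    (hℓ0 : 0 ≤ ℓ) (hR : R ≤ 1 / 2) (hA : ℓ + R < 1) :
    (2 * (1 - p) * ℓ) / (1 - 2 * (1 - p) * ℓ - 2 * p * R) ≤ ℓ / (1 - ℓ - R) := by
  have hA' : 0 < 1 - ℓ - R := by linarith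
  have hB : 0 < 1 - 2 * (1 - p) * ℓ - 2 * p * R := by
    nlinarith [mul_nonneg (by linarith : (0:ℝ) ≤ 2 * p - 1) (by linarith : (0:ℝ) ≤ 1 / 2 - R),
      mul_pos (by linarith : (0:ℝ) < 1 - p) hA']
  rw [div_le_div_iff₀ hB hA']
  nlinarith [mul_nonneg hℓ0 (mul_nonneg (by linarith : (0:ℝ) ≤ 2 * p - 1) (by linarith : (0:ℝ) ≤ 1 / 2 - R))]

/-- A weight function for which `potential` is a strict supermartingale. -/
structure IsWeight (p w₀ w₁ r C : ℝ) (G : ℝ → ℝ) : Prop where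
  r_pos : 0 < r
  r_lt_one : r < 1
  one_le : ∀ R, R < 1 → 1 ≤ G R
  le_div : ∀ R, 0 ≤ R → R < 1 → G R ≤ C / (1 - R)
  -- The query point is not across `θ*`. A correct verdict turns the ratio `y` into `yg` and raises
  -- `R`; a wrong one gives `yb` and lowers `R`. At `R = 1/2` the hypothesis offers no contraction,
  -- so there the gain must come from `G`.
  near : ∀ w ∈ Set.Icc w₀ w₁, ∀ R ∈ Set.Icc (0 : ℝ) (1 / 2), ∀ y yg yb : ℝ, 0 ≤ yg → 0 ≤ yb →
    yg ≤ y → (1 - w) * yg + w * yb ≤ (1 - contractionRate p w₁ * (1 / 2 - R)) * y →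
    (1 - w) * (yg * G (2 * p * R)) + w * (yb * G (2 * (1 - p) * R)) ≤ r * (y * G R)
  -- The query point is across `θ*`. The ratio keeps its value, so the whole gain must come from
  -- `G`.
  opposite : ∀ w ∈ Set.Icc w₀ w₁, ∀ R : ℝ, 1 / 2 < R → R < 1 →
    (1 - w) * G (1 - 2 * p * (1 - R)) + w * G (1 - 2 * (1 - p) * (1 - R)) ≤ r * G R

-- The weight has three levels. For `R ≤ 1 - p` the ratio contracts by itself and `G = 1`. For `1 -
-- p < R ≤ 1/2` it may fail to contract, but a wrong verdict, of probability at least `w₀`, brings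
-- `R` below `1 - p` and resets `G` to `1`. For `R > 1/2` the term `1 / (1 - R)` contracts in mean.
set_option maxHeartbeats 800000 in
lemma exists_isWeight {p w₀ w₁ : ℝ} (hp : 1 / 2 < p) (hw₀ : 0 < w₀) (hw : w₀ ≤ w₁)
    (hw₁ : w₁ < 1 - p) : ∃ (r C : ℝ) (G : ℝ → ℝ), 0 < C ∧ IsWeight p w₀ w₁ r C G := by
  have hp1 : p < 1 := by linarith
  have hq : 0 < 1 - p := by linarith
  have hc := contractionRate_pos hp hp1 hw₁
  set c := contractionRate p w₁ with hcd
  -- `e` bounds the term `1 / (2 (1 - R))` after a move from `R ≤ 1/2`, since `R` then stays at most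
  -- `p`. With `w₀ * B = e` the chance of a reset pays for this increase: `(1 - w₀) * (B + e) = B -
  -- w₀ * e`.
  set e := 1 / (2 * (1 - p)) with hed
  have he : 0 < e := by positivity
  set B := e / w₀ with hBd
  have hB : 0 < B := by positivity
  have hwB : w₀ * B = e := by rw [hBd]; field_simp
  -- `s` is the contraction guaranteed for `R ≤ 1 - p`; with `κ * B ≤ s` the jump of `G` to the
  -- middle level costs less than that.
  set s := c * (p - 1 / 2) with hsd
  have hs : 0 < s := mul_pos hc (by linarith)
  obtain ⟨κ, hκ0, hκ⟩ : ∃ κ : ℝ, 0 < κ ∧ κ * B ≤ s := ⟨s / B, by positivity, by field_simp; rfl⟩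
  -- The last three bounds on `t` serve the low, the middle and the high range of `R`, in this
  -- order.
  obtain ⟨t, ht0, ht1, ht2, ht3, ht4⟩ : ∃ t : ℝ, 0 < t ∧ t < 1 ∧ t ≤ s ^ 2 ∧
      t * (1 + κ * B) ≤ κ * (w₀ * e) ∧ t * (1 + κ * B + κ) ≤ κ * (c / 2) := by
    refine ⟨min (min (1 / 2) (s ^ 2)) (min (κ * (w₀ * e) / (1 + κ * B))
      (κ * (c / 2) / (1 + κ * B + κ))), by positivity, ?_, ?_, ?_, ?_⟩
    · exact lt_of_le_of_lt ((min_le_left _ _).trans (min_le_left _ _)) (by norm_num)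
    · exact (min_le_left _ _).trans (min_le_right _ _)
    · rw [← le_div_iff₀ (by positivity)]
      exact (min_le_right _ _).trans (min_le_left _ _)
    · rw [← le_div_iff₀ (by positivity)]
      exact (min_le_right _ _).trans (min_le_right _ _)
  have hs1 : s ≤ 1 := by
    have : c ≤ 1 := by
      rw [hcd, contractionRate, div_le_one (by positivity)]
      nlinarith [mul_pos (by linarith : 0 < w₁) (by linarith : 0 < 2 * p - 1), mul_pos hq hq]
    rw [hsd]; nlinarith
  have hsB : (1 - s) * (1 + κ * B) ≤ 1 - t := by
    have : (1 - s) * (1 + κ * B) ≤ (1 - s) * (1 + s) :=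
      mul_le_mul_of_nonneg_left (by linarith) (by linarith)
    nlinarith
  set G : ℝ → ℝ := fun R => 1 + κ * (if R ≤ 1 - p then 0 else if R ≤ 1 / 2 then B
    else B + 1 / (2 * (1 - R))) with hG
  have Glow : ∀ R, R ≤ 1 - p → G R = 1 := by intro R hR; simp [hG, hR]
  have Gmid : ∀ R, 1 - p < R → R ≤ 1 / 2 → G R = 1 + κ * B := by
    intro R h1 h2; simp only [hG]; rw [if_neg (by linarith), if_pos h2]
  have Ghigh : ∀ R, 1 / 2 < R → G R = 1 + κ * (B + 1 / (2 * (1 - R))) := by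
    intro R h1; simp only [hG]; rw [if_neg (by linarith), if_neg (by linarith)]
  have Gle_near : ∀ R, R ≤ 1 / 2 → G R ≤ 1 + κ * B := by
    intro R hR
    by_cases h : R ≤ 1 - p
    · rw [Glow R h]; nlinarith [mul_pos hκ0 hB]
    · rw [Gmid R (by linarith) hR]
  have Gle : ∀ R, R < 1 → G R ≤ 1 + κ * (B + 1 / (2 * (1 - R))) := by
    intro R hR
    have hpos : 0 < 1 / (2 * (1 - R)) := by
      have : 0 < 1 - R := by linarith
      positivity
    by_cases h : R ≤ 1 / 2
    · refine (Gle_near R h).trans ?_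
      nlinarith [mul_pos hκ0 hpos]
    · rw [Ghigh R (by linarith)]
  have one_le : ∀ R, R < 1 → 1 ≤ G R := by
    intro R hR
    have hpos : 0 < 1 / (2 * (1 - R)) := by
      have : 0 < 1 - R := by linarith
      positivity
    simp only [hG]
    split_ifs
    · simp
    · linarith [mul_pos hκ0 hB]
    · linarith [mul_pos hκ0 (add_pos hB hpos)]
  refine ⟨1 - t, 1 + κ * B + κ, G, by positivity, by linarith, by linarith, one_le, ?_, ?_, ?_⟩
  · intro R hR0 hR1
    refine (Gle R hR1).trans ?_
    have h1 : 0 < 1 - R := by linarith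
    rw [le_div_iff₀ h1]
    have : (1 + κ * (B + 1 / (2 * (1 - R)))) * (1 - R) = (1 + κ * B) * (1 - R) + κ / 2 := by
      field_simp; ring
    rw [this]
    nlinarith [mul_nonneg (by positivity : 0 ≤ 1 + κ * B) hR0]
  · rintro w ⟨hwl, hwu⟩ R ⟨hR0, hR⟩ y yg yb hyg hyb hle hcon
    have hw0 : 0 < w := by linarith
    have hw' : 0 < 1 - w := by linarith
    have hy : 0 ≤ y := hyg.trans hle
    have h2p : 0 ≤ 2 * p - 1 := by linarith
    -- In the low range no verdict leads above `1/2`, because `2p(1-p) ≤ 1/2`.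
    by_cases hlow : R ≤ 1 - p
    · have h1 : G (2 * p * R) ≤ 1 + κ * B := by
        apply Gle_near
        have h4 : 2 * p * R ≤ 2 * p * (1 - p) := by gcongr
        linarith [sq_nonneg (2 * p - 1), h4]
      have h2 : G (2 * (1 - p) * R) ≤ 1 + κ * B := by
        apply Gle_near
        linarith [mul_nonneg hR0 h2p]
      have hb : 0 < 1 + κ * B := by positivity
      rw [Glow R hlow]
      have hsy : (1 - c * (1 / 2 - R)) * y ≤ (1 - s) * y := by
        apply mul_le_mul_of_nonneg_right _ hy
        rw [hsd]
        linarith [mul_nonneg hc.le (by linarith : 0 ≤ 1 - p - R)]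
      calc (1 - w) * (yg * G (2 * p * R)) + w * (yb * G (2 * (1 - p) * R))
          ≤ (1 - w) * (yg * (1 + κ * B)) + w * (yb * (1 + κ * B)) := by gcongr
        _ = ((1 - w) * yg + w * yb) * (1 + κ * B) := by ring
        _ ≤ ((1 - s) * y) * (1 + κ * B) :=
          mul_le_mul_of_nonneg_right (hcon.trans hsy) hb.le
        _ = ((1 - s) * (1 + κ * B)) * y := by ring
        _ ≤ (1 - t) * y := mul_le_mul_of_nonneg_right hsB hy
        _ = (1 - t) * (y * 1) := by ring
    · have hlow' : 1 - p < R := by linarith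
      have h1 : G (2 * p * R) ≤ 1 + κ * (B + e) := by
        have hRp : 2 * p * R ≤ p := by
          linarith [mul_nonneg (by linarith : 0 ≤ p) (by linarith : 0 ≤ 1 / 2 - R)]
        refine (Gle _ (by linarith)).trans ?_
        have : 1 / (2 * (1 - 2 * p * R)) ≤ e := by
          rw [hed]; apply one_div_le_one_div_of_le <;> linarith
        gcongr
      have h2 : G (2 * (1 - p) * R) = 1 :=
        Glow _ (by linarith [mul_nonneg hq.le (by linarith : 0 ≤ 1 / 2 - R)])
      rw [Gmid R hlow' hR, h2]
      have hcon' : (1 - w) * yg + w * yb ≤ y := by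
        refine hcon.trans ?_
        linarith [mul_nonneg (mul_nonneg hc.le (by linarith : 0 ≤ 1 / 2 - R)) hy]
      have hBe : (1 - w) * (B + e) ≤ B - w₀ * e := by
        have : (1 - w) * (B + e) ≤ (1 - w₀) * (B + e) := by gcongr
        linarith
      calc (1 - w) * (yg * G (2 * p * R)) + w * (yb * 1)
          ≤ (1 - w) * (yg * (1 + κ * (B + e))) + w * (yb * 1) := by gcongr
        _ = ((1 - w) * yg + w * yb) + κ * (yg * ((1 - w) * (B + e))) := by ring
        _ ≤ y + κ * (y * (B - w₀ * e)) := by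
          have h0 : 0 ≤ (1 - w) * (B + e) := by positivity
          have : yg * ((1 - w) * (B + e)) ≤ y * (B - w₀ * e) := mul_le_mul hle hBe h0 hy
          gcongr
        _ = y * (1 + κ * B) - y * (κ * (w₀ * e)) := by ring
        _ ≤ (1 - t) * (y * (1 + κ * B)) := by
          linarith [mul_nonneg hy (by linarith : 0 ≤ κ * (w₀ * e) - t * (1 + κ * B))]
  · rintro w ⟨hwl, hwu⟩ R hR hR1
    have hw0 : 0 < w := by linarith
    have hw' : 0 < 1 - w := by linarith
    have h1R : 0 < 1 - R := by linarith
    rw [Ghigh R hR]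
    have g1 := Gle (1 - 2 * p * (1 - R)) (by linarith [mul_pos (by linarith : 0 < p) h1R])
    have g2 := Gle (1 - 2 * (1 - p) * (1 - R)) (by linarith [mul_pos hq h1R])
    simp only [sub_sub_cancel] at g1 g2
    have hρ := sum_inv_factors_le hp hp1 hwu
    set x := 1 / (2 * (1 - R)) with hx
    have hx1 : 1 ≤ x := by rw [hx, le_div_iff₀ (by positivity)]; linarith
    calc (1 - w) * G (1 - 2 * p * (1 - R)) + w * G (1 - 2 * (1 - p) * (1 - R))
        ≤ (1 - w) * (1 + κ * (B + 1 / (2 * (2 * p * (1 - R)))))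
          + w * (1 + κ * (B + 1 / (2 * (2 * (1 - p) * (1 - R))))) := by gcongr
      _ = 1 + κ * B + κ * (((1 - w) / (2 * p) + w / (2 * (1 - p))) * x) := by
        rw [hx]; field_simp; ring
      _ ≤ 1 + κ * B + κ * ((1 - c / 2) * x) := by gcongr
      _ ≤ (1 - t) * (1 + κ * (B + x)) := by
        have : t * (1 + κ * B + κ * x) ≤ κ * (c / 2) * x := by
          calc t * (1 + κ * B + κ * x) ≤ t * ((1 + κ * B + κ) * x) := by
                apply mul_le_mul_of_nonneg_left _ ht0.le
                nlinarith [mul_nonneg (by positivity : 0 ≤ 1 + κ * B) (by linarith : 0 ≤ x - 1)]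
            _ ≤ _ := by nlinarith
        nlinarith

/-! ### Contraction of the potential for each position of the query point -/

section PotentialStep

variable {p w₀ w₁ r C : ℝ} {G : ℝ → ℝ}

lemma potential_nonneg (hG : IsWeight p w₀ w₁ r C G) {ℓ R : ℝ} (hℓ : 0 ≤ ℓ) (hA : ℓ + R < 1) :
    0 ≤ potential G ℓ R := by
  have := hG.one_le R (by linarith)
  have h : 0 < 1 - ℓ - R := by linarith
  unfold potential; positivity

lemma one_le_potential (hG : IsWeight p w₀ w₁ r C G) {ℓ R : ℝ} (hℓ : 1 / 2 ≤ ℓ) (hR : 0 ≤ R)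
    (hA : ℓ + R < 1) : 1 ≤ potential G ℓ R := by
  have := hG.one_le R (by linarith)
  have h : 0 < 1 - ℓ - R := by linarith
  have h2 : 1 ≤ ℓ / (1 - ℓ - R) := by rw [le_div_iff₀ h]; linarith
  unfold potential; nlinarith

/-- Used for the initial potential: `m` is a lower bound for the prior mass of the interval. One
factor `1 / m` comes from the ratio, the other from the growth of `G` near `R = 1`. -/
lemma potential_le (hG : IsWeight p w₀ w₁ r C G) (hC : 0 ≤ C) {ℓ R m : ℝ} (hℓ : 0 ≤ ℓ) (hR : 0 ≤ R)
    (hm : 0 < m) (hA : m ≤ 1 - ℓ - R) : potential G ℓ R ≤ C / m ^ 2 := by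
  have h1 := hG.one_le R (by linarith)
  have h2 := hG.le_div R hR (by linarith)
  have h3 : ℓ / (1 - ℓ - R) ≤ 1 / m := by gcongr; linarith
  have h4 : C / (1 - R) ≤ C / m := by gcongr; linarith
  unfold potential
  calc ℓ / (1 - ℓ - R) * G R ≤ 1 / m * (C / m) := by
        apply mul_le_mul h3 (h2.trans h4) (by linarith) (by positivity)
    _ = _ := by field_simp

lemma potential_step_far (hG : IsWeight p w₀ w₁ r C G) (hp : 1 / 2 < p) (hw₀ : 0 < w₀)
    (hw₁ : w₁ < 1 - p) {w ℓ R : ℝ} (hw : w ∈ Set.Icc w₀ w₁) (hℓ : 1 / 2 ≤ ℓ) (hR : 0 ≤ R)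
    (hA : ℓ + R < 1) :
    (1 - w) * potential G (1 - 2 * p * (1 - ℓ)) (2 * p * R)
      + w * potential G (1 - 2 * (1 - p) * (1 - ℓ)) (2 * (1 - p) * R) ≤ r * potential G ℓ R := by
  have hp1 : p < 1 := by linarith [hw.1, hw.2]
  have hA' : 0 < 1 - ℓ - R := by linarith
  have hq : 0 < 1 - p := by linarith
  unfold potential
  have e1 : ∀ q : ℝ, 1 - (1 - 2 * q * (1 - ℓ)) - 2 * q * R = 2 * q * (1 - ℓ - R) := by intro q; ring
  rw [e1, e1]
  apply hG.near w hw R ⟨hR, by linarith⟩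
  · exact div_nonneg (by nlinarith) (by positivity)
  · exact div_nonneg (by nlinarith) (by positivity)
  · exact ratio_decreases_far hp hA
  · exact ratio_contracts_far hp hp1 hw.2 hw₁ hℓ hR hA

lemma potential_step_mid (hG : IsWeight p w₀ w₁ r C G) (hp : 1 / 2 < p) (hw₀ : 0 < w₀)
    (hw₁ : w₁ < 1 - p) {w ℓ R : ℝ} (hw : w ∈ Set.Icc w₀ w₁) (hℓ0 : 0 ≤ ℓ) (hℓ : ℓ ≤ 1 / 2)
    (hR : 0 ≤ R) (hR' : R ≤ 1 / 2) (hA : ℓ + R < 1) :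
    (1 - w) * potential G (2 * (1 - p) * ℓ) (2 * p * R)
      + w * potential G (2 * p * ℓ) (2 * (1 - p) * R) ≤ r * potential G ℓ R := by
  have hp1 : p < 1 := by linarith [hw.1, hw.2]
  have hA' : 0 < 1 - ℓ - R := by linarith
  have hq : 0 < 1 - p := by linarith
  have hp0 : 0 < p := by linarith
  unfold potential
  apply hG.near w hw R ⟨hR, hR'⟩
  · exact div_nonneg (by positivity) (by nlinarith)
  · exact div_nonneg (by positivity) (by nlinarith)
  · exact ratio_decreases_mid hp hp1 hℓ0 hR' hA
  · exact ratio_contracts_mid hp hp1 (by linarith [hw.1]) hw.2 hw₁ hℓ0 hℓ hR hR' hA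

/-- Both `ℓ` and the interval lie on one side of the query point and are scaled alike, so only `G`
changes. -/
lemma potential_step_over (hG : IsWeight p w₀ w₁ r C G) (hp : 1 / 2 < p)
    (hp1 : p < 1) {w ℓ R : ℝ} (hw : w ∈ Set.Icc w₀ w₁) (hℓ0 : 0 ≤ ℓ)
    (hR' : 1 / 2 < R) (hA : ℓ + R < 1) :
    (1 - w) * potential G (2 * p * ℓ) (1 - 2 * p * (1 - R))
      + w * potential G (2 * (1 - p) * ℓ) (1 - 2 * (1 - p) * (1 - R)) ≤ r * potential G ℓ R := by
  have hA' : 0 < 1 - ℓ - R := by linarith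
  have hq : 0 < 1 - p := by linarith
  have hp0 : 0 < p := by linarith
  have e : ∀ q : ℝ, 0 < q → 2 * q * ℓ / (1 - 2 * q * ℓ - (1 - 2 * q * (1 - R))) = ℓ / (1 - ℓ - R) := by
    intro q hq
    have : 1 - 2 * q * ℓ - (1 - 2 * q * (1 - R)) = 2 * q * (1 - ℓ - R) := by ring
    rw [this]; field_simp
  unfold potential
  rw [e p hp0, e (1 - p) hq]
  have h := hG.opposite w hw R hR' (by linarith)
  have hY : 0 ≤ ℓ / (1 - ℓ - R) := by positivity
  nlinarith [mul_le_mul_of_nonneg_left h hY]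

end PotentialStep

end MAPB

namespace MAPB

/-! ### The boundary and the stopping rule -/

lemma barrier_arg_nonneg {η : ℝ} (hη₀ : 0 < η) (hη₁ : η < 1) (m : ℕ) :
    0 ≤ 2 * m * (Real.log (m + 1) - Real.log η) := by
  have h1 : 0 ≤ Real.log (m + 1) := Real.log_nonneg (by linarith [Nat.cast_nonneg (α := ℝ) m])
  have h2 : Real.log η < 0 := Real.log_neg hη₀ hη₁
  have : 0 ≤ Real.log (m + 1) - Real.log η := by linarith
  positivity

lemma barrier_sq {η : ℝ} (hη₀ : 0 < η) (hη₁ : η < 1) (m : ℕ) :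
    barrier η m ^ 2 = 2 * m * (Real.log (m + 1) - Real.log η) :=
  Real.sq_sqrt (barrier_arg_nonneg hη₀ hη₁ m)

lemma barrier_nonneg (η : ℝ) (m : ℕ) : 0 ≤ barrier η m := Real.sqrt_nonneg _

lemma barrier_pos {η : ℝ} (hη₀ : 0 < η) (hη₁ : η < 1) {m : ℕ} (hm : 1 ≤ m) : 0 < barrier η m := by
  have h1 : 0 ≤ Real.log (m + 1) := Real.log_nonneg (by linarith [Nat.cast_nonneg (α := ℝ) m])
  have h2 : Real.log η < 0 := Real.log_neg hη₀ hη₁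
  have : 0 < Real.log (m + 1) - Real.log η := by linarith
  have : (0 : ℝ) < m := by exact_mod_cast hm
  unfold barrier; positivity

lemma barrier_mono {η : ℝ} (hη₀ : 0 < η) (hη₁ : η < 1) {m n : ℕ} (h : m ≤ n) :
    barrier η m ≤ barrier η n := by
  apply Real.sqrt_le_sqrt
  have h1 : 0 ≤ Real.log (m + 1) := Real.log_nonneg (by linarith [Nat.cast_nonneg (α := ℝ) m])
  have h2 : Real.log η < 0 := Real.log_neg hη₀ hη₁
  have : 0 ≤ Real.log (m + 1) - Real.log η := by linarith
  have h3 : (m : ℝ) ≤ n := by exact_mod_cast h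
  have : (0 : ℝ) ≤ m := by positivity
  gcongr

/-- The test stops at time `m`. -/
def StopsAt (η : ℝ) (z : ℕ → ℝ) (m : ℕ) : Prop :=
  1 ≤ m ∧ barrier η m ≤ |walk z m| ∧ ∀ l, 1 ≤ l → l < m → |walk z l| < barrier η l

lemma StopsAt.testTime_eq {η : ℝ} {z : ℕ → ℝ} {m : ℕ} (h : StopsAt η z m) :
    testTime η z = m := by
  apply le_antisymm
  · exact iInf₂_le m ⟨h.1, h.2.1⟩
  · refine le_iInf₂ fun l hl => ?_
    by_contra hc
    have hlm : l < m := by exact_mod_cast not_le.1 hc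
    exact absurd hl.2 (not_le.2 (h.2.2 l hl.1 hlm))

lemma exists_stopsAt_of_exists {η : ℝ} {z : ℕ → ℝ}
    (h : ∃ m, 1 ≤ m ∧ barrier η m ≤ |walk z m|) : ∃ m, StopsAt η z m := by
  classical
  refine ⟨Nat.find h, (Nat.find_spec h).1, (Nat.find_spec h).2, fun l hl hlt => ?_⟩
  have := Nat.find_min h hlt
  push Not at this
  exact this hl

lemma exists_stopsAt {η : ℝ} {z : ℕ → ℝ} (h : testTime η z ≠ ⊤) : ∃ m, StopsAt η z m := by
  apply exists_stopsAt_of_exists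
  by_contra hc
  push Not at hc
  apply h
  refine iInf₂_eq_top.2 fun m hm => ?_
  exact absurd hm.2 (not_le.2 (hc m hm.1))

lemma StopsAt.testSignal_eq {η : ℝ} {z : ℕ → ℝ} {m : ℕ} (h : StopsAt η z m) :
    testSignal η z = SignType.sign (walk z m) := by
  have := h.testTime_eq
  simp [testSignal, this]

lemma testSignal_eq_neg_iff {η : ℝ} {z : ℕ → ℝ} :
    testSignal η z = SignType.neg ↔ ∃ m, StopsAt η z m ∧ walk z m < 0 := by
  constructor
  · intro h
    have ht : testTime η z ≠ ⊤ := by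
      intro ht
      rw [testSignal, if_pos ht] at h
      exact absurd h (by decide)
    obtain ⟨m, hm⟩ := exists_stopsAt ht
    refine ⟨m, hm, ?_⟩
    rw [hm.testSignal_eq] at h
    exact sign_eq_neg_one_iff.1 h
  · rintro ⟨m, hm, hneg⟩
    rw [hm.testSignal_eq]
    exact sign_eq_neg_one_iff.2 hneg

lemma testSignal_eq_pos_iff {η : ℝ} {z : ℕ → ℝ} :
    testSignal η z = SignType.pos ↔ ∃ m, StopsAt η z m ∧ 0 < walk z m := by
  constructor
  · intro h
    have ht : testTime η z ≠ ⊤ := by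
      intro ht
      rw [testSignal, if_pos ht] at h
      exact absurd h (by decide)
    obtain ⟨m, hm⟩ := exists_stopsAt ht
    refine ⟨m, hm, ?_⟩
    rw [hm.testSignal_eq] at h
    exact sign_eq_one_iff.1 h
  · rintro ⟨m, hm, hpos⟩
    rw [hm.testSignal_eq]
    exact sign_eq_one_iff.2 hpos

lemma testSignal_ne_zero {η : ℝ} (hη₀ : 0 < η) (hη₁ : η < 1) {z : ℕ → ℝ} (h : testTime η z ≠ ⊤) :
    testSignal η z = SignType.pos ∨ testSignal η z = SignType.neg := by
  obtain ⟨m, hm⟩ := exists_stopsAt h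
  have h0 : 0 < |walk z m| := (barrier_pos hη₀ hη₁ hm.1).trans_le hm.2.1
  rcases lt_or_gt_of_ne (abs_pos.1 h0) with hlt | hgt
  · exact Or.inr (testSignal_eq_neg_iff.2 ⟨m, hm, hlt⟩)
  · exact Or.inl (testSignal_eq_pos_iff.2 ⟨m, hm, hgt⟩)

lemma walk_neg (z : ℕ → ℝ) (m : ℕ) : walk (fun i => -z i) m = -walk z m := by
  simp [walk]

lemma stopsAt_neg_iff {η : ℝ} {z : ℕ → ℝ} {m : ℕ} :
    StopsAt η (fun i => -z i) m ↔ StopsAt η z m := by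
  simp [StopsAt, walk_neg]

lemma testSignal_eq_pos_iff_neg {η : ℝ} {z : ℕ → ℝ} :
    testSignal η z = SignType.pos ↔ testSignal η (fun i => -z i) = SignType.neg := by
  rw [testSignal_eq_pos_iff, testSignal_eq_neg_iff]
  simp [stopsAt_neg_iff, walk_neg]

lemma abs_walk_lt_of_lt_testTime {η : ℝ} {z : ℕ → ℝ} {n m : ℕ} (h : (n : ℕ∞) ≤ testTime η z)
    (hm : 1 ≤ m) (hmn : m < n) : |walk z m| < barrier η m := by
  by_contra hc
  have h2 : testTime η z ≤ (m : ℕ∞) := iInf₂_le m ⟨hm, not_lt.1 hc⟩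
  have : n ≤ m := by exact_mod_cast h.trans h2
  omega

lemma measurable_walk (m : ℕ) : Measurable fun z : ℕ → ℝ => walk z m := by
  unfold walk; fun_prop

lemma measurableSet_stopsAt (η : ℝ) (m : ℕ) : MeasurableSet {z : ℕ → ℝ | StopsAt η z m} := by
  have h : ∀ l, Measurable fun z : ℕ → ℝ => |walk z l| := fun l => (measurable_walk l).abs
  unfold StopsAt
  simp only [Set.ofPred_and, Set.ofPred_forall]
  refine (MeasurableSet.const _).inter ((measurableSet_le measurable_const (h m)).inter ?_)
  exact MeasurableSet.iInter fun l => MeasurableSet.iInter fun _ => MeasurableSet.iInter fun _ =>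
    measurableSet_lt (h l) measurable_const

lemma measurableSet_testSignal_neg (η : ℝ) :
    MeasurableSet {z : ℕ → ℝ | testSignal η z = SignType.neg} := by
  simp only [testSignal_eq_neg_iff, Set.ofPred_exists, Set.ofPred_and]
  exact MeasurableSet.iUnion fun m => (measurableSet_stopsAt η m).inter
    (measurableSet_lt (measurable_walk m) measurable_const)

lemma measurableSet_testSignal_pos (η : ℝ) :
    MeasurableSet {z : ℕ → ℝ | testSignal η z = SignType.pos} := by
  simp only [testSignal_eq_pos_iff, Set.ofPred_exists, Set.ofPred_and]
  exact MeasurableSet.iUnion fun m => (measurableSet_stopsAt η m).inter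
    (measurableSet_lt measurable_const (measurable_walk m))

/-! ### Error probability of the test -/

/-- The walk with `j` steps up and `k` steps down is outside the boundary. -/
def IsOutside (η : ℝ) (j k : ℕ) : Prop := 0 < j + k ∧ barrier η (j + k) ≤ |(j : ℝ) - k|

/-- Started after `j` steps up and `k` steps down, and continued by `z`, the walk leaves the
boundary on the lower side within `n` steps. -/
def LossBy (η : ℝ) : ℕ → ℕ → ℕ → (ℕ → ℝ) → Prop
  | 0, j, k, _ => IsOutside η j k ∧ j < k
  | n + 1, j, k, z => (IsOutside η j k ∧ j < k) ∨ (¬ IsOutside η j k ∧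
      ((z 0 = 1 ∧ LossBy η n (j + 1) k (fun i => z (i + 1))) ∨
        (z 0 = -1 ∧ LossBy η n j (k + 1) (fun i => z (i + 1)))))

open Classical in
/-- The probability of `LossBy` if the steps are independent and go down with probability `q`. -/
noncomputable def lossProb (η q : ℝ) : ℕ → ℕ → ℕ → ℝ
  | 0, j, k => if IsOutside η j k ∧ j < k then 1 else 0
  | n + 1, j, k => if IsOutside η j k then (if j < k then 1 else 0)
      else q * lossProb η q n j (k + 1) + (1 - q) * lossProb η q n (j + 1) k

lemma LossBy.succ {η : ℝ} : ∀ {n j k : ℕ} {z : ℕ → ℝ}, LossBy η n j k z → LossBy η (n + 1) j k z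
  | 0, _, _, _, h => Or.inl h
  | _ + 1, _, _, _, h => by
    rcases h with h | ⟨h0, h | h⟩
    · exact Or.inl h
    · exact Or.inr ⟨h0, Or.inl ⟨h.1, h.2.succ⟩⟩
    · exact Or.inr ⟨h0, Or.inr ⟨h.1, h.2.succ⟩⟩

lemma measurableSet_lossBy (η : ℝ) : ∀ n j k : ℕ, MeasurableSet {z : ℕ → ℝ | LossBy η n j k z}
  | 0, _, _ => MeasurableSet.const _
  | n + 1, j, k => by
    have hs : Measurable fun (z : ℕ → ℝ) (i : ℕ) => z (i + 1) := by fun_prop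
    have h0 : ∀ c : ℝ, MeasurableSet {z : ℕ → ℝ | z 0 = c} := fun c =>
      measurableSet_eq_fun (measurable_pi_apply 0) measurable_const
    exact (MeasurableSet.const _).union ((MeasurableSet.const _).inter
      (((h0 1).inter (hs (measurableSet_lossBy η n (j + 1) k))).union
        ((h0 (-1)).inter (hs (measurableSet_lossBy η n j (k + 1))))))

/-- Here `n` is the number of steps left before the stopping time `N`, so the induction runs
backwards along the path; of the past only the counts `j` and `k` matter. -/
lemma lossBy_of_stopsAt {η : ℝ} {z : ℕ → ℝ} (hz : ∀ i, z i = 1 ∨ z i = -1) {N : ℕ}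
    (hN : StopsAt η z N) (hneg : walk z N < 0) :
    ∀ n m j k : ℕ, m + n = N → j + k = m → walk z m = (j : ℝ) - k →
      LossBy η n j k (fun i => z (m + i)) := by
  intro n
  induction n with
  | zero =>
    intro m j k hm hjk hw
    rw [add_zero] at hm
    subst hm
    refine ⟨⟨by have := hN.1; omega, ?_⟩, ?_⟩
    · rw [hjk, ← hw]; exact hN.2.1
    · have : (j : ℝ) < k := by linarith
      exact_mod_cast this
  | succ n ih =>
    intro m j k hm hjk hw
    refine Or.inr ⟨?_, ?_⟩
    · rintro ⟨h1, h2⟩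
      rw [hjk] at h1 h2
      rw [← hw] at h2
      exact absurd h2 (not_le.2 (hN.2.2 m h1 (by omega)))
    · have hstep : walk z (m + 1) = walk z m + z m := Finset.sum_range_succ _ _
      have e : (fun i => z (m + (i + 1))) = fun i => z (m + 1 + i) := by
        funext i; congr 1; omega
      rcases hz m with h | h
      · left
        refine ⟨h, ?_⟩
        simp only [e]
        apply ih (m + 1) (j + 1) k (by omega) (by omega)
        rw [hstep, hw, h]; push_cast; ring
      · right
        refine ⟨h, ?_⟩
        simp only [e]
        apply ih (m + 1) j (k + 1) (by omega) (by omega)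
        rw [hstep, hw, h]; push_cast; ring

lemma lossProb_nonneg {η q : ℝ} (hq : q ∈ Set.Icc (0 : ℝ) 1) : ∀ n j k, 0 ≤ lossProb η q n j k
  | 0, j, k => by unfold lossProb; split_ifs <;> norm_num
  | n + 1, j, k => by
    have h1 := lossProb_nonneg (η := η) hq n j (k + 1)
    have h2 := lossProb_nonneg (η := η) hq n (j + 1) k
    have h3 : 0 ≤ 1 - q := by linarith [hq.2]
    have h4 := hq.1
    unfold lossProb; split_ifs <;> positivity

lemma lossProb_le_one {η q : ℝ} (hq : q ∈ Set.Icc (0 : ℝ) 1) : ∀ n j k, lossProb η q n j k ≤ 1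
  | 0, j, k => by unfold lossProb; split_ifs <;> norm_num
  | n + 1, j, k => by
    have h1 := lossProb_le_one (η := η) hq n j (k + 1)
    have h2 := lossProb_le_one (η := η) hq n (j + 1) k
    have h3 : 0 ≤ 1 - q := by linarith [hq.2]
    have h4 := hq.1
    unfold lossProb; split_ifs
    · exact le_rfl
    · exact zero_le_one
    · nlinarith

lemma lossProb_of_outside {η q : ℝ} {n j k : ℕ} (h : IsOutside η j k) :
    lossProb η q n j k = if j < k then 1 else 0 := by
  cases n <;> simp [lossProb, h]

/-- Monotone dependence on the starting point. A start already lost remains lost when an upward step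
is exchanged for a downward one, and a start outside on the upper side remains so under the opposite
exchange; between these cases the recursion preserves the inequality. -/
lemma lossProb_antitone {η q : ℝ} (hq : q ∈ Set.Icc (0 : ℝ) 1) :
    ∀ n j k, lossProb η q n (j + 1) k ≤ lossProb η q n j (k + 1) := by
  intro n
  induction n with
  | zero =>
    intro j k
    by_cases h1 : IsOutside η (j + 1) k
    · by_cases h2 : j + 1 < k
      · have h3 : IsOutside η j (k + 1) := by
          refine ⟨by omega, ?_⟩
          have e : j + (k + 1) = j + 1 + k := by ring
          rw [e]
          refine h1.2.trans ?_
          have : (j : ℝ) + 1 < k := by exact_mod_cast h2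
          push_cast
          rw [abs_of_neg (by linarith), abs_of_neg (by linarith)]; linarith
        rw [lossProb_of_outside h3, if_pos (by omega)]
        exact lossProb_le_one hq _ _ _
      · rw [lossProb_of_outside h1, if_neg h2]
        exact lossProb_nonneg hq _ _ _
    · simp only [lossProb, h1, false_and, if_false]
      split_ifs <;> norm_num
  | succ n ih =>
    intro j k
    by_cases h1 : IsOutside η (j + 1) k
    · by_cases h2 : j + 1 < k
      · have h3 : IsOutside η j (k + 1) := by
          refine ⟨by omega, ?_⟩
          have e : j + (k + 1) = j + 1 + k := by ring
          rw [e]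
          refine h1.2.trans ?_
          have : (j : ℝ) + 1 < k := by exact_mod_cast h2
          push_cast
          rw [abs_of_neg (by linarith), abs_of_neg (by linarith)]; linarith
        rw [lossProb_of_outside h3, if_pos (by omega)]
        exact lossProb_le_one hq _ _ _
      · rw [lossProb_of_outside h1, if_neg h2]
        exact lossProb_nonneg hq _ _ _
    · by_cases h3 : IsOutside η j (k + 1)
      · by_cases h4 : j < k + 1
        · rw [lossProb_of_outside h3, if_pos h4]
          exact lossProb_le_one hq _ _ _
        · exfalso
          apply h1
          refine ⟨by omega, ?_⟩
          have e : j + (k + 1) = j + 1 + k := by ring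
          have h5 := h3.2
          rw [e] at h5
          refine h5.trans ?_
          have : (k : ℝ) + 1 ≤ j := by exact_mod_cast not_lt.1 h4
          push_cast
          rw [abs_of_nonneg (by linarith), abs_of_nonneg (by linarith)]; linarith
      · simp only [lossProb, h1, h3, if_false]
        have a1 := ih j (k + 1)
        have a2 := ih (j + 1) k
        have h4 := hq.1
        have h5 : 0 ≤ 1 - q := by linarith [hq.2]
        gcongr

/-- By `lossProb_antitone` the recursion step is increasing in `q`, so the fair walk is the worst
case. -/
lemma lossProb_le_half {η q : ℝ} (hq : 0 ≤ q) (hq' : q ≤ 1 / 2) :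
    ∀ n j k, lossProb η q n j k ≤ lossProb η (1 / 2) n j k := by
  intro n
  induction n with
  | zero => intro j k; simp [lossProb]
  | succ n ih =>
    intro j k
    by_cases h : IsOutside η j k
    · rw [lossProb_of_outside h, lossProb_of_outside h]
    · simp only [lossProb, h, if_false]
      have a1 := ih j (k + 1)
      have a2 := ih (j + 1) k
      have a3 := lossProb_antitone (η := η) (q := 1 / 2) (by norm_num) n j k
      nlinarith [mul_le_mul_of_nonneg_left a1 hq,
        mul_le_mul_of_nonneg_left a2 (by linarith : 0 ≤ 1 - q),
        mul_nonneg (sub_nonneg.2 a3) (sub_nonneg.2 hq')]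

/-- The likelihood ratio of the uniform mixture of Bernoulli laws to the fair coin. -/
noncomputable def mixtureRatio (j k : ℕ) : ℝ :=
  2 ^ (j + k) * (j.factorial * k.factorial) / (j + k + 1).factorial

lemma mixtureRatio_pos (j k : ℕ) : 0 < mixtureRatio j k := by
  unfold mixtureRatio; positivity

/-- The ratio is `2^(j+k) ∫ x^j (1-x)^k dx` over `[0, 1]`, and the identity is `x + (1 - x) = 1`
under the integral. -/
lemma mixtureRatio_martingale (j k : ℕ) :
    1 / 2 * mixtureRatio j (k + 1) + 1 / 2 * mixtureRatio (j + 1) k = mixtureRatio j k := by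
  unfold mixtureRatio
  have e : j + 1 + k = j + (k + 1) := by ring
  rw [e]
  have e2 : j + (k + 1) + 1 = (j + k + 1) + 1 := by ring
  rw [e2, Nat.factorial_succ (j + k + 1), Nat.factorial_succ k, Nat.factorial_succ j]
  push_cast
  have : ((j + k + 1).factorial : ℝ) ≠ 0 := by positivity
  have h2 : (j : ℝ) + k + 1 + 1 ≠ 0 := by positivity
  field_simp
  ring

/-- A Chernoff bound: one term of a binomial expansion is at most the whole sum `(2 cosh t)^(j+k)`,
and `cosh t ≤ exp (t² / 2)`. -/
lemma choose_mul_exp_le (j k : ℕ) (t : ℝ) :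
    ((j + k).choose j : ℝ) * Real.exp (t * (j - k)) ≤ 2 ^ (j + k) * Real.exp ((j + k) * t ^ 2 / 2) := by
  have h1 : ((j + k).choose j : ℝ) * Real.exp (t * (j - k))
      ≤ (Real.exp t + Real.exp (-t)) ^ (j + k) := by
    rw [add_pow]
    have h := Finset.single_le_sum (f := fun i => Real.exp t ^ i * Real.exp (-t) ^ (j + k - i)
      * ((j + k).choose i : ℝ)) (s := Finset.range (j + k + 1)) (fun i _ => by positivity)
      (Finset.mem_range.2 (by omega : j < j + k + 1))
    refine le_trans (le_of_eq ?_) h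
    simp only [Nat.add_sub_cancel_left]
    rw [← Real.exp_nat_mul, ← Real.exp_nat_mul, ← Real.exp_add, mul_comm]
    congr 2; ring
  refine h1.trans ?_
  have h2 : Real.exp t + Real.exp (-t) = 2 * Real.cosh t := by rw [Real.cosh_eq]; ring
  rw [h2, mul_pow]
  have h3 : Real.cosh t ^ (j + k) ≤ Real.exp (t ^ 2 / 2) ^ (j + k) :=
    pow_le_pow_left₀ (Real.cosh_pos t).le (Real.cosh_le_exp_half_sq t) _
  rw [← Real.exp_nat_mul] at h3
  have e : ((j + k : ℕ) : ℝ) * (t ^ 2 / 2) = (j + k) * t ^ 2 / 2 := by push_cast; ring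
  rw [e] at h3
  gcongr

/-- This determines the form of the boundary. With the optimal `t = S / m` the Chernoff bound gives
`choose m j ≤ 2^m exp (-S² / (2m))`, and `|S| ≥ ħ_m` makes the exponential at most `η / (m + 1)`;
the factor `m + 1` is the price of the uniform mixture. -/
lemma one_le_mixtureRatio {η : ℝ} (hη₀ : 0 < η) (hη₁ : η < 1) {j k : ℕ} (h : IsOutside η j k) :
    1 ≤ η * mixtureRatio j k := by
  obtain ⟨hm, hb⟩ := h
  have hm0 : (0 : ℝ) < j + k := by exact_mod_cast hm
  have hsq : 2 * ((j + k : ℕ) : ℝ) * (Real.log ((j + k : ℕ) + 1) - Real.log η) ≤ ((j : ℝ) - k) ^ 2 := by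
    rw [← barrier_sq hη₀ hη₁, ← sq_abs ((j : ℝ) - k)]
    exact pow_le_pow_left₀ (barrier_nonneg _ _) hb 2
  have hch := choose_mul_exp_le j k (((j : ℝ) - k) / (j + k))
  set S := (j : ℝ) - k with hS
  push_cast at hsq
  set m := (j : ℝ) + k with hmd
  have e1 : S / m * S = S ^ 2 / m := by ring
  have e2 : m * (S / m) ^ 2 / 2 = S ^ 2 / m - S ^ 2 / (2 * m) := by field_simp; ring
  rw [e1, e2, Real.exp_sub, ← mul_div_assoc, le_div_iff₀ (Real.exp_pos _)] at hch
  have hch2 : ((j + k).choose j : ℝ) * Real.exp (S ^ 2 / (2 * m)) ≤ 2 ^ (j + k) := by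
    have hp := Real.exp_pos (S ^ 2 / m)
    nlinarith
  have hexp : (m + 1) / η ≤ Real.exp (S ^ 2 / (2 * m)) := by
    have : Real.log ((m + 1) / η) ≤ S ^ 2 / (2 * m) := by
      rw [Real.log_div (by positivity) hη₀.ne', le_div_iff₀ (by positivity)]
      linarith
    calc (m + 1) / η = Real.exp (Real.log ((m + 1) / η)) := (Real.exp_log (by positivity)).symm
      _ ≤ _ := Real.exp_le_exp.2 this
  have h3 : ((j + k).choose j : ℝ) * (m + 1) ≤ η * 2 ^ (j + k) := by
    have : ((j + k).choose j : ℝ) * ((m + 1) / η) ≤ 2 ^ (j + k) :=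
      le_trans (by gcongr) hch2
    rw [← mul_div_assoc, div_le_iff₀ hη₀] at this
    linarith
  have hfac : ((j + k).choose j : ℝ) * (j.factorial * k.factorial) = (j + k).factorial := by
    have := Nat.add_choose_mul_factorial_mul_factorial j k
    rw [Nat.choose_symm_add, ← mul_assoc]; exact_mod_cast this
  unfold mixtureRatio
  rw [← mul_div_assoc, le_div_iff₀ (by positivity), one_mul, Nat.factorial_succ]
  push_cast
  rw [← hfac, ← hmd]
  have hpos : (0 : ℝ) ≤ j.factorial * k.factorial := by positivity
  nlinarith [mul_le_mul_of_nonneg_right h3 hpos]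

lemma isOutside_swap {η : ℝ} {j k : ℕ} : IsOutside η k j ↔ IsOutside η j k := by
  unfold IsOutside; rw [add_comm k j, abs_sub_comm]

/-- For the fair walk, swapping the counts exchanges the two sides of the boundary, so the sum is
the probability of leaving on either side. It is dominated by `η` times the mixture martingale, as
in Ville's inequality. From the origin both terms agree, whence `η / 2` for each side. -/
lemma lossProb_half_add_swap {η : ℝ} (hη₀ : 0 < η) (hη₁ : η < 1) :
    ∀ n j k, lossProb η (1 / 2) n j k + lossProb η (1 / 2) n k j ≤ η * mixtureRatio j k := by
  have hout : ∀ n j k, IsOutside η j k →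
      lossProb η (1 / 2) n j k + lossProb η (1 / 2) n k j ≤ η * mixtureRatio j k := by
    intro n j k h
    rw [lossProb_of_outside h, lossProb_of_outside (isOutside_swap.2 h)]
    refine le_trans ?_ (one_le_mixtureRatio hη₀ hη₁ h)
    rcases lt_trichotomy j k with h1 | h1 | h1
    · rw [if_pos h1, if_neg (by omega)]; norm_num
    · rw [if_neg (by omega), if_neg (by omega)]; norm_num
    · rw [if_neg (by omega), if_pos h1]; norm_num
  intro n
  induction n with
  | zero =>
    intro j k
    by_cases h : IsOutside η j k
    · exact hout 0 j k h
    · have h' : ¬ IsOutside η k j := fun h' => h (isOutside_swap.2 h')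
      simp only [lossProb, h, h', false_and, if_false]
      linarith [mul_pos hη₀ (mixtureRatio_pos j k)]
  | succ n ih =>
    intro j k
    by_cases h : IsOutside η j k
    · exact hout _ j k h
    · have h' : ¬ IsOutside η k j := fun h' => h (isOutside_swap.2 h')
      simp only [lossProb, h, h', if_false]
      have a1 := ih j (k + 1)
      have a2 := ih (j + 1) k
      rw [← mixtureRatio_martingale j k]
      linarith

lemma lossProb_zero_le {η q : ℝ} (hη₀ : 0 < η) (hη₁ : η < 1) (hq : 0 ≤ q) (hq' : q ≤ 1 / 2) (n : ℕ) :
    lossProb η q n 0 0 ≤ η / 2 := by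
  have h1 := lossProb_le_half (η := η) hq hq' n 0 0
  have h2 := lossProb_half_add_swap hη₀ hη₁ n 0 0
  have h3 : mixtureRatio 0 0 = 1 := by simp [mixtureRatio]
  rw [h3] at h2
  linarith

/-! ### Probabilities of the verdicts of a walk with independent signs -/

section RandomWalk

variable {Ω : Type*} [mΩ : MeasurableSpace Ω] {P : Measure Ω} [IsProbabilityMeasure P]

/-- Induction on the horizon by conditioning on the first step, which is independent of the shifted
walk. -/
lemma prob_lossBy_le {η q : ℝ} (hq : q ∈ Set.Icc (0 : ℝ) 1) :
    ∀ (n j k : ℕ) (X : ℕ → Ω → ℝ), (∀ i, Measurable (X i)) → iIndepFun X P →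
      (∀ i, P.real {ω | X i ω = -1} = q) → (∀ i, P.real {ω | X i ω = 1} = 1 - q) →
      P.real {ω | LossBy η n j k (fun i => X i ω)} ≤ lossProb η q n j k := by
  intro n
  induction n with
  | zero =>
    intro j k X hX hi h1 h2
    by_cases h : IsOutside η j k ∧ j < k
    · simp only [lossProb, LossBy, h, true_and, if_true]; exact measureReal_le_one
    · simp [lossProb, LossBy, h]
  | succ n ih =>
    intro j k X hX hi h1 h2
    by_cases h : IsOutside η j k
    · by_cases h' : j < k
      · rw [lossProb_of_outside h, if_pos h']; exact measureReal_le_one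
      · simp [lossProb, LossBy, h, h']
    · simp only [lossProb, LossBy, h, if_false, false_and, not_false_eq_true, true_and, false_or]
      have hshift : iIndepFun (fun i => X (i + 1)) P :=
        hi.precomp (g := fun i => i + 1) (add_left_injective 1)
      have hle : ∀ i, MeasurableSpace.comap (X i) inferInstance ≤ mΩ := fun i => (hX i).comap_le
      have hind := indep_iSup_of_disjoint hle hi.iIndep
        (S := {0}) (T := {i | 1 ≤ i}) (by simp)
      have hpast : ∀ c : ℝ, MeasurableSet[⨆ i ∈ ({0} : Set ℕ),
          MeasurableSpace.comap (X i) inferInstance] {ω | X 0 ω = c} := by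
        intro c
        apply (le_iSup₂_of_le (f := fun i (_ : i ∈ ({0} : Set ℕ)) =>
          MeasurableSpace.comap (X i) inferInstance) 0 rfl le_rfl)
        exact ⟨{c}, measurableSet_singleton c, rfl⟩
      have hfut : ∀ j k, MeasurableSet[⨆ i ∈ {i : ℕ | 1 ≤ i},
          MeasurableSpace.comap (X i) inferInstance]
          {ω | LossBy η n j k (fun i => X (i + 1) ω)} := by
        intro j k
        have hm : Measurable[⨆ i ∈ {i : ℕ | 1 ≤ i}, MeasurableSpace.comap (X i) inferInstance]
            (fun ω i => X (i + 1) ω) := by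
          refine @measurable_pi_iff _ _ _ (_) _ _ |>.2 fun i => ?_
          exact Measurable.of_comap_le (le_iSup₂_of_le (f := fun i (_ : i ∈ {i : ℕ | 1 ≤ i}) =>
            MeasurableSpace.comap (X i) inferInstance) (i + 1) (Nat.le_add_left 1 i) le_rfl)
        exact hm (measurableSet_lossBy η n j k)
      have hprod : ∀ (c : ℝ) j k, P.real ({ω | X 0 ω = c} ∩
          {ω | LossBy η n j k (fun i => X (i + 1) ω)})
          = P.real {ω | X 0 ω = c} * P.real {ω | LossBy η n j k (fun i => X (i + 1) ω)} := by
        intro c j k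
        have := (Indep_iff _ _ P).1 hind _ _ (hpast c) (hfut j k)
        simp only [measureReal_def, this, ENNReal.toReal_mul]
      have hq1 : 0 ≤ 1 - q := by linarith [hq.2]
      have hq0 := hq.1
      rw [Set.ofPred_or]
      refine (measureReal_union_le _ _).trans ?_
      rw [Set.ofPred_and, Set.ofPred_and, hprod, hprod, h1, h2, add_comm]
      have b1 := ih j (k + 1) (fun i => X (i + 1)) (fun i => hX _) hshift (fun i => h1 _) (fun i => h2 _)
      have b2 := ih (j + 1) k (fun i => X (i + 1)) (fun i => hX _) hshift (fun i => h1 _) (fun i => h2 _)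
      gcongr

lemma prob_eq_one_of_signs {X : Ω → ℝ} (hX : Measurable X) (hv : ∀ ω, X ω = 1 ∨ X ω = -1) :
    P.real {ω | X ω = 1} = 1 - P.real {ω | X ω = -1} := by
  have : {ω | X ω = 1} = {ω | X ω = -1}ᶜ := by
    ext ω
    simp only [Set.mem_ofPred_eq, Set.mem_compl_iff]
    rcases hv ω with h | h <;> rw [h] <;> norm_num
  rw [this, probReal_compl_eq_one_sub (measurableSet_eq_fun hX measurable_const)]

/-- A walk without downward drift is stopped on the lower side with probability at most `η / 2`. -/
lemma prob_testSignal_neg_le {η q : ℝ} (hη₀ : 0 < η) (hη₁ : η < 1) (hq : q ≤ 1 / 2)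
    {X : ℕ → Ω → ℝ} (hX : ∀ i, Measurable (X i)) (hi : iIndepFun X P)
    (hv : ∀ i ω, X i ω = 1 ∨ X i ω = -1) (h1 : ∀ i, P.real {ω | X i ω = -1} = q) :
    P.real {ω | testSignal η (fun i => X i ω) = SignType.neg} ≤ η / 2 := by
  have hq0 : 0 ≤ q := by rw [← h1 0]; exact measureReal_nonneg
  have h2 : ∀ i, P.real {ω | X i ω = 1} = 1 - q := fun i => by
    rw [prob_eq_one_of_signs (hX i) (hv i), h1 i]
  have hsub : {ω | testSignal η (fun i => X i ω) = SignType.neg}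
      ⊆ ⋃ n, {ω | LossBy η n 0 0 (fun i => X i ω)} := by
    intro ω hω
    obtain ⟨N, hN, hneg⟩ := testSignal_eq_neg_iff.1 hω
    have := lossBy_of_stopsAt (fun i => hv i ω) hN hneg N 0 0 0 (by omega) rfl (by simp [walk])
    simp only [zero_add] at this
    exact Set.mem_iUnion.2 ⟨N, this⟩
  have hmono : Monotone fun n => {ω | LossBy η n 0 0 (fun i => X i ω)} :=
    monotone_nat_of_le_succ fun n ω h => LossBy.succ h
  have hle : P {ω | testSignal η (fun i => X i ω) = SignType.neg} ≤ ENNReal.ofReal (η / 2) := by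
    refine (measure_mono hsub).trans ?_
    rw [hmono.measure_iUnion]
    refine iSup_le fun n => ?_
    rw [← ofReal_measureReal]
    apply ENNReal.ofReal_le_ofReal
    exact (prob_lossBy_le ⟨hq0, by linarith⟩ n 0 0 X hX hi h1 h2).trans
      (lossProb_zero_le hη₀ hη₁ hq0 hq n)
  exact ENNReal.toReal_le_of_le_ofReal (by linarith) hle

/-- The boundary grows more slowly than `m`, so finitely many equal answers decide a test. Their
number depends on `η` only, which keeps the lower bound on the error probability uniform over all
settings. -/
lemma exists_barrier_le {η : ℝ} (hη₀ : 0 < η) (hη₁ : η < 1) : ∃ m : ℕ, 1 ≤ m ∧ barrier η m ≤ m := by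
  have h2 : Real.log η < 0 := Real.log_neg hη₀ hη₁
  obtain ⟨m, hm⟩ := exists_nat_ge (8 - 4 * Real.log η)
  refine ⟨m, ?_, ?_⟩
  · by_contra hc
    have : m = 0 := by omega
    subst this
    norm_num at hm
    linarith
  · have hm0 : (0 : ℝ) < m := by linarith
    apply Real.sqrt_le_iff.2 ⟨hm0.le, ?_⟩
    have hl := Real.log_le_sub_one_of_pos (by positivity : (0 : ℝ) < ((m : ℝ) + 1) / 4)
    rw [Real.log_div (by positivity) (by norm_num)] at hl
    have h4 : Real.log 4 ≤ 2 := by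
      have : Real.log 4 = 2 * Real.log 2 := by
        rw [show (4 : ℝ) = 2 ^ 2 by norm_num, Real.log_pow]; norm_num
      linarith [Real.log_two_lt_d9]
    nlinarith

/-- If the first `m` steps go down and `m` is outside the boundary, the verdict is negative. -/
lemma testSignal_neg_of_forall {η : ℝ} {m : ℕ} (hm : 1 ≤ m) (hb : barrier η m ≤ m) {z : ℕ → ℝ}
    (hz : ∀ i < m, z i = -1) : testSignal η z = SignType.neg := by
  have hw : ∀ l ≤ m, walk z l = -l := by
    intro l hl
    unfold walk
    rw [Finset.sum_congr rfl (g := fun _ => (-1 : ℝ))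
      (fun i hi => hz i ((Finset.mem_range.1 hi).trans_le hl))]
    simp
  obtain ⟨N, hN⟩ := exists_stopsAt_of_exists (η := η) (z := z) ⟨m, hm, by rw [hw m le_rfl]; simpa using hb⟩
  have hNm : N ≤ m := by
    by_contra hc
    have := hN.2.2 m hm (by omega)
    rw [hw m le_rfl, abs_neg, Nat.abs_cast] at this
    linarith
  refine testSignal_eq_neg_iff.2 ⟨N, hN, ?_⟩
  rw [hw N hNm]
  have : (0 : ℝ) < N := by exact_mod_cast hN.1
  linarith

lemma le_prob_testSignal_neg {η q : ℝ} {m : ℕ} (hm : 1 ≤ m) (hb : barrier η m ≤ m)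
    {X : ℕ → Ω → ℝ} (hi : iIndepFun X P)
    (h1 : ∀ i, P.real {ω | X i ω = -1} = q) :
    q ^ m ≤ P.real {ω | testSignal η (fun i => X i ω) = SignType.neg} := by
  have h := hi.measure_inter_preimage_eq_mul (Finset.range m) (sets := fun _ => {(-1 : ℝ)})
    (fun i _ => measurableSet_singleton _)
  have hsub : (⋂ i ∈ Finset.range m, X i ⁻¹' {(-1 : ℝ)})
      ⊆ {ω | testSignal η (fun i => X i ω) = SignType.neg} := by
    intro ω hω
    simp only [Set.mem_iInter] at hω
    exact testSignal_neg_of_forall hm hb fun i hi => hω i (Finset.mem_range.2 hi)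
  refine le_trans (le_of_eq ?_) (measureReal_mono hsub)
  rw [measureReal_def, h, ENNReal.toReal_prod]
  have h2 : ∀ i, (P (X i ⁻¹' {(-1 : ℝ)})).toReal = q := h1
  simp [h2]

end RandomWalk

end MAPB

namespace MAPB

/-! ### The law of one comparison -/

section Gumbel

variable {Ω : Type*} [mΩ : MeasurableSpace Ω] {P : Measure Ω} [IsProbabilityMeasure P]

/-- The law is given through `X ≤ x` only; continuity of this distribution function excludes atoms,
so strict and weak inequalities have equal probability. -/
lemma HasGumbelLaw.prob_eq_zero {X : Ω → ℝ} {γ : ℝ} (hX : HasGumbelLaw P X γ) (c : ℝ) :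
    P.real {ω | X ω = c} = 0 := by
  obtain ⟨hm, hF⟩ := hX
  have hle : ∀ x < c, P.real {ω | X ω = c}
      ≤ Real.exp (-Real.exp (-c / γ)) - Real.exp (-Real.exp (-x / γ)) := by
    intro x hx
    have hd : Disjoint {ω | X ω = c} {ω | X ω ≤ x} := by
      rw [Set.disjoint_left]
      intro ω (h1 : X ω = c) (h2 : X ω ≤ x)
      linarith
    have hu := measureReal_union (μ := P) hd (measurableSet_le hm measurable_const)
    have hs : P.real ({ω | X ω = c} ∪ {ω | X ω ≤ x}) ≤ P.real {ω | X ω ≤ c} := by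
      refine measureReal_mono ?_
      rintro ω (h | h)
      · exact le_of_eq h
      · exact le_trans h hx.le
    rw [hu, hF, hF] at hs
    linarith
  have hcont : Continuous fun x : ℝ =>
      Real.exp (-Real.exp (-c / γ)) - Real.exp (-Real.exp (-x / γ)) := by fun_prop
  have ht : Filter.Tendsto (fun x : ℝ =>
      Real.exp (-Real.exp (-c / γ)) - Real.exp (-Real.exp (-x / γ))) (nhdsWithin c (Set.Iio c))
      (nhds 0) := by
    have := (hcont.tendsto c).mono_left (nhdsWithin_le_nhds (s := Set.Iio c))
    simpa using this
  refine le_antisymm ?_ measureReal_nonneg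
  exact ge_of_tendsto ht (Filter.eventually_of_mem self_mem_nhdsWithin hle)

lemma HasGumbelLaw.prob_lt {X : Ω → ℝ} {γ : ℝ} (hX : HasGumbelLaw P X γ) (c : ℝ) :
    P.real {ω | X ω < c} = Real.exp (-Real.exp (-c / γ)) := by
  rw [← hX.2 c]
  apply le_antisymm
  · exact measureReal_mono fun ω (h : X ω < c) => h.le
  · have : {ω | X ω ≤ c} ⊆ {ω | X ω < c} ∪ {ω | X ω = c} := fun ω (h : X ω ≤ c) =>
      lt_or_eq_of_le h
    refine (measureReal_mono this).trans ((measureReal_union_le _ _).trans ?_)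
    rw [hX.prob_eq_zero c, add_zero]

/-- The exponential of the negative of a Gumbel variable is exponentially distributed. -/
lemma HasGumbelLaw.map_exp {X : Ω → ℝ} {γ : ℝ} (hγ : 0 < γ) (hX : HasGumbelLaw P X γ) :
    P.map (fun ω => Real.exp (-X ω / γ)) = expMeasure 1 := by
  have hm : Measurable fun ω => Real.exp (-X ω / γ) :=
    Real.measurable_exp.comp (hX.1.neg.div_const γ)
  have : IsProbabilityMeasure (P.map fun ω => Real.exp (-X ω / γ)) :=
    Measure.isProbabilityMeasure_map hm.aemeasurable
  have := isProbabilityMeasure_expMeasure one_pos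
  apply Measure.eq_of_cdf
  ext x
  rw [cdf_expMeasure_eq one_pos, cdf_eq_real, map_measureReal_apply hm measurableSet_Iic]
  rcases le_or_gt x 0 with hx | hx
  · have : (fun ω => Real.exp (-X ω / γ)) ⁻¹' Set.Iic x = ∅ := by
      ext ω
      simp only [Set.mem_preimage, Set.mem_Iic, Set.mem_empty_iff_false, iff_false, not_le]
      exact hx.trans_lt (Real.exp_pos _)
    rw [this, measureReal_empty]
    split_ifs with h
    · have : x = 0 := le_antisymm hx h
      simp [this]
    · rfl
  · have : (fun ω => Real.exp (-X ω / γ)) ⁻¹' Set.Iic x = {ω | X ω < -(γ * Real.log x)}ᶜ := by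
      ext ω
      simp only [Set.mem_preimage, Set.mem_Iic, Set.mem_compl_iff, Set.mem_ofPred_eq, not_lt]
      rw [← Real.le_log_iff_exp_le hx, div_le_iff₀ hγ]
      constructor <;> intro h <;> linarith
    rw [this, probReal_compl_eq_one_sub (measurableSet_lt hX.1 measurable_const), hX.prob_lt,
      if_pos hx.le]
    have : -(-(γ * Real.log x)) / γ = Real.log x := by field_simp
    rw [this, Real.exp_log hx, one_mul]

lemma expMeasure_one_Ioi {a : ℝ} (ha : 0 ≤ a) :
    expMeasure 1 (Set.Ioi a) = ENNReal.ofReal (Real.exp (-a)) := by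
  have := isProbabilityMeasure_expMeasure one_pos
  have h := cdf_expMeasure_eq one_pos a
  rw [cdf_eq_real, if_pos ha, one_mul] at h
  rw [← Set.compl_Iic, ← ofReal_measureReal, probReal_compl_eq_one_sub measurableSet_Iic, h]
  congr 1; ring

/-- For independent standard exponentials this is the probability that one exceeds `s` times the
other, the integral of `exp (-(1 + s) y)` over the half-line. -/
lemma lintegral_exp_expMeasure {s : ℝ} (hs : 0 < s) :
    ∫⁻ y, expMeasure 1 (Set.Ioi (s * y)) ∂(expMeasure 1) = ENNReal.ofReal (1 / (1 + s)) := by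
  have e : expMeasure 1 = volume.withDensity (exponentialPDF 1) := rfl
  have hpdf : Measurable (exponentialPDF 1) :=
    (measurable_exponentialPDFReal 1).ennreal_ofReal
  have hmeas : Measurable fun y : ℝ => expMeasure 1 (Set.Ioi (s * y)) := by
    have : Antitone fun y : ℝ => expMeasure 1 (Set.Ioi (s * y)) := fun a b h =>
      measure_mono (Set.Ioi_subset_Ioi (by gcongr))
    exact this.measurable
  have h1 : ∫⁻ y, expMeasure 1 (Set.Ioi (s * y)) ∂(expMeasure 1)
      = ∫⁻ y, exponentialPDF 1 y * expMeasure 1 (Set.Ioi (s * y)) := by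
    conv_lhs => rw [e]
    rw [lintegral_withDensity_eq_lintegral_mul _ hpdf (by rw [← e]; exact hmeas)]
    rfl
  have h2 : (fun y => exponentialPDF 1 y * expMeasure 1 (Set.Ioi (s * y)))
      = Set.indicator (Set.Ici 0) fun y => ENNReal.ofReal (Real.exp (-(1 + s) * y)) := by
    funext y
    rcases lt_or_ge y 0 with hy | hy
    · rw [exponentialPDF_of_neg hy, zero_mul, Set.indicator_of_notMem (by simpa using hy)]
    · rw [exponentialPDF_of_nonneg hy, Set.indicator_of_mem (by simpa using hy),
        expMeasure_one_Ioi (by positivity), ← ENNReal.ofReal_mul (by positivity), one_mul, one_mul,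
        ← Real.exp_add]
      congr 2; ring
  have hneg : -(1 + s) < 0 := by linarith
  rw [h1, h2, lintegral_indicator measurableSet_Ici, setLIntegral_congr Ioi_ae_eq_Ici.symm,
    ← ofReal_integral_eq_lintegral_ofReal (integrableOn_exp_mul_Ioi hneg 0)
      (Filter.Eventually.of_forall fun y => (Real.exp_pos _).le), integral_exp_mul_Ioi hneg]
  congr 1
  rw [mul_zero, Real.exp_zero, neg_div_neg_eq]

/-- Two utilities with independent Gumbel noises are compared according to the logistic law. -/
lemma prob_gumbel_lt_add {X Y : Ω → ℝ} {γ : ℝ} (hγ : 0 < γ) (hX : HasGumbelLaw P X γ)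
    (hY : HasGumbelLaw P Y γ) (hXY : IndepFun X Y P) (D : ℝ) :
    P.real {ω | X ω < Y ω + D} = 1 / (1 + Real.exp (-D / γ)) := by
  have hf : Measurable fun x : ℝ => Real.exp (-x / γ) := by fun_prop
  have hWX : Measurable fun ω => Real.exp (-X ω / γ) := hf.comp hX.1
  have hWY : Measurable fun ω => Real.exp (-Y ω / γ) := hf.comp hY.1
  have hind : IndepFun (fun ω => Real.exp (-Y ω / γ)) (fun ω => Real.exp (-X ω / γ)) P :=
    (hXY.comp hf hf).symm
  have hmap := (indepFun_iff_map_prod_eq_prod_map_map hWY.aemeasurable hWX.aemeasurable).1 hind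
  rw [hX.map_exp hγ, hY.map_exp hγ] at hmap
  set s := Real.exp (-D / γ) with hs
  have hset : MeasurableSet {q : ℝ × ℝ | s * q.1 < q.2} :=
    measurableSet_lt (by fun_prop) (by fun_prop)
  have hev : {ω | X ω < Y ω + D} = (fun ω => (Real.exp (-Y ω / γ), Real.exp (-X ω / γ))) ⁻¹'
      {q : ℝ × ℝ | s * q.1 < q.2} := by
    ext ω
    simp only [Set.mem_preimage, Set.mem_ofPred_eq]
    rw [hs, ← Real.exp_add, Real.exp_lt_exp, ← add_div, div_lt_div_iff_of_pos_right hγ]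
    constructor <;> intro h <;> linarith
  have := isProbabilityMeasure_expMeasure one_pos
  rw [measureReal_def, hev, ← Measure.map_apply (hWY.prodMk hWX) hset, hmap,
    Measure.prod_apply hset]
  have h3 : (fun y : ℝ => expMeasure 1 (Prod.mk y ⁻¹' {q : ℝ × ℝ | s * q.1 < q.2}))
      = fun y => expMeasure 1 (Set.Ioi (s * y)) := rfl
  rw [h3, lintegral_exp_expMeasure (Real.exp_pos _), ENNReal.toReal_ofReal (by positivity)]

end Gumbel

/-! ### Independence of blocks -/

/-- Each answer depends on a block of two noises; joint independence passes from noises to disjoint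
blocks by adding one block at a time. -/
lemma iIndep_iSup_of_pairwise_disjoint {Ω ι κ : Type*} {mΩ : MeasurableSpace Ω} {P : Measure Ω}
    [IsProbabilityMeasure P] {m : ι → MeasurableSpace Ω} (hle : ∀ i, m i ≤ mΩ) (hm : iIndep m P)
    {S : κ → Set ι} (hS : Pairwise fun a b => Disjoint (S a) (S b)) :
    iIndep (fun a => ⨆ i ∈ S a, m i) P := by
  classical
  rw [iIndep_iff]
  intro s
  induction s using Finset.induction_on with
  | empty => intro f _; simp
  | insert a s ha ih =>
    intro f hf
    rw [Finset.set_biInter_insert, Finset.prod_insert ha,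
      ← ih fun i hi => hf i (Finset.mem_insert_of_mem hi)]
    have hd : Disjoint (S a) (⋃ b ∈ s, S b) := by
      simp only [Set.disjoint_iUnion_right]
      intro b hb
      exact hS (fun h => ha (h ▸ hb))
    refine (Indep_iff _ _ P).1 (indep_iSup_of_disjoint hle hm hd) _ _
      (hf a (Finset.mem_insert_self a s)) ?_
    refine @MeasurableSet.biInter _ _ (_) _ _ s.countable_toSet fun b hb => ?_
    have hmono : (⨆ i ∈ S b, m i) ≤ ⨆ i ∈ ⋃ b ∈ s, S b, m i :=
      biSup_mono fun i hi => Set.mem_biUnion hb hi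
    exact hmono _ (hf b (Finset.mem_insert_of_mem hb))

/-! ### Information generated by the tests, and measurability of the answers -/

section Information

variable {Ω : Type*} {ξ : ℕ × ℕ × Bool → Ω → ℝ} {d : ℝ → ℝ → ℝ} {θs : ℝ} {cm cp : ℝ → ℝ}

/-- The events decided by the `k`-th test. -/
@[reducible] def testInfo (ξ : ℕ × ℕ × Bool → Ω → ℝ) (k : ℕ) : MeasurableSpace Ω :=
  ⨆ j ∈ {j : ℕ × ℕ × Bool | j.1 = k}, MeasurableSpace.comap (ξ j) inferInstance

lemma testInfo_le_pastInfo {k n : ℕ} (h : k < n) :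
    testInfo ξ k ≤ pastInfo ξ n := by
  refine iSup₂_le fun j hj => ?_
  have hj' : j.1 = k := hj
  exact le_iSup (fun j : {j : ℕ × ℕ × Bool // j.1 < n} =>
    MeasurableSpace.comap (ξ j) inferInstance) ⟨j, by omega⟩

lemma pastInfo_mono {k n : ℕ} (h : k ≤ n) :
    pastInfo ξ k ≤ pastInfo ξ n := by
  refine iSup_le fun j => ?_
  exact le_iSup (fun j : {j : ℕ × ℕ × Bool // j.1 < n} =>
    MeasurableSpace.comap (ξ j) inferInstance) ⟨j, j.2.trans_le h⟩

lemma response_eq_or (x : ℕ × ℕ × Bool → ℝ) (k : ℕ) (θ : ℝ) (i : ℕ) :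
    response d θs cm cp x k θ i = 1 ∨ response d θs cm cp x k θ i = -1 := by
  unfold response; split_ifs <;> simp

lemma measurable_response_of {m : MeasurableSpace Ω} {k i : ℕ} {θ : ℝ}
    (hf : Measurable[m] (ξ (k, i, false))) (ht : Measurable[m] (ξ (k, i, true))) :
    Measurable[m] fun ω => response d θs cm cp (fun j => ξ j ω) k θ i := by
  unfold response
  exact Measurable.ite (measurableSet_lt (measurable_const.add hf) (measurable_const.add ht))
    measurable_const measurable_const

lemma measurable_response_testInfo (k i : ℕ) (θ : ℝ) :
    Measurable[testInfo ξ k] fun ω => response d θs cm cp (fun j => ξ j ω) k θ i := by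
  have h : ∀ b, Measurable[testInfo ξ k] (ξ (k, i, b)) := fun b =>
    Measurable.of_comap_le (le_iSup₂_of_le (f := fun j (_ : j ∈ {j : ℕ × ℕ × Bool | j.1 = k}) =>
      MeasurableSpace.comap (ξ j) inferInstance) (k, i, b) rfl le_rfl)
  exact measurable_response_of (h _) (h _)

lemma measurable_responses_testInfo (k : ℕ) (θ : ℝ) :
    Measurable[testInfo ξ k] fun ω => response d θs cm cp (fun j => ξ j ω) k θ :=
  @measurable_pi_iff _ _ _ (testInfo ξ k) _ _ |>.2 fun i => measurable_response_testInfo k i θ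

lemma IsNoise.comap_le {mΩ : MeasurableSpace Ω} {P : Measure Ω} {γ : ℝ} (h : IsNoise P γ ξ) (j : ℕ × ℕ × Bool) :
    MeasurableSpace.comap (ξ j) inferInstance ≤ mΩ := (h.1 j).1.comap_le

lemma IsNoise.measurable_response {_ : MeasurableSpace Ω} {P : Measure Ω} {γ : ℝ}
    (h : IsNoise P γ ξ)
    (k i : ℕ) (θ : ℝ) :
    Measurable fun ω => response d θs cm cp (fun j => ξ j ω) k θ i :=
  measurable_response_of (h.1 _).1 (h.1 _).1

end Information

/-! ### Independence and law of the answers -/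

section Noise

variable {Ω : Type*} [mΩ : MeasurableSpace Ω] {P : Measure Ω} [IsProbabilityMeasure P]
  {γ : ℝ} {ξ : ℕ × ℕ × Bool → Ω → ℝ}

lemma IsNoise.pastInfo_le (h : IsNoise P γ ξ) (k : ℕ) : pastInfo ξ k ≤ mΩ :=
  iSup_le fun j => h.comap_le j

lemma IsNoise.testInfo_le (h : IsNoise P γ ξ) (k : ℕ) : testInfo ξ k ≤ mΩ :=
  iSup₂_le fun j _ => h.comap_le j

/-- A test is independent of the earlier tests. -/
lemma IsNoise.prob_inter (h : IsNoise P γ ξ) {k : ℕ} {A B : Set Ω}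
    (hA : MeasurableSet[pastInfo ξ k] A) (hB : MeasurableSet[testInfo ξ k] B) :
    P.real (A ∩ B) = P.real A * P.real B := by
  have hd : Disjoint {j : ℕ × ℕ × Bool | j.1 < k} {j | j.1 = k} := by
    rw [Set.disjoint_left]
    intro j (h1 : j.1 < k) (h2 : j.1 = k)
    omega
  have hind := indep_iSup_of_disjoint h.comap_le h.2.iIndep hd
  have e : pastInfo ξ k = ⨆ j ∈ {j : ℕ × ℕ × Bool | j.1 < k},
      MeasurableSpace.comap (ξ j) inferInstance :=
    iSup_subtype' (p := fun j : ℕ × ℕ × Bool => j.1 < k)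
      (f := fun j _ => MeasurableSpace.comap (ξ j) inferInstance) |>.symm
  rw [e] at hA
  have := (Indep_iff _ _ P).1 hind A B hA hB
  simp only [measureReal_def, this, ENNReal.toReal_mul]

variable {d : ℝ → ℝ → ℝ} {θs : ℝ} {cm cp : ℝ → ℝ}

/-- The answers of one test are independent. -/
lemma IsNoise.iIndepFun_response (h : IsNoise P γ ξ) (k : ℕ) (θ : ℝ) :
    iIndepFun (fun i ω => response d θs cm cp (fun j => ξ j ω) k θ i) P := by
  have hS : Pairwise fun a b : ℕ => Disjoint {j : ℕ × ℕ × Bool | j.1 = k ∧ j.2.1 = a}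
      {j | j.1 = k ∧ j.2.1 = b} := by
    intro a b hab
    rw [Set.disjoint_left]
    intro j (h1 : j.1 = k ∧ j.2.1 = a) (h2 : j.1 = k ∧ j.2.1 = b)
    exact hab (h1.2.symm.trans h2.2)
  have hi := iIndep_iSup_of_pairwise_disjoint h.comap_le h.2.iIndep hS
  rw [iIndepFun_iff_iIndep]
  refine iIndep_of_iIndep_of_le hi fun i => ?_
  apply Measurable.comap_le
  have hb : ∀ b, Measurable[⨆ j ∈ {j : ℕ × ℕ × Bool | j.1 = k ∧ j.2.1 = i},
      MeasurableSpace.comap (ξ j) inferInstance] (ξ (k, i, b)) := fun b =>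
    Measurable.of_comap_le (le_iSup₂_of_le (f := fun j (_ : j ∈ {j : ℕ × ℕ × Bool |
      j.1 = k ∧ j.2.1 = i}) => MeasurableSpace.comap (ξ j) inferInstance) (k, i, b) ⟨rfl, rfl⟩ le_rfl)
  exact measurable_response_of (hb _) (hb _)

lemma IsNoise.prob_response_one (h : IsNoise P γ ξ) (hγ : 0 < γ) (k i : ℕ) (θ : ℝ) :
    P.real {ω | response d θs cm cp (fun j => ξ j ω) k θ i = 1}
      = 1 / (1 + Real.exp (-(utility d θs (cp θ) - utility d θs (cm θ)) / γ)) := by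
  rw [← prob_gumbel_lt_add hγ (h.1 (k, i, false)) (h.1 (k, i, true))
    (h.2.indepFun (by simp))]
  congr 1
  ext ω
  simp only [Set.mem_ofPred_eq, response]
  split_ifs with hc
  · simp only [true_iff]; linarith
  · refine ⟨fun hx => by norm_num at hx, fun hx => absurd ?_ hc⟩
    linarith

lemma IsNoise.prob_response_neg_one (h : IsNoise P γ ξ) (hγ : 0 < γ) (k i : ℕ) (θ : ℝ) :
    P.real {ω | response d θs cm cp (fun j => ξ j ω) k θ i = -1}
      = 1 / (1 + Real.exp ((utility d θs (cp θ) - utility d θs (cm θ)) / γ)) := by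
  have h1 := prob_eq_one_of_signs (P := P) (h.measurable_response (d := d) (θs := θs) (cm := cm)
    (cp := cp) k i θ) (fun ω => response_eq_or _ _ _ _)
  rw [h.prob_response_one hγ] at h1
  have h2 : P.real {ω | response d θs cm cp (fun j => ξ j ω) k θ i = -1}
      = 1 - 1 / (1 + Real.exp (-(utility d θs (cp θ) - utility d θs (cm θ)) / γ)) := by linarith
  rw [h2, neg_div, Real.exp_neg]
  have := Real.exp_pos ((utility d θs (cp θ) - utility d θs (cm θ)) / γ)
  field_simp
  ring

end Noise

/-! ### The two options on either side of a query point -/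

section Utility

variable {d : ℝ → ℝ → ℝ} {Δ β θs θ : ℝ} {cm cp : ℝ → ℝ}

/-- The options are at most `Δ` apart, so no comparison is too easy. This yields an error
probability bounded below in terms of `Δ / γ`. -/
lemma abs_utility_sub_le (hd : IsDistance d) (hc : IsComparisonPair d Δ β cm cp)
    (hθ : θ ∈ Set.Icc (-β) β) :
    |utility d θs (cp θ) - utility d θs (cm θ)| ≤ Δ := by
  obtain ⟨_, _, h3, h4⟩ := hc θ hθ
  have hcc : d (cm θ) (cp θ) ≤ Δ := by
    have := hd.triangle (cm θ) θ (cp θ)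
    rw [hd.symm θ (cp θ)] at this
    linarith
  have h5 := hd.triangle (cm θ) (cp θ) θs
  have h6 := hd.triangle (cp θ) (cm θ) θs
  rw [hd.symm (cp θ) (cm θ)] at h6
  unfold utility
  rw [abs_le]
  constructor <;> linarith

/-- If `θ*` lies beyond the right option, monotonicity suffices. Otherwise `θ*` is between `θ` and
`cp θ`, hence within `Δ / 2` of the right option and at least `Δ / 2` from the left one. -/
lemma utility_le_of_le (hd : IsDistance d) (hc : IsComparisonPair d Δ β cm cp)
    (hθ : θ ∈ Set.Icc (-β) β) (h : θ ≤ θs) : utility d θs (cm θ) ≤ utility d θs (cp θ) := by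
  obtain ⟨h1, h2, h3, h4⟩ := hc θ hθ
  unfold utility
  rw [neg_le_neg_iff]
  rcases eq_or_lt_of_le h with h | h
  · subst h; linarith
  rcases le_or_gt (cp θ) θs with h5 | h5
  · rcases eq_or_lt_of_le h5 with h6 | h6
    · rw [h6, (hd.eq_zero_iff θs θs).2 rfl]; exact hd.nonneg _ _
    · exact (hd.mono_left (cm θ) (cp θ) θs (h1.trans h2) h6).le
  · have h6 := hd.mono_right (cm θ) θ θs h1 h
    have h7 := hd.mono_left θ θs (cp θ) h h5
    rw [hd.symm (cp θ) θs]
    rw [hd.symm θ (cp θ)] at h7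
    linarith

lemma utility_le_of_ge (hd : IsDistance d) (hc : IsComparisonPair d Δ β cm cp)
    (hθ : θ ∈ Set.Icc (-β) β) (h : θs ≤ θ) : utility d θs (cp θ) ≤ utility d θs (cm θ) := by
  obtain ⟨h1, h2, h3, h4⟩ := hc θ hθ
  unfold utility
  rw [neg_le_neg_iff]
  rcases eq_or_lt_of_le h with h | h
  · subst h; linarith
  rcases le_or_gt θs (cm θ) with h5 | h5
  · rcases eq_or_lt_of_le h5 with h6 | h6
    · rw [← h6, (hd.eq_zero_iff θs θs).2 rfl]; exact hd.nonneg _ _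
    · rw [hd.symm (cm θ), hd.symm (cp θ)]
      exact (hd.mono_right θs (cm θ) (cp θ) h6 (h1.trans h2)).le
  · have h6 := hd.mono_left θs θ (cp θ) h h2
    have h7 := hd.mono_right (cm θ) θs θ h5 h
    rw [hd.symm (cp θ) θs]
    rw [hd.symm θ (cp θ)] at h6
    linarith

end Utility

/-! ### Error probability of one horizontal move -/

section Verdict

variable {Ω : Type*} [mΩ : MeasurableSpace Ω] {P : Measure Ω} [IsProbabilityMeasure P]
  {γ : ℝ} {ξ : ℕ × ℕ × Bool → Ω → ℝ} {d : ℝ → ℝ → ℝ} {Δ β θs θ η : ℝ} {cm cp : ℝ → ℝ}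

lemma one_div_one_add_exp_le_half {x : ℝ} (hx : 0 ≤ x) : 1 / (1 + Real.exp x) ≤ 1 / 2 := by
  have := Real.one_le_exp hx
  apply one_div_le_one_div_of_le <;> linarith

lemma prob_neg_mem (h : IsNoise P γ ξ) (hγ : 0 < γ) (hη₀ : 0 < η) (hη₁ : η < 1)
    (hd : IsDistance d) (hc : IsComparisonPair d Δ β cm cp) (hθ : θ ∈ Set.Icc (-β) β) (hs : θ ≤ θs)
    {m : ℕ} (hm : 1 ≤ m) (hb : barrier η m ≤ m) (k : ℕ) :
    P.real {ω | testSignal η (response d θs cm cp (fun j => ξ j ω) k θ) = SignType.neg}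
      ∈ Set.Icc ((1 / (1 + Real.exp (Δ / γ))) ^ m) (η / 2) := by
  have h1 := fun i => h.prob_response_neg_one (d := d) (θs := θs) (cm := cm) (cp := cp) hγ k i θ
  have hu := utility_le_of_le hd hc hθ hs
  have ha := abs_utility_sub_le (θs := θs) hd hc hθ
  have hi := h.iIndepFun_response (d := d) (θs := θs) (cm := cm) (cp := cp) k θ
  constructor
  · refine le_trans ?_ (le_prob_testSignal_neg hm hb hi h1)
    have := (le_abs_self _).trans ha
    gcongr
  · exact prob_testSignal_neg_le hη₀ hη₁ (one_div_one_add_exp_le_half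
      (div_nonneg (by linarith) hγ.le)) (fun i => h.measurable_response k i θ) hi
      (fun i ω => response_eq_or _ _ _ _) h1

lemma prob_pos_mem (h : IsNoise P γ ξ) (hγ : 0 < γ) (hη₀ : 0 < η) (hη₁ : η < 1)
    (hd : IsDistance d) (hc : IsComparisonPair d Δ β cm cp) (hθ : θ ∈ Set.Icc (-β) β) (hs : θs ≤ θ)
    {m : ℕ} (hm : 1 ≤ m) (hb : barrier η m ≤ m) (k : ℕ) :
    P.real {ω | testSignal η (response d θs cm cp (fun j => ξ j ω) k θ) = SignType.pos}
      ∈ Set.Icc ((1 / (1 + Real.exp (Δ / γ))) ^ m) (η / 2) := by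
  have h1 : ∀ i, P.real {ω | -response d θs cm cp (fun j => ξ j ω) k θ i = -1}
      = 1 / (1 + Real.exp (-(utility d θs (cp θ) - utility d θs (cm θ)) / γ)) := by
    intro i
    simp only [neg_inj]
    exact h.prob_response_one hγ k i θ
  have hu := utility_le_of_ge hd hc hθ hs
  have ha := abs_utility_sub_le (θs := θs) hd hc hθ
  have hi : iIndepFun (fun i ω => -response d θs cm cp (fun j => ξ j ω) k θ i) P :=
    (h.iIndepFun_response (d := d) (θs := θs) (cm := cm) (cp := cp) k θ).comp (fun _ x => -x)
      (fun _ => measurable_neg)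
  simp only [testSignal_eq_pos_iff_neg]
  constructor
  · refine le_trans ?_ (le_prob_testSignal_neg hm hb hi h1)
    have := (neg_le_abs _).trans ha
    gcongr
  · exact prob_testSignal_neg_le hη₀ hη₁ (one_div_one_add_exp_le_half
      (div_nonneg (by linarith) hγ.le)) (fun i => (h.measurable_response k i θ).neg) hi
      (fun i ω => by rcases response_eq_or (d := d) (θs := θs) (cm := cm) (cp := cp)
                      (fun j => ξ j ω) k θ i with h | h <;> simp [h]) h1

end Verdict

end MAPB

namespace MAPB

/-! ### Medians and updates of densities -/

/-- The mass to the left of `x`. -/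
noncomputable def mass (β : ℝ) (ρ : ℝ → ℝ) (x : ℝ) : ℝ := ∫ t in (-β)..x, ρ t

/-- The density multiplied by `lo` to the left of `θ` and by `hi` to the right. -/
noncomputable def reweight (θ lo hi : ℝ) (ρ : ℝ → ℝ) : ℝ → ℝ :=
  fun t => (if θ ≤ t then hi else lo) * ρ t

lemma update_pos (p θ : ℝ) (ρ : ℝ → ℝ) :
    update p θ SignType.pos ρ = reweight θ (2 * (1 - p)) (2 * p) ρ := by
  funext t; simp only [update, reweight]; split_ifs <;> rfl

lemma update_neg (p θ : ℝ) (ρ : ℝ → ℝ) :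
    update p θ SignType.neg ρ = reweight θ (2 * p) (2 * (1 - p)) ρ := by
  funext t; simp only [update, reweight]; split_ifs <;> rfl

section Prior

variable {β : ℝ} {ρ : ℝ → ℝ}

lemma IsPrior.intervalIntegrable (h : IsPrior β ρ) {x y : ℝ} (hx : x ∈ Set.Icc (-β) β)
    (hy : y ∈ Set.Icc (-β) β) : IntervalIntegrable ρ volume x y := by
  rw [intervalIntegrable_iff]
  apply h.2.1.mono_set
  exact Set.uIoc_subset_uIcc.trans (Set.uIcc_subset_Icc hx hy)

lemma IsPrior.mass_add (h : IsPrior β ρ) {x y : ℝ} (hx : x ∈ Set.Icc (-β) β)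
    (hy : y ∈ Set.Icc (-β) β) : mass β ρ x + ∫ t in x..y, ρ t = mass β ρ y := by
  have h0 : -β ∈ Set.Icc (-β) β := ⟨le_rfl, hx.1.trans hx.2⟩
  exact intervalIntegral.integral_add_adjacent_intervals (h.intervalIntegrable h0 hx)
    (h.intervalIntegrable hx hy)

lemma IsPrior.mass_strictMonoOn (h : IsPrior β ρ) : StrictMonoOn (mass β ρ) (Set.Icc (-β) β) := by
  intro x hx y hy hxy
  rw [← h.mass_add hx hy]
  have : 0 < ∫ t in x..y, ρ t :=
    intervalIntegral.intervalIntegral_pos_of_pos_on (h.intervalIntegrable hx hy)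
      (fun t ht => h.1 t ⟨hx.1.trans ht.1.le, ht.2.le.trans hy.2⟩) hxy
  linarith

lemma mass_left : mass β ρ (-β) = 0 := intervalIntegral.integral_same

lemma IsPrior.mass_right (hβ : 0 < β) (h : IsPrior β ρ) : mass β ρ β = 1 := by
  rw [mass, intervalIntegral.integral_of_le (by linarith), ← integral_Icc_eq_integral_Ioc]
  exact h.2.2

lemma IsPrior.mass_nonneg (h : IsPrior β ρ) {x : ℝ} (hx : x ∈ Set.Icc (-β) β) :
    0 ≤ mass β ρ x := by
  rw [← mass_left (β := β) (ρ := ρ)]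
  exact h.mass_strictMonoOn.monotoneOn ⟨le_rfl, hx.1.trans hx.2⟩ hx hx.1

lemma IsPrior.mass_le_one (hβ : 0 < β) (h : IsPrior β ρ) {x : ℝ} (hx : x ∈ Set.Icc (-β) β) :
    mass β ρ x ≤ 1 := by
  rw [← h.mass_right hβ]
  exact h.mass_strictMonoOn.monotoneOn hx ⟨by linarith, le_rfl⟩ hx.2

lemma IsPrior.mass_continuousOn (hβ : 0 < β) (h : IsPrior β ρ) :
    ContinuousOn (mass β ρ) (Set.Icc (-β) β) := by
  have := intervalIntegral.continuousOn_primitive_interval (μ := volume) (f := ρ)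
    (a := -β) (b := β) (by rw [Set.uIcc_of_le (by linarith)]; exact h.2.1)
  rwa [Set.uIcc_of_le (by linarith)] at this

lemma IsPrior.median_spec (hβ : 0 < β) (h : IsPrior β ρ) :
    median β ρ ∈ Set.Icc (-β) β ∧ mass β ρ (median β ρ) = 1 / 2 := by
  have hiv := intermediate_value_Icc (by linarith : -β ≤ β) (h.mass_continuousOn hβ)
  rw [mass_left, h.mass_right hβ] at hiv
  obtain ⟨x, hx, hx2⟩ := hiv (by norm_num : (1 / 2 : ℝ) ∈ Set.Icc (0 : ℝ) 1)
  have hmed : median β ρ = x := by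
    apply IsLeast.csInf_eq
    refine ⟨⟨hx, hx2.ge⟩, ?_⟩
    rintro y ⟨hy, hy2⟩
    by_contra hc
    have := h.mass_strictMonoOn hy hx (not_le.1 hc)
    rw [hx2] at this
    exact absurd hy2 (not_le.2 this)
  rw [hmed]
  exact ⟨hx, hx2⟩

variable {θ lo hi : ℝ}

lemma integral_reweight_of_le {x y : ℝ} (hxy : x ≤ y) (hy : y ≤ θ) :
    ∫ t in x..y, reweight θ lo hi ρ t = lo * ∫ t in x..y, ρ t := by
  rw [← intervalIntegral.integral_const_mul]
  apply intervalIntegral.integral_congr_ae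
  -- At `t = θ` the density carries the factor `hi`; this single point is negligible.
  have : ∀ᵐ t : ℝ, t ≠ θ := by simp [ae_iff]
  filter_upwards [this] with t ht hmem
  rw [Set.uIoc_of_le hxy] at hmem
  have : ¬ θ ≤ t := fun hc => ht (le_antisymm (hmem.2.trans hy) hc)
  simp [reweight, this]

lemma integral_reweight_of_ge {x y : ℝ} (hxy : x ≤ y) (hx : θ ≤ x) :
    ∫ t in x..y, reweight θ lo hi ρ t = hi * ∫ t in x..y, ρ t := by
  rw [← intervalIntegral.integral_const_mul]
  apply intervalIntegral.integral_congr
  intro t ht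
  rw [Set.uIcc_of_le hxy] at ht
  simp [reweight, hx.trans ht.1]

lemma IsPrior.integrableOn_reweight (h : IsPrior β ρ) :
    IntegrableOn (reweight θ lo hi ρ) (Set.Icc (-β) β) := by
  have hm : Measurable fun t : ℝ => if θ ≤ t then hi else lo :=
    Measurable.ite measurableSet_Ici measurable_const measurable_const
  refine Integrable.bdd_mul (c := max |hi| |lo|) h.2.1 hm.aestronglyMeasurable ?_
  refine Filter.Eventually.of_forall fun t => ?_
  split_ifs
  · exact le_max_left _ _
  · exact le_max_right _ _

lemma IsPrior.intervalIntegrable_reweight (h : IsPrior β ρ) {x y : ℝ} (hx : x ∈ Set.Icc (-β) β)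
    (hy : y ∈ Set.Icc (-β) β) : IntervalIntegrable (reweight θ lo hi ρ) volume x y := by
  rw [intervalIntegrable_iff]
  apply h.integrableOn_reweight.mono_set
  exact Set.uIoc_subset_uIcc.trans (Set.uIcc_subset_Icc hx hy)

lemma mass_reweight_of_le {x : ℝ} (hx : -β ≤ x) (h : x ≤ θ) :
    mass β (reweight θ lo hi ρ) x = lo * mass β ρ x :=
  integral_reweight_of_le hx h

lemma IsPrior.mass_reweight_of_ge (h : IsPrior β ρ) (hθ : θ ∈ Set.Icc (-β) β) {x : ℝ}
    (hx : x ≤ β) (hθx : θ ≤ x) :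
    mass β (reweight θ lo hi ρ) x = lo * mass β ρ θ + hi * (mass β ρ x - mass β ρ θ) := by
  have hx' : x ∈ Set.Icc (-β) β := ⟨hθ.1.trans hθx, hx⟩
  have h0 : -β ∈ Set.Icc (-β) β := ⟨le_rfl, hx'.1.trans hx'.2⟩
  rw [mass, ← intervalIntegral.integral_add_adjacent_intervals
    (h.intervalIntegrable_reweight h0 hθ) (h.intervalIntegrable_reweight hθ hx'),
    integral_reweight_of_le hθ.1 le_rfl, integral_reweight_of_ge hθx le_rfl,
    ← h.mass_add hθ hx', mass]
  ring

lemma IsPrior.reweight (hβ : 0 < β) (h : IsPrior β ρ) (hθ : θ ∈ Set.Icc (-β) β)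
    (hm : mass β ρ θ = 1 / 2) (hlo : 0 < lo) (hhi : 0 < hi) (hsum : lo + hi = 2) :
    IsPrior β (reweight θ lo hi ρ) := by
  refine ⟨fun t ht => ?_, h.integrableOn_reweight, ?_⟩
  · have := h.1 t ht
    unfold MAPB.reweight
    split_ifs <;> positivity
  · have h1 := h.mass_reweight_of_ge (lo := lo) (hi := hi) hθ le_rfl hθ.2
    rw [h.mass_right hβ, hm, mass, intervalIntegral.integral_of_le (by linarith),
      ← integral_Icc_eq_integral_Ioc] at h1
    rw [h1]; linarith

end Prior

/-! ### The bisection along a sequence of verdicts -/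

/-- The density after the verdicts `w`, the latest first, where `true` stands for `+1`. -/
noncomputable def wordDensity (β p : ℝ) (ρ₀ : ℝ → ℝ) : List Bool → ℝ → ℝ
  | [] => ρ₀
  | b :: w => update p (median β (wordDensity β p ρ₀ w)) (if b then SignType.pos else SignType.neg)
      (wordDensity β p ρ₀ w)

/-- The query point after the verdicts `w`. -/
noncomputable def wordQuery (β p : ℝ) (ρ₀ : ℝ → ℝ) (w : List Bool) : ℝ :=
  median β (wordDensity β p ρ₀ w)

/-- The mass to the left of `x` after the verdicts `w`. -/
noncomputable def wordMass (β p : ℝ) (ρ₀ : ℝ → ℝ) (w : List Bool) (x : ℝ) : ℝ :=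
  mass β (wordDensity β p ρ₀ w) x

section Word

variable {β p : ℝ} {ρ₀ : ℝ → ℝ}

lemma wordDensity_true (w : List Bool) : wordDensity β p ρ₀ (true :: w)
    = reweight (wordQuery β p ρ₀ w) (2 * (1 - p)) (2 * p) (wordDensity β p ρ₀ w) :=
  update_pos _ _ _

lemma wordDensity_false (w : List Bool) : wordDensity β p ρ₀ (false :: w)
    = reweight (wordQuery β p ρ₀ w) (2 * p) (2 * (1 - p)) (wordDensity β p ρ₀ w) :=
  update_neg _ _ _

lemma isPrior_wordDensity (hβ : 0 < β) (hp0 : 0 < p) (hp1 : p < 1) (h : IsPrior β ρ₀) :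
    ∀ w, IsPrior β (wordDensity β p ρ₀ w)
  | [] => h
  | b :: w => by
    have ih := isPrior_wordDensity hβ hp0 hp1 h w
    have hs := ih.median_spec hβ
    have hq : 0 < 1 - p := by linarith
    cases b
    · rw [wordDensity_false]
      exact ih.reweight hβ hs.1 hs.2 (by positivity) (by positivity) (by ring)
    · rw [wordDensity_true]
      exact ih.reweight hβ hs.1 hs.2 (by positivity) (by positivity) (by ring)

lemma wordQuery_mem (hβ : 0 < β) (hp0 : 0 < p) (hp1 : p < 1) (h : IsPrior β ρ₀) (w : List Bool) :
    wordQuery β p ρ₀ w ∈ Set.Icc (-β) β :=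
  ((isPrior_wordDensity hβ hp0 hp1 h w).median_spec hβ).1

lemma wordMass_query (hβ : 0 < β) (hp0 : 0 < p) (hp1 : p < 1) (h : IsPrior β ρ₀) (w : List Bool) :
    wordMass β p ρ₀ w (wordQuery β p ρ₀ w) = 1 / 2 :=
  ((isPrior_wordDensity hβ hp0 hp1 h w).median_spec hβ).2

lemma wordMass_strictMonoOn (hβ : 0 < β) (hp0 : 0 < p) (hp1 : p < 1) (h : IsPrior β ρ₀)
    (w : List Bool) : StrictMonoOn (wordMass β p ρ₀ w) (Set.Icc (-β) β) :=
  (isPrior_wordDensity hβ hp0 hp1 h w).mass_strictMonoOn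

lemma wordMass_true_of_le {w : List Bool} {x : ℝ} (hx : -β ≤ x) (hxq : x ≤ wordQuery β p ρ₀ w) :
    wordMass β p ρ₀ (true :: w) x = 2 * (1 - p) * wordMass β p ρ₀ w x := by
  unfold wordMass
  rw [wordDensity_true, mass_reweight_of_le hx hxq]

lemma wordMass_false_of_le {w : List Bool} {x : ℝ} (hx : -β ≤ x) (hxq : x ≤ wordQuery β p ρ₀ w) :
    wordMass β p ρ₀ (false :: w) x = 2 * p * wordMass β p ρ₀ w x := by
  unfold wordMass
  rw [wordDensity_false, mass_reweight_of_le hx hxq]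

lemma wordMass_true_of_ge (hβ : 0 < β) (hp0 : 0 < p) (hp1 : p < 1) (h : IsPrior β ρ₀)
    {w : List Bool} {x : ℝ} (hx : x ≤ β) (hxq : wordQuery β p ρ₀ w ≤ x) :
    wordMass β p ρ₀ (true :: w) x = 1 - 2 * p * (1 - wordMass β p ρ₀ w x) := by
  have hm := wordMass_query hβ hp0 hp1 h w
  unfold wordMass at *
  rw [wordDensity_true, (isPrior_wordDensity hβ hp0 hp1 h w).mass_reweight_of_ge
    (wordQuery_mem hβ hp0 hp1 h w) hx hxq, hm]
  ring

lemma wordMass_false_of_ge (hβ : 0 < β) (hp0 : 0 < p) (hp1 : p < 1) (h : IsPrior β ρ₀)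
    {w : List Bool} {x : ℝ} (hx : x ≤ β) (hxq : wordQuery β p ρ₀ w ≤ x) :
    wordMass β p ρ₀ (false :: w) x = 1 - 2 * (1 - p) * (1 - wordMass β p ρ₀ w x) := by
  have hm := wordMass_query hβ hp0 hp1 h w
  unfold wordMass at *
  rw [wordDensity_false, (isPrior_wordDensity hβ hp0 hp1 h w).mass_reweight_of_ge
    (wordQuery_mem hβ hp0 hp1 h w) hx hxq, hm]
  ring

variable {w₀ w₁ r C : ℝ} {G : ℝ → ℝ}

lemma wordMass_mem (hβ : 0 < β) (hp0 : 0 < p) (hp1 : p < 1) (h : IsPrior β ρ₀) (w : List Bool)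
    {x : ℝ} (hx : x ∈ Set.Icc (-β) β) : wordMass β p ρ₀ w x ∈ Set.Icc (0 : ℝ) 1 :=
  ⟨(isPrior_wordDensity hβ hp0 hp1 h w).mass_nonneg hx,
    (isPrior_wordDensity hβ hp0 hp1 h w).mass_le_one hβ hx⟩

/-- A test may never stop, so the verdict probabilities may sum to less than `1`. Since the
potential is nonnegative, the missing mass can be assigned to the correct verdict. -/
lemma mixture_le {u v A B S : ℝ} (hA : 0 ≤ A) (huv : u + v ≤ 1) (h : (1 - v) * A + v * B ≤ S) :
    u * A + v * B ≤ S := by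
  have := mul_le_mul_of_nonneg_right (by linarith : u ≤ 1 - v) hA
  linarith

/-- The potential for an interval `[x, y]` with `θ* = y` contracts. -/
lemma left_potential_step (hβ : 0 < β) (hp : 1 / 2 < p) (hp1 : p < 1) (h : IsPrior β ρ₀)
    (hG : IsWeight p w₀ w₁ r C G) (hw₀ : 0 < w₀) (hw₁ : w₁ < 1 - p) {x y : ℝ} (hx : -β ≤ x)
    (hxy : x < y) (hy : y ≤ β) (w : List Bool) {u v : ℝ} (huv : u + v ≤ 1)
    (hv : wordQuery β p ρ₀ w ≤ y → v ∈ Set.Icc w₀ w₁)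
    (hu : y ≤ wordQuery β p ρ₀ w → u ∈ Set.Icc w₀ w₁) :
    u * potential G (wordMass β p ρ₀ (true :: w) x) (1 - wordMass β p ρ₀ (true :: w) y)
      + v * potential G (wordMass β p ρ₀ (false :: w) x) (1 - wordMass β p ρ₀ (false :: w) y)
      ≤ r * potential G (wordMass β p ρ₀ w x) (1 - wordMass β p ρ₀ w y) := by
  have hp0 : 0 < p := by linarith
  have hxm : x ∈ Set.Icc (-β) β := ⟨hx, hxy.le.trans hy⟩
  have hym : y ∈ Set.Icc (-β) β := ⟨hx.trans hxy.le, hy⟩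
  have hθ := wordQuery_mem hβ hp0 hp1 h w
  have hmono := fun w => wordMass_strictMonoOn hβ hp0 hp1 h w
  have hlt : ∀ w, wordMass β p ρ₀ w x + (1 - wordMass β p ρ₀ w y) < 1 := fun w => by
    linarith [hmono w hxm hym hxy]
  have hx0 := fun w => (wordMass_mem hβ hp0 hp1 h w hxm).1
  have hy1 := (wordMass_mem hβ hp0 hp1 h w hym).2
  have hnn := fun w => potential_nonneg hG (hx0 w) (hlt w)
  have hhalf := wordMass_query hβ hp0 hp1 h w
  have e1 : ∀ q F : ℝ, 1 - (1 - 2 * q * (1 - F)) = 2 * q * (1 - F) := by intro q F; ring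
  rcases le_or_gt (wordQuery β p ρ₀ w) y with hqy | hqy
  -- The query point is to the left of `y = θ*`: the wrong verdict is `false`, with probability `v`.
  · refine mixture_le (hnn _) huv ?_
    rw [wordMass_true_of_ge hβ hp0 hp1 h hy hqy, wordMass_false_of_ge hβ hp0 hp1 h hy hqy, e1, e1]
    have hRle : 1 - wordMass β p ρ₀ w y ≤ 1 / 2 := by
      have := (hmono w).monotoneOn hθ hym hqy
      linarith
    rcases le_or_gt (wordQuery β p ρ₀ w) x with hqx | hqx
    · rw [wordMass_true_of_ge hβ hp0 hp1 h hxm.2 hqx, wordMass_false_of_ge hβ hp0 hp1 h hxm.2 hqx]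
      have := (hmono w).monotoneOn hθ hxm hqx
      exact potential_step_far hG hp hw₀ hw₁ (hv hqy) (by linarith) (by linarith) (hlt w)
    · rw [wordMass_true_of_le hx hqx.le, wordMass_false_of_le hx hqx.le]
      have := hmono w hxm hθ hqx
      exact potential_step_mid hG hp hw₀ hw₁ (hv hqy) (hx0 w) (by linarith) (by linarith) hRle
        (hlt w)
  -- The query point is across `θ*`: now `true` is the wrong verdict, and the two terms exchange
  -- roles.
  · rw [add_comm]
    refine mixture_le (hnn _) (by linarith) ?_
    have hqx : x ≤ wordQuery β p ρ₀ w := hxy.le.trans hqy.le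
    have := hmono w hym hθ hqy
    have hst := potential_step_over hG hp hp1 (hu hqy.le) (hx0 w)
      (by linarith : 1 / 2 < 1 - wordMass β p ρ₀ w y) (hlt w)
    rw [sub_sub_cancel] at hst
    rw [wordMass_true_of_le hym.1 hqy.le, wordMass_false_of_le hym.1 hqy.le,
      wordMass_true_of_le hx hqx, wordMass_false_of_le hx hqx]
    exact hst

/-- The potential for an interval `[y, x]` with `θ* = y` contracts. -/
lemma right_potential_step (hβ : 0 < β) (hp : 1 / 2 < p) (hp1 : p < 1) (h : IsPrior β ρ₀)
    (hG : IsWeight p w₀ w₁ r C G) (hw₀ : 0 < w₀) (hw₁ : w₁ < 1 - p) {x y : ℝ} (hx : x ≤ β)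
    (hxy : y < x) (hy : -β ≤ y) (w : List Bool) {u v : ℝ} (huv : u + v ≤ 1)
    (hv : wordQuery β p ρ₀ w ≤ y → v ∈ Set.Icc w₀ w₁)
    (hu : y ≤ wordQuery β p ρ₀ w → u ∈ Set.Icc w₀ w₁) :
    u * potential G (1 - wordMass β p ρ₀ (true :: w) x) (wordMass β p ρ₀ (true :: w) y)
      + v * potential G (1 - wordMass β p ρ₀ (false :: w) x) (wordMass β p ρ₀ (false :: w) y)
      ≤ r * potential G (1 - wordMass β p ρ₀ w x) (wordMass β p ρ₀ w y) := by
  have hp0 : 0 < p := by linarith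
  have hxm : x ∈ Set.Icc (-β) β := ⟨hy.trans hxy.le, hx⟩
  have hym : y ∈ Set.Icc (-β) β := ⟨hy, hxy.le.trans hx⟩
  have hθ := wordQuery_mem hβ hp0 hp1 h w
  have hmono := fun w => wordMass_strictMonoOn hβ hp0 hp1 h w
  have hlt : ∀ w, (1 - wordMass β p ρ₀ w x) + wordMass β p ρ₀ w y < 1 := fun w => by
    linarith [hmono w hym hxm hxy]
  have hx0 : ∀ w, 0 ≤ 1 - wordMass β p ρ₀ w x := fun w =>
    sub_nonneg.2 (wordMass_mem hβ hp0 hp1 h w hxm).2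
  have hy0 := (wordMass_mem hβ hp0 hp1 h w hym).1
  have hnn := fun w => potential_nonneg hG (hx0 w) (hlt w)
  have hhalf := wordMass_query hβ hp0 hp1 h w
  have e1 : ∀ q F : ℝ, 1 - (1 - 2 * q * (1 - F)) = 2 * q * (1 - F) := by intro q F; ring
  rcases le_or_gt y (wordQuery β p ρ₀ w) with hqy | hqy
  · rw [add_comm]
    refine mixture_le (hnn _) (by linarith) ?_
    rw [wordMass_true_of_le hy hqy, wordMass_false_of_le hy hqy]
    have hRle : wordMass β p ρ₀ w y ≤ 1 / 2 := by
      have := (hmono w).monotoneOn hym hθ hqy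
      linarith
    rcases le_or_gt x (wordQuery β p ρ₀ w) with hqx | hqx
    · rw [wordMass_true_of_le hxm.1 hqx, wordMass_false_of_le hxm.1 hqx]
      have := (hmono w).monotoneOn hxm hθ hqx
      have hst := potential_step_far hG hp hw₀ hw₁ (hu hqy)
        (by linarith : 1 / 2 ≤ 1 - wordMass β p ρ₀ w x) hy0 (hlt w)
      rw [sub_sub_cancel] at hst
      exact hst
    · rw [wordMass_true_of_ge hβ hp0 hp1 h hx hqx.le, wordMass_false_of_ge hβ hp0 hp1 h hx hqx.le,
        e1, e1]
      have := hmono w hθ hxm hqx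
      exact potential_step_mid hG hp hw₀ hw₁ (hu hqy) (hx0 w) (by linarith) hy0 hRle (hlt w)
  · refine mixture_le (hnn _) huv ?_
    have hqx : wordQuery β p ρ₀ w ≤ x := hqy.le.trans hxy.le
    have := hmono w hθ hym hqy
    have hst := potential_step_over hG hp hp1 (hv hqy.le) (hx0 w)
      (by linarith : 1 / 2 < wordMass β p ρ₀ w y) (hlt w)
    rw [wordMass_true_of_ge hβ hp0 hp1 h hym.2 hqy.le, wordMass_false_of_ge hβ hp0 hp1 h hym.2 hqy.le,
      wordMass_true_of_ge hβ hp0 hp1 h hx hqx, wordMass_false_of_ge hβ hp0 hp1 h hx hqx, e1, e1]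
    exact hst

end Word

end MAPB

namespace MAPB

/-! ### Convergence of the horizontal moves -/

/-- The sequences of `k` verdicts. -/
def words : ℕ → Finset (List Bool)
  | 0 => {[]}
  | k + 1 => (words k).image (List.cons true) ∪ (words k).image (List.cons false)

lemma mem_words {k : ℕ} {w : List Bool} : w ∈ words k ↔ w.length = k := by
  induction k generalizing w with
  | zero => simp [words]
  | succ k ih =>
    cases w with
    | nil => simp [words]
    | cons b w => cases b <;> simp [words, ih]

lemma sum_words_succ (k : ℕ) (f : List Bool → ℝ) :
    ∑ w ∈ words (k + 1), f w = ∑ w ∈ words k, (f (true :: w) + f (false :: w)) := by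
  have hd : Disjoint ((words k).image (List.cons true)) ((words k).image (List.cons false)) := by
    rw [Finset.disjoint_left]
    intro w h1 h2
    obtain ⟨a, _, rfl⟩ := Finset.mem_image.1 h1
    obtain ⟨b, _, hb⟩ := Finset.mem_image.1 h2
    simp at hb
  rw [words, Finset.sum_union hd, Finset.sum_image (by simp), Finset.sum_image (by simp),
    Finset.sum_add_distrib]

/-- The sign of a verdict. -/
def verdictSign (b : Bool) : SignType := if b then SignType.pos else SignType.neg

/-- The tests have the verdicts `w`, the latest first. -/
def wordEvent {Ω : Type*} (β p η : ℝ) (ρ₀ : ℝ → ℝ) (Z : Ω → ℕ → ℝ → ℕ → ℝ) : List Bool → Set Ω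
  | [] => Set.univ
  | b :: w => wordEvent β p η ρ₀ Z w ∩
      {ω | testSignal η (Z ω w.length (wordQuery β p ρ₀ w)) = verdictSign b}

section WordEvent

variable {Ω : Type*} {β p η : ℝ} {ρ₀ : ℝ → ℝ} {Z : Ω → ℕ → ℝ → ℕ → ℝ}

/-- On the event of a word the random density is a fixed function. The next test is therefore a test
at a fixed point, and no conditioning on a random query point is required. -/
lemma density_of_mem_wordEvent {ω : Ω} : ∀ {w : List Bool}, ω ∈ wordEvent β p η ρ₀ Z w →
    density β p η ρ₀ (Z ω) w.length = wordDensity β p ρ₀ w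
  | [], _ => rfl
  | b :: w, h => by
    have ih := density_of_mem_wordEvent h.1
    have h2 : testSignal η (Z ω w.length (wordQuery β p ρ₀ w)) = verdictSign b := h.2
    rw [List.length_cons, density, ih]
    change update p _ (testSignal η (Z ω w.length (wordQuery β p ρ₀ w))) _ = _
    rw [h2]
    rfl

lemma queryPoint_of_mem_wordEvent {ω : Ω} {w : List Bool} (h : ω ∈ wordEvent β p η ρ₀ Z w) :
    queryPoint β p η ρ₀ (Z ω) w.length = wordQuery β p ρ₀ w := by
  rw [queryPoint, density_of_mem_wordEvent h]; rfl

lemma exists_wordEvent (hη₀ : 0 < η) (hη₁ : η < 1) {ω : Ω} {k : ℕ}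
    (h : MakesMoves β p η ρ₀ (Z ω) k) : ∃ w ∈ words k, ω ∈ wordEvent β p η ρ₀ Z w := by
  induction k with
  | zero => exact ⟨[], by simp [words], trivial⟩
  | succ k ih =>
    obtain ⟨w, hw, hω⟩ := ih fun j hj => h j (hj.trans k.lt_succ_self)
    have hk := mem_words.1 hw
    have hq := queryPoint_of_mem_wordEvent hω
    have hfinite := h k k.lt_succ_self
    rw [verticalMoves, ← hk, hq] at hfinite
    rcases testSignal_ne_zero hη₀ hη₁ hfinite with h1 | h1
    · exact ⟨true :: w, mem_words.2 (by simp [hk]), hω, h1⟩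
    · exact ⟨false :: w, mem_words.2 (by simp [hk]), hω, h1⟩

lemma verdictSign_injective : Function.Injective verdictSign := by
  intro a b; cases a <;> cases b <;> decide

lemma eq_of_mem_wordEvent {ω : Ω} : ∀ {w w' : List Bool}, w.length = w'.length →
    ω ∈ wordEvent β p η ρ₀ Z w → ω ∈ wordEvent β p η ρ₀ Z w' → w = w'
  | [], w', hl, _, _ => (List.length_eq_zero_iff.1 hl.symm).symm
  | b :: w, [], hl, _, _ => by simp at hl
  | b :: w, b' :: w', hl, h, h' => by
    have e := eq_of_mem_wordEvent (by simpa using hl) h.1 h'.1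
    subst e
    have h1 : testSignal η (Z ω w.length (wordQuery β p ρ₀ w)) = verdictSign b := h.2
    have h2 : testSignal η (Z ω w.length (wordQuery β p ρ₀ w)) = verdictSign b' := h'.2
    rw [verdictSign_injective (h1.symm.trans h2)]

end WordEvent

/-! ### Geometric decay of the probability of a distant query point -/

section Probability

variable {Ω : Type*} [mΩ : MeasurableSpace Ω] {P : Measure Ω} [IsProbabilityMeasure P]
  {γ : ℝ} {ξ : ℕ × ℕ × Bool → Ω → ℝ} {d : ℝ → ℝ → ℝ} {Δ β θs η p : ℝ} {cm cp ρ₀ : ℝ → ℝ}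

/-- All answers of the human, as a function of the outcome. -/
noncomputable def answers (d : ℝ → ℝ → ℝ) (θs : ℝ) (cm cp : ℝ → ℝ) (ξ : ℕ × ℕ × Bool → Ω → ℝ) :
    Ω → ℕ → ℝ → ℕ → ℝ := fun ω => response d θs cm cp (fun j => ξ j ω)

lemma measurableSet_verdict (k : ℕ) (θ : ℝ) (b : Bool) : MeasurableSet[testInfo ξ k]
    {ω | testSignal η (answers d θs cm cp ξ ω k θ) = verdictSign b} := by
  have h := measurable_responses_testInfo (ξ := ξ) (d := d) (θs := θs) (cm := cm) (cp := cp) k θ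
  cases b
  · exact h (measurableSet_testSignal_neg η)
  · exact h (measurableSet_testSignal_pos η)

lemma measurableSet_wordEvent : ∀ w : List Bool, MeasurableSet[pastInfo ξ w.length]
    (wordEvent β p η ρ₀ (answers d θs cm cp ξ) w)
  | [] => MeasurableSet.univ
  | b :: w => by
    have h1 := pastInfo_mono (ξ := ξ) (Nat.le_succ w.length) _ (measurableSet_wordEvent w)
    have h2 := testInfo_le_pastInfo (ξ := ξ) (Nat.lt_succ_self w.length) _
      (measurableSet_verdict (η := η) (d := d) (θs := θs) (cm := cm) (cp := cp)
        w.length (wordQuery β p ρ₀ w) b)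
    exact h1.inter h2

/-- The probability of the verdict `b` after the verdicts `w`. -/
noncomputable def verdictProb (P : Measure Ω) (β p η : ℝ) (ρ₀ : ℝ → ℝ) (Z : Ω → ℕ → ℝ → ℕ → ℝ)
    (w : List Bool) (b : Bool) : ℝ :=
  P.real {ω | testSignal η (Z ω w.length (wordQuery β p ρ₀ w)) = verdictSign b}

lemma prob_wordEvent_cons (h : IsNoise P γ ξ) (b : Bool) (w : List Bool) :
    P.real (wordEvent β p η ρ₀ (answers d θs cm cp ξ) (b :: w))
      = P.real (wordEvent β p η ρ₀ (answers d θs cm cp ξ) w)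
        * verdictProb P β p η ρ₀ (answers d θs cm cp ξ) w b :=
  h.prob_inter (measurableSet_wordEvent w) (measurableSet_verdict _ _ b)

lemma verdictProb_add_le (h : IsNoise P γ ξ) (w : List Bool) :
    verdictProb P β p η ρ₀ (answers d θs cm cp ξ) w true
      + verdictProb P β p η ρ₀ (answers d θs cm cp ξ) w false ≤ 1 := by
  unfold verdictProb
  rw [← measureReal_union]
  · exact measureReal_le_one
  · rw [Set.disjoint_left]
    intro ω h1 h2
    have : verdictSign true = verdictSign false := (Eq.symm h1).trans h2
    exact absurd (verdictSign_injective this) (by decide)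
  · exact h.testInfo_le _ _ (measurableSet_verdict _ _ _)

/-- The expectation of a contracting function decays geometrically. -/
lemma sum_prob_wordEvent_mul_le (h : IsNoise P γ ξ) {r : ℝ} (hr : 0 ≤ r) {Φ : List Bool → ℝ}
    (hstep : ∀ w, verdictProb P β p η ρ₀ (answers d θs cm cp ξ) w true * Φ (true :: w)
      + verdictProb P β p η ρ₀ (answers d θs cm cp ξ) w false * Φ (false :: w) ≤ r * Φ w) (k : ℕ) :
    ∑ w ∈ words k, P.real (wordEvent β p η ρ₀ (answers d θs cm cp ξ) w) * Φ w ≤ r ^ k * Φ [] := by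
  induction k with
  | zero => simp [words, wordEvent]
  | succ k ih =>
    rw [sum_words_succ]
    calc _ ≤ ∑ w ∈ words k, r * (P.real (wordEvent β p η ρ₀ (answers d θs cm cp ξ) w) * Φ w) := by
          refine Finset.sum_le_sum fun w _ => ?_
          rw [prob_wordEvent_cons h, prob_wordEvent_cons h]
          have := mul_le_mul_of_nonneg_left (hstep w)
            (measureReal_nonneg (μ := P) (s := wordEvent β p η ρ₀ (answers d θs cm cp ξ) w))
          linarith
      _ = r * ∑ w ∈ words k, P.real (wordEvent β p η ρ₀ (answers d θs cm cp ξ) w) * Φ w :=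
          (Finset.mul_sum _ _ _).symm
      _ ≤ r * (r ^ k * Φ []) := mul_le_mul_of_nonneg_left ih hr
      _ = r ^ (k + 1) * Φ [] := by ring

/-- Markov's inequality for sums over words. -/
lemma sum_filter_prob_le {s : Finset (List Bool)} {bad : List Bool → Prop} [DecidablePred bad]
    {N Φ : List Bool → ℝ} (hN : ∀ w, 0 ≤ N w) (hΦ : ∀ w, 0 ≤ Φ w) (hbad : ∀ w, bad w → 1 ≤ Φ w) :
    ∑ w ∈ s with bad w, N w ≤ ∑ w ∈ s, N w * Φ w := by
  calc ∑ w ∈ s with bad w, N w ≤ ∑ w ∈ s with bad w, N w * Φ w := by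
        refine Finset.sum_le_sum fun w hw => ?_
        have := hbad w (Finset.mem_filter.1 hw).2
        nlinarith [hN w]
    _ ≤ _ := Finset.sum_le_sum_of_subset_of_nonneg (Finset.filter_subset _ _)
        fun w _ _ => mul_nonneg (hN w) (hΦ w)

lemma verdictProb_false_mem (h : IsNoise P γ ξ) (hγ : 0 < γ) (hη₀ : 0 < η) (hη₁ : η < 1)
    (hd : IsDistance d) (hc : IsComparisonPair d Δ β cm cp) (hβ : 0 < β) (hp0 : 0 < p) (hp1 : p < 1)
    (hρ : IsPrior β ρ₀) {m : ℕ} (hm : 1 ≤ m) (hb : barrier η m ≤ m) (w : List Bool)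
    (hw : wordQuery β p ρ₀ w ≤ θs) :
    verdictProb P β p η ρ₀ (answers d θs cm cp ξ) w false
      ∈ Set.Icc ((1 / (1 + Real.exp (Δ / γ))) ^ m) (η / 2) :=
  prob_neg_mem h hγ hη₀ hη₁ hd hc (wordQuery_mem hβ hp0 hp1 hρ w) hw hm hb w.length

lemma verdictProb_true_mem (h : IsNoise P γ ξ) (hγ : 0 < γ) (hη₀ : 0 < η) (hη₁ : η < 1)
    (hd : IsDistance d) (hc : IsComparisonPair d Δ β cm cp) (hβ : 0 < β) (hp0 : 0 < p) (hp1 : p < 1)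
    (hρ : IsPrior β ρ₀) {m : ℕ} (hm : 1 ≤ m) (hb : barrier η m ≤ m) (w : List Bool)
    (hw : θs ≤ wordQuery β p ρ₀ w) :
    verdictProb P β p η ρ₀ (answers d θs cm cp ξ) w true
      ∈ Set.Icc ((1 / (1 + Real.exp (Δ / γ))) ^ m) (η / 2) :=
  prob_pos_mem h hγ hη₀ hη₁ hd hc (wordQuery_mem hβ hp0 hp1 hρ w) hw hm hb w.length

lemma integral_prior_eq_sub (hρ : IsPrior β ρ₀) {x y : ℝ} (hx : x ∈ Set.Icc (-β) β)
    (hy : y ∈ Set.Icc (-β) β) : ∫ t in x..y, ρ₀ t = mass β ρ₀ y - mass β ρ₀ x := by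
  linarith [hρ.mass_add hx hy]

open Classical in
/-- It is exponentially unlikely that the query point is still far from `θ*`. -/
lemma sum_prob_far_le (h : IsNoise P γ ξ) (hγ : 0 < γ) (hη₀ : 0 < η) (hη₁ : η < 1)
    (hd : IsDistance d) (hc : IsComparisonPair d Δ β cm cp) (hβ : 0 < β)
    (hθs : θs ∈ Set.Icc (-β) β) (hp : 1 / 2 < p) (hp1 : p < 1 - η / 2)
    (hρ : IsPrior β ρ₀) {m : ℕ} (hm : 1 ≤ m) (hb : barrier η m ≤ m) {r C : ℝ} {G : ℝ → ℝ}
    (hC : 0 ≤ C) (hG : IsWeight p ((1 / (1 + Real.exp (Δ / γ))) ^ m) (η / 2) r C G)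
    {a ς : ℝ} (ha : 0 < a) (hmass : PriorMass β θs a ς ρ₀) (k : ℕ) :
    ∑ w ∈ words k with a < |wordQuery β p ρ₀ w - θs|,
      P.real (wordEvent β p η ρ₀ (answers d θs cm cp ξ) w) ≤ 2 * (C / (a ^ ς) ^ 2) * r ^ k := by
  have hp0 : 0 < p := by linarith
  have hp1' : p < 1 := by linarith
  have hw₀ : 0 < (1 / (1 + Real.exp (Δ / γ))) ^ m := by positivity
  have hw₁ : η / 2 < 1 - p := by linarith
  have hN : ∀ w, 0 ≤ P.real (wordEvent β p η ρ₀ (answers d θs cm cp ξ) w) :=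
    fun w => measureReal_nonneg
  have hq := wordQuery_mem hβ hp0 hp1' hρ
  have hpos : 0 < a ^ ς := Real.rpow_pos_of_pos ha _
  have hbound : 0 ≤ C / (a ^ ς) ^ 2 * r ^ k := by
    have := hG.r_pos
    positivity
  have hv := verdictProb_false_mem (d := d) (θs := θs) (cm := cm) (cp := cp) h hγ hη₀ hη₁ hd hc hβ
    hp0 hp1' hρ hm hb
  have hu := verdictProb_true_mem (d := d) (θs := θs) (cm := cm) (cp := cp) h hγ hη₀ hη₁ hd hc hβ
    hp0 hp1' hρ hm hb
  have huv := verdictProb_add_le (P := P) (β := β) (p := p) (η := η) (ρ₀ := ρ₀) (d := d) (θs := θs)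
    (cm := cm) (cp := cp) h
  have hleft : ∑ w ∈ words k with wordQuery β p ρ₀ w < θs - a,
      P.real (wordEvent β p η ρ₀ (answers d θs cm cp ξ) w) ≤ C / (a ^ ς) ^ 2 * r ^ k := by
    by_cases hcase : a < θs + β
    · have hx : -β ≤ θs - a := by linarith
      have hxy : θs - a < θs := by linarith
      have hxm : θs - a ∈ Set.Icc (-β) β := ⟨hx, hxy.le.trans hθs.2⟩
      have hmono := fun w => wordMass_strictMonoOn hβ hp0 hp1' hρ w
      have hlt : ∀ w, wordMass β p ρ₀ w (θs - a) + (1 - wordMass β p ρ₀ w θs) < 1 := fun w => by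
        linarith [hmono w hxm hθs hxy]
      have h0 := fun w => (wordMass_mem hβ hp0 hp1' hρ w hxm).1
      have h1 := fun w => (wordMass_mem hβ hp0 hp1' hρ w hθs).2
      refine (sum_filter_prob_le (Φ := fun w => potential G (wordMass β p ρ₀ w (θs - a))
        (1 - wordMass β p ρ₀ w θs)) hN (fun w => potential_nonneg hG (h0 w) (hlt w)) ?_).trans ?_
      · intro w hw
        have := (hmono w).monotoneOn (hq w) hxm hw.le
        rw [wordMass_query hβ hp0 hp1' hρ w] at this
        exact one_le_potential hG this (by linarith [h1 w]) (hlt w)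
      · refine (sum_prob_wordEvent_mul_le h hG.r_pos.le (fun w => left_potential_step hβ hp hp1' hρ
          hG hw₀ hw₁ hx hxy hθs.2 w (huv w) (hv w) (hu w)) k).trans ?_
        rw [mul_comm]
        apply mul_le_mul_of_nonneg_right _ (pow_nonneg hG.r_pos.le k)
        refine potential_le hG hC (h0 []) (by linarith [h1 []]) hpos ?_
        have := hmass.1 hcase
        rw [integral_prior_eq_sub hρ hxm hθs] at this
        change a ^ ς ≤ 1 - mass β ρ₀ (θs - a) - (1 - mass β ρ₀ θs)
        linarith
    -- On an exempt side no point of `[-β, β]` is farther than `a` from `θ*`.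
    · rw [Finset.filter_false_of_mem, Finset.sum_empty]
      · exact hbound
      · intro w _ hw
        linarith [(hq w).1]
  have hright : ∑ w ∈ words k with θs + a < wordQuery β p ρ₀ w,
      P.real (wordEvent β p η ρ₀ (answers d θs cm cp ξ) w) ≤ C / (a ^ ς) ^ 2 * r ^ k := by
    by_cases hcase : a < β - θs
    · have hx : θs + a ≤ β := by linarith
      have hxy : θs < θs + a := by linarith
      have hxm : θs + a ∈ Set.Icc (-β) β := ⟨hθs.1.trans hxy.le, hx⟩
      have hmono := fun w => wordMass_strictMonoOn hβ hp0 hp1' hρ w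
      have hlt : ∀ w, (1 - wordMass β p ρ₀ w (θs + a)) + wordMass β p ρ₀ w θs < 1 := fun w => by
        linarith [hmono w hθs hxm hxy]
      have h0 : ∀ w, 0 ≤ 1 - wordMass β p ρ₀ w (θs + a) := fun w =>
        sub_nonneg.2 (wordMass_mem hβ hp0 hp1' hρ w hxm).2
      have h1 := fun w => (wordMass_mem hβ hp0 hp1' hρ w hθs).1
      refine (sum_filter_prob_le (Φ := fun w => potential G (1 - wordMass β p ρ₀ w (θs + a))
        (wordMass β p ρ₀ w θs)) hN (fun w => potential_nonneg hG (h0 w) (hlt w)) ?_).trans ?_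
      · intro w hw
        have := (hmono w).monotoneOn hxm (hq w) hw.le
        rw [wordMass_query hβ hp0 hp1' hρ w] at this
        exact one_le_potential hG (by linarith) (h1 w) (hlt w)
      · refine (sum_prob_wordEvent_mul_le h hG.r_pos.le (fun w => right_potential_step hβ hp hp1' hρ
          hG hw₀ hw₁ hx hxy hθs.1 w (huv w) (hv w) (hu w)) k).trans ?_
        rw [mul_comm]
        apply mul_le_mul_of_nonneg_right _ (pow_nonneg hG.r_pos.le k)
        refine potential_le hG hC (h0 []) (h1 []) hpos ?_
        have := hmass.2 hcase
        rw [integral_prior_eq_sub hρ hθs hxm] at this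
        change a ^ ς ≤ 1 - (1 - mass β ρ₀ (θs + a)) - mass β ρ₀ θs
        linarith
    · rw [Finset.filter_false_of_mem, Finset.sum_empty]
      · exact hbound
      · intro w _ hw
        linarith [(hq w).2]
  have hsub : (words k).filter (fun w => a < |wordQuery β p ρ₀ w - θs|)
      ⊆ (words k).filter (fun w => wordQuery β p ρ₀ w < θs - a)
        ∪ (words k).filter (fun w => θs + a < wordQuery β p ρ₀ w) := by
    intro w hw
    rw [Finset.mem_filter, lt_abs] at hw
    rw [Finset.mem_union, Finset.mem_filter, Finset.mem_filter]
    rcases hw.2 with h1 | h1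
    · exact Or.inr ⟨hw.1, by linarith⟩
    · exact Or.inl ⟨hw.1, by linarith⟩
  calc _ ≤ _ := Finset.sum_le_sum_of_subset_of_nonneg hsub fun w _ _ => hN w
    _ ≤ _ := le_add_of_nonneg_right (Finset.sum_nonneg fun w _ => hN w)
    _ = _ := Finset.sum_union_inter
    _ ≤ _ := (add_le_add hleft hright).trans_eq (by ring)

/-- The moves are made, and from the `n`-th move on some query point is far from `θ*`. -/
def farEvent (β p η : ℝ) (ρ₀ : ℝ → ℝ) (Z : Ω → ℕ → ℝ → ℕ → ℝ) (θs a : ℝ) (n : ℕ) : Set Ω :=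
  ⋃ k : ℕ, ⋃ w : {w : List Bool // w.length = n + k ∧ a < |wordQuery β p ρ₀ w - θs|},
    wordEvent β p η ρ₀ Z w

lemma measurableSet_farEvent (h : IsNoise P γ ξ) (a : ℝ) (n : ℕ) :
    MeasurableSet (farEvent β p η ρ₀ (answers d θs cm cp ξ) θs a n) :=
  MeasurableSet.iUnion fun _ => MeasurableSet.iUnion fun w =>
    h.pastInfo_le _ _ (measurableSet_wordEvent w.1)

/-- All moves from the `n`-th on are included, so the bound applies at a random time as well; the
price is the factor `1 / (1 - r)`. -/
lemma prob_farEvent_le (h : IsNoise P γ ξ) (hγ : 0 < γ) (hη₀ : 0 < η) (hη₁ : η < 1)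
    (hd : IsDistance d) (hc : IsComparisonPair d Δ β cm cp) (hβ : 0 < β)
    (hθs : θs ∈ Set.Icc (-β) β) (hp : 1 / 2 < p) (hp1 : p < 1 - η / 2)
    (hρ : IsPrior β ρ₀) {m : ℕ} (hm : 1 ≤ m) (hb : barrier η m ≤ m) {r C : ℝ} {G : ℝ → ℝ}
    (hC : 0 ≤ C) (hG : IsWeight p ((1 / (1 + Real.exp (Δ / γ))) ^ m) (η / 2) r C G)
    {a ς : ℝ} (ha : 0 < a) (hmass : PriorMass β θs a ς ρ₀) (n : ℕ) :
    P.real (farEvent β p η ρ₀ (answers d θs cm cp ξ) θs a n)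
      ≤ 2 * (C / (a ^ ς) ^ 2) * r ^ n / (1 - r) := by
  classical
  have hr := hG.r_pos
  have hr1 := hG.r_lt_one
  have hpos : 0 < a ^ ς := Real.rpow_pos_of_pos ha _
  have hs : HasSum (fun k => 2 * (C / (a ^ ς) ^ 2) * r ^ (n + k))
      (2 * (C / (a ^ ς) ^ 2) * r ^ n / (1 - r)) := by
    have := (hasSum_geometric_of_lt_one hr.le hr1).mul_left (2 * (C / (a ^ ς) ^ 2) * r ^ n)
    simp only [pow_add, ← mul_assoc]
    exact this
  have hnn : ∀ k, 0 ≤ 2 * (C / (a ^ ς) ^ 2) * r ^ (n + k) := fun k => by positivity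
  refine ENNReal.toReal_le_of_le_ofReal (hs.nonneg hnn) ?_
  rw [← hs.tsum_eq, ENNReal.ofReal_tsum_of_nonneg hnn hs.summable]
  refine (measure_iUnion_le _).trans (ENNReal.tsum_le_tsum fun k => ?_)
  rw [← ofReal_measureReal]
  apply ENNReal.ofReal_le_ofReal
  refine le_trans ?_ (sum_prob_far_le (d := d) (θs := θs) (cm := cm) (cp := cp) h hγ hη₀ hη₁ hd hc
    hβ hθs hp hp1 hρ hm hb hC hG ha hmass (n + k))
  refine le_trans (measureReal_mono (s₂ := ⋃ w ∈ (words (n + k)).filter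
    (fun w => a < |wordQuery β p ρ₀ w - θs|), wordEvent β p η ρ₀ (answers d θs cm cp ξ) w) ?_ ?_)
    (measureReal_biUnion_finset_le _ _)
  · refine Set.iUnion_subset fun w => Set.subset_biUnion_of_mem (u := fun w =>
      wordEvent β p η ρ₀ (answers d θs cm cp ξ) w) ?_
    exact Finset.mem_coe.2 (Finset.mem_filter.2 ⟨mem_words.2 w.2.1, w.2.2⟩)
  · exact measure_ne_top _ _

end Probability

end MAPB

namespace MAPB

/-! ### The thresholds -/

lemma rpow_two_mul {ε : ℝ} (hε : 0 < ε) (κ : ℝ) : ε ^ (2 * κ) = (ε ^ κ) ^ 2 := by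
  rw [mul_comm, Real.rpow_mul hε.le]; norm_cast

lemma le_of_barrier_div_ge {η y : ℝ} (hη₀ : 0 < η) (hη₁ : η < 1) (hy : 0 < y) {s : ℕ} (hs : 1 ≤ s)
    (h : y / 2 ≤ barrier η s / s) :
    (s : ℝ) ≤ 1 + 16 / y ^ 2 * (Real.log (16 / y ^ 2) + Real.log (1 / η)) := by
  have hs0 : (0 : ℝ) < s := by exact_mod_cast hs
  rw [le_div_iff₀ hs0] at h
  have h2 : (y / 2 * s) ^ 2 ≤ 2 * s * (Real.log (s + 1) - Real.log η) := by
    rw [← barrier_sq hη₀ hη₁]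
    exact pow_le_pow_left₀ (by positivity) h 2
  have h3 : y ^ 2 / 4 * s ≤ 2 * (Real.log (s + 1) - Real.log η) := by
    have : (y ^ 2 / 4 * s) * s ≤ (2 * (Real.log (s + 1) - Real.log η)) * s := by linarith
    exact le_of_mul_le_mul_right this hs0
  -- The tangent of the logarithm at `16 / y²`: its slope is small enough to consume only half of
  -- the linear term on the left of `h3`.
  have h4 := Real.log_le_sub_one_of_pos (by positivity : (0 : ℝ) < (s + 1) / (16 / y ^ 2))
  rw [Real.log_div (by positivity) (by positivity)] at h4
  rw [one_div, Real.log_inv]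
  set L := Real.log (16 / y ^ 2)
  have e : ((s : ℝ) + 1) / (16 / y ^ 2) = y ^ 2 / 16 * (s + 1) := by field_simp
  rw [e] at h4
  have h5 : y ^ 2 / 8 * s ≤ y ^ 2 / 8 + 2 * (L + -Real.log η) := by linarith
  have h6 : (s : ℝ) = 8 / y ^ 2 * (y ^ 2 / 8 * s) := by field_simp
  have h7 : 1 + 16 / y ^ 2 * (L + -Real.log η)
      = 8 / y ^ 2 * (y ^ 2 / 8 + 2 * (L + -Real.log η)) := by field_simp; ring
  rw [h6, h7]
  gcongr

/-- Boundedness makes `sSup` on `ℕ` a true maximum instead of the default value `0`. -/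
lemma bddAbove_tauZero {η y : ℝ} (hη₀ : 0 < η) (hη₁ : η < 1) (hy : 0 < y) :
    BddAbove {s : ℕ | 1 ≤ s ∧ y / 2 ≤ barrier η s / s} := by
  refine ⟨⌊1 + 16 / y ^ 2 * (Real.log (16 / y ^ 2) + Real.log (1 / η))⌋₊, ?_⟩
  rintro s ⟨hs, h⟩
  exact Nat.le_floor (le_of_barrier_div_ge hη₀ hη₁ hy hs h)

lemma tauZero_le {η c κ ε : ℝ} (hη₀ : 0 < η) (hη₁ : η < 1) (hy : 0 < c * ε ^ κ) {b : ℝ} (hb : 0 ≤ b)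
    (h : 1 + 16 / (c * ε ^ κ) ^ 2 * (Real.log (16 / (c * ε ^ κ) ^ 2) + Real.log (1 / η)) ≤ b) :
    (tauZero η c κ ε : ℝ) ≤ b := by
  unfold tauZero
  rcases Set.eq_empty_or_nonempty {s : ℕ | 1 ≤ s ∧ c * ε ^ κ / 2 ≤ barrier η s / s} with he | hne
  · rw [he]; simpa using hb
  · have := Nat.sSup_mem hne (bddAbove_tauZero hη₀ hη₁ hy)
    exact (le_of_barrier_div_ge hη₀ hη₁ hy this.1 this.2).trans h

lemma barrier_lt_of_tauZero_lt {η c κ ε : ℝ} (hη₀ : 0 < η) (hη₁ : η < 1) (hy : 0 < c * ε ^ κ)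
    {s : ℕ} (hs : tauZero η c κ ε < s) : barrier η s < s * (c * ε ^ κ / 2) := by
  have hs1 : 1 ≤ s := by omega
  have hs0 : (0 : ℝ) < s := by exact_mod_cast hs1
  by_contra hc
  have hmem : s ∈ {s : ℕ | 1 ≤ s ∧ c * ε ^ κ / 2 ≤ barrier η s / s} := by
    refine ⟨hs1, ?_⟩
    rw [le_div_iff₀ hs0]
    linarith [not_lt.1 hc]
  have := le_csSup (bddAbove_tauZero hη₀ hη₁ hy) hmem
  unfold tauZero at hs
  omega

lemma gapConst_pos {γ lam a κ : ℝ} (hγ : 0 < γ) (hlam : 0 < lam) (ha : 0 < a) :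
    0 < gapConst γ lam a κ := by
  have := Real.log_pos (one_lt_two)
  have := Real.rpow_pos_of_pos ha κ
  unfold gapConst
  positivity

/-- The threshold for vertical moves has the order `(log (1/δ) + log (1/ε)) ε^(-2κ)`. -/
lemma exists_tauUp_le {η c κ : ℝ} (hη₀ : 0 < η) (hη₁ : η < 1) (hc : 0 < c) (hκ : 0 < κ) :
    ∃ C : ℝ, 0 < C ∧ ∀ δ ε : ℝ, 0 < δ → δ < 1 → 0 < ε → ε ≤ 1 / 2 →
      tauUp η c κ δ ε ≤ C * (Real.log (1 / δ) + Real.log (1 / ε)) * ε ^ (-(2 * κ)) := by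
  have hLη : 0 ≤ Real.log (1 / η) := Real.log_nonneg (by rw [le_div_iff₀ hη₀]; linarith)
  set K := |Real.log (16 / c ^ 2)| + Real.log (1 / η) with hK
  have hK0 : 0 ≤ K := by positivity
  refine ⟨2 + 16 / c ^ 2 * (2 * K + 2 * κ) + 8 / c ^ 2, by positivity, ?_⟩
  intro δ ε hδ hδ1 hε hε1
  have hlδ : 0 ≤ Real.log (1 / δ) := Real.log_nonneg (by rw [le_div_iff₀ hδ]; linarith)
  -- Here `ε ≤ 1/2` matters: `log (1/ε)` stays away from `0` and absorbs the terms that depend on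
  -- neither `δ` nor `ε`.
  have hlε : 1 / 2 ≤ Real.log (1 / ε) := by
    have h2 : Real.log 2 ≤ Real.log (1 / ε) :=
      Real.log_le_log two_pos (by rw [le_div_iff₀ hε]; linarith)
    linarith [Real.log_two_gt_d9]
  have hεκ : 0 < ε ^ κ := Real.rpow_pos_of_pos hε κ
  have hεκ1 : ε ^ κ ≤ 1 := Real.rpow_le_one hε.le (by linarith) hκ.le
  have hE : ε ^ (-(2 * κ)) = 1 / (ε ^ κ) ^ 2 := by
    rw [Real.rpow_neg hε.le, rpow_two_mul hε, one_div]
  rw [hE]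
  set E := 1 / (ε ^ κ) ^ 2 with hEd
  set lδ := Real.log (1 / δ)
  set lε := Real.log (1 / ε) with hlεd
  have hE1 : 1 ≤ E := by
    rw [hEd, le_div_iff₀ (by positivity), one_mul]
    exact pow_le_one₀ hεκ.le hεκ1
  have hq : 0 ≤ 16 / c ^ 2 := by positivity
  have hq8 : 0 ≤ 8 / c ^ 2 := by positivity
  unfold tauUp
  refine max_le ?_ ?_
  · refine tauZero_le hη₀ hη₁ (by positivity) (by positivity) ?_
    have e1 : 16 / (c * ε ^ κ) ^ 2 = 16 / c ^ 2 * E := by rw [hEd]; field_simp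
    have e2 : Real.log (16 / c ^ 2 * E) = Real.log (16 / c ^ 2) + 2 * κ * lε := by
      rw [Real.log_mul (by positivity) (by positivity), hEd, ← rpow_two_mul hε, one_div,
        Real.log_inv, Real.log_rpow hε, hlεd, one_div, Real.log_inv]
      ring
    rw [e1, e2]
    have h1 : Real.log (16 / c ^ 2) + 2 * κ * lε + Real.log (1 / η) ≤ (2 * K + 2 * κ) * lε := by
      have := le_abs_self (Real.log (16 / c ^ 2))
      nlinarith
    have h2 : 16 / c ^ 2 * E * (Real.log (16 / c ^ 2) + 2 * κ * lε + Real.log (1 / η))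
        ≤ 16 / c ^ 2 * E * ((2 * K + 2 * κ) * lε) := by gcongr
    have h3 : 1 ≤ 2 * lε * E := by nlinarith
    have h4 : 0 ≤ (2 + 16 / c ^ 2 * (2 * K + 2 * κ) + 8 / c ^ 2) * lδ * E := by positivity
    have h5 : 0 ≤ 8 / c ^ 2 * lε * E := by positivity
    linarith
  · have e : 8 * lδ / (c ^ 2 * ε ^ (2 * κ)) = 8 / c ^ 2 * lδ * E := by
      rw [rpow_two_mul hε, hEd]; field_simp
    rw [e]
    have h4 : 0 ≤ (2 + 16 / c ^ 2 * (2 * K + 2 * κ)) * lδ * E := by positivity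
    have h5 : 0 ≤ (2 + 16 / c ^ 2 * (2 * K + 2 * κ) + 8 / c ^ 2) * lε * E := by positivity
    linarith

/-! ### Concentration of the test statistic -/

section Concentration

variable {Ω : Type*} [mΩ : MeasurableSpace Ω] {P : Measure Ω} [IsProbabilityMeasure P]

lemma integral_of_signs {X : Ω → ℝ} (hX : Measurable X) (hv : ∀ ω, X ω = 1 ∨ X ω = -1) :
    ∫ ω, X ω ∂P = 1 - 2 * P.real {ω | X ω = -1} := by
  have hs : MeasurableSet {ω | X ω = -1} := measurableSet_eq_fun hX measurable_const
  have e : X = fun ω => 1 - 2 * Set.indicator {ω | X ω = -1} (fun _ => (1 : ℝ)) ω := by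
    funext ω
    rcases hv ω with h | h
    · rw [Set.indicator_of_notMem (by simp [h]; norm_num), h]; norm_num
    · rw [Set.indicator_of_mem (by simpa using h), h]; norm_num
  conv_lhs => rw [e]
  have hint : Integrable (Set.indicator {ω | X ω = -1} (fun _ => (1 : ℝ))) P :=
    (integrable_const 1).indicator hs
  rw [integral_sub (integrable_const _) (hint.const_mul 2), integral_const_mul,
    integral_indicator_const _ hs]
  simp

/-- Hoeffding's inequality for `μ - X i`, which is sub-Gaussian with parameter `1` because the
values lie in an interval of length `2`. Only one tail is needed, since `|S| < b` implies `S < b`.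
-/
lemma prob_walk_lt_le_of_nonneg {X : ℕ → Ω → ℝ} (hX : ∀ i, Measurable (X i)) (hi : iIndepFun X P)
    (hv : ∀ i ω, X i ω = 1 ∨ X i ω = -1) {μ : ℝ} (hμ : ∀ i, ∫ ω, X i ω ∂P = μ) {m : ℕ} {b : ℝ}
    (hb : b ≤ m * μ) :
    P.real {ω | |walk (fun i => X i ω) m| < b} ≤ Real.exp (-(m * μ - b) ^ 2 / (2 * m)) := by
  have hsub : ∀ i, HasSubgaussianMGF (fun ω => μ - X i ω) 1 P := by
    intro i
    have h := hasSubgaussianMGF_of_mem_Icc (μ := P) (X := fun ω => X i ω) (a := -1) (b := 1)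
      (hX i).aemeasurable (Filter.Eventually.of_forall fun ω => by
        rcases hv i ω with h | h <;> rw [h] <;> norm_num)
    have e : ((‖(1 : ℝ) - -1‖₊ / 2) ^ 2 : NNReal) = 1 := by
      have : ‖(1 : ℝ) - -1‖₊ = 2 := by ext; norm_num
      rw [this]; norm_num
    rw [e, hμ i] at h
    have h2 := h.neg
    convert! h2 using 1
    funext ω
    simp
  have hind : iIndepFun (fun i ω => μ - X i ω) P :=
    hi.comp (fun _ x => μ - x) (fun _ => by fun_prop)
  have h := HasSubgaussianMGF.measure_sum_range_ge_le_of_iIndepFun hind (n := m)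
    (fun i _ => hsub i) (sub_nonneg.2 hb)
  simp only [NNReal.coe_one, mul_one] at h
  refine le_trans (measureReal_mono ?_) h
  intro ω (hω : |walk (fun i => X i ω) m| < b)
  have h1 := (abs_lt.1 hω).2
  change m * μ - b ≤ ∑ i ∈ Finset.range m, (μ - X i ω)
  rw [Finset.sum_sub_distrib]
  simp only [Finset.sum_const, Finset.card_range, nsmul_eq_mul]
  unfold walk at h1
  linarith

lemma prob_abs_walk_lt_le {X : ℕ → Ω → ℝ} (hX : ∀ i, Measurable (X i)) (hi : iIndepFun X P)
    (hv : ∀ i ω, X i ω = 1 ∨ X i ω = -1) {μ : ℝ} (hμ : ∀ i, ∫ ω, X i ω ∂P = μ) {m : ℕ} {b : ℝ}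
    (hb : b ≤ m * |μ|) :
    P.real {ω | |walk (fun i => X i ω) m| < b} ≤ Real.exp (-(m * |μ| - b) ^ 2 / (2 * m)) := by
  rcases le_total 0 μ with h | h
  · rw [abs_of_nonneg h] at hb ⊢
    exact prob_walk_lt_le_of_nonneg hX hi hv hμ hb
  · rw [abs_of_nonpos h] at hb ⊢
    have := prob_walk_lt_le_of_nonneg (X := fun i ω => -X i ω) (μ := -μ) (fun i => (hX i).neg)
      (hi.comp (fun _ x => -x) (fun _ => measurable_neg))
      (fun i ω => by rcases hv i ω with h | h <;> simp [h])
      (fun i => by rw [integral_neg, hμ]) hb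
    simpa only [walk_neg, abs_neg] using this

end Concentration

/-- The right side is `tanh (x / 2)`. The constants in `c` are made for this bound: `8 log 2 > 11/2`
leaves room for a quadratic lower bound of the exponential, and `y ≤ 1/6` avoids saturation. -/
lemma two_mul_le_logistic {x y : ℝ} (hy0 : 0 ≤ y) (hy : y ≤ 1 / 6) (hx : 8 * Real.log 2 * y ≤ x) :
    2 * y ≤ 1 - 2 * (1 / (1 + Real.exp x)) := by
  have hl := Real.log_two_gt_d9
  have hx' : 11 / 2 * y ≤ x := by nlinarith
  have h1 : 1 + 11 / 2 * y + 15 * y ^ 2 ≤ Real.exp x := by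
    have := Real.quadratic_le_exp_of_nonneg (by positivity : 0 ≤ 11 / 2 * y)
    have h2 := Real.exp_le_exp.2 hx'
    nlinarith [sq_nonneg y]
  have hpos := Real.exp_pos x
  rw [← mul_div_assoc, mul_one, le_sub_iff_add_le, ← le_sub_iff_add_le', div_le_iff₀ (by positivity)]
  nlinarith [mul_nonneg hy0 hy0, mul_nonneg (mul_nonneg hy0 hy0) (by linarith : 0 ≤ 1 / 6 - y),
    mul_nonneg (by linarith : 0 ≤ 1 - 2 * y) (sub_nonneg.2 h1)]

lemma two_mul_le_abs_logistic {x y : ℝ} (hy0 : 0 ≤ y) (hy : y ≤ 1 / 6)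
    (hx : 8 * Real.log 2 * y ≤ |x|) : 2 * y ≤ |1 - 2 * (1 / (1 + Real.exp x))| := by
  rcases le_total 0 x with h | h
  · rw [abs_of_nonneg h] at hx
    exact (two_mul_le_logistic hy0 hy hx).trans (le_abs_self _)
  · rw [abs_of_nonpos h] at hx
    refine (two_mul_le_logistic hy0 hy hx).trans ((le_of_eq ?_).trans (neg_le_abs _))
    rw [Real.exp_neg]
    have := Real.exp_pos x
    field_simp
    ring

/-! ### Long tests are unlikely at distances between `ε` and `a` -/

section Vertical

variable {Ω : Type*} [mΩ : MeasurableSpace Ω] {P : Measure Ω} [IsProbabilityMeasure P]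
  {γ : ℝ} {ξ : ℕ × ℕ × Bool → Ω → ℝ} {d : ℝ → ℝ → ℝ} {β θs η p : ℝ} {cm cp ρ₀ : ℝ → ℝ}

/-- A long test is unlikely at a query point further than `ε` from `θ*`. -/
lemma prob_abs_walk_lt_barrier_le (h : IsNoise P γ ξ) (hγ : 0 < γ) (hη₀ : 0 < η) (hη₁ : η < 1)
    {a lam κ δ ε θ : ℝ} (ha : 0 < a) (hlam : 0 < lam) (hκ : 0 < κ)
    (hgap : UtilityGap d β θs a lam κ cm cp) (hδ : 0 < δ) (hδ1 : δ ≤ 1 / 2) (hε : 0 < ε)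
    (hθ : θ ∈ Set.Icc (-β) β) (hθε : ε < |θ - θs|) (hθa : |θ - θs| ≤ a) (k : ℕ) :
    2 ≤ ⌈tauUp η (gapConst γ lam a κ) κ δ ε⌉₊ ∧
    P.real {ω | |walk (answers d θs cm cp ξ ω k θ) (⌈tauUp η (gapConst γ lam a κ) κ δ ε⌉₊ - 1)|
      < barrier η (⌈tauUp η (gapConst γ lam a κ) κ δ ε⌉₊ - 1)} ≤ δ := by
  have hc := gapConst_pos (κ := κ) hγ hlam ha
  have hc1 : gapConst γ lam a κ ≤ lam / (8 * γ * Real.log 2) := min_le_left _ _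
  have hc2 : gapConst γ lam a κ ≤ 1 / (6 * a ^ κ) := min_le_right _ _
  set c := gapConst γ lam a κ
  have hεκ : 0 < ε ^ κ := Real.rpow_pos_of_pos hε κ
  have haκ : 0 < a ^ κ := Real.rpow_pos_of_pos ha κ
  have hlog2 := Real.log_pos one_lt_two
  set y := c * ε ^ κ with hyd
  have hy : 0 < y := by positivity
  have hy6 : y ≤ 1 / 6 := by
    have h1 : ε ^ κ ≤ a ^ κ := Real.rpow_le_rpow hε.le (hθε.le.trans hθa) hκ.le
    calc y ≤ 1 / (6 * a ^ κ) * a ^ κ := by rw [hyd]; gcongr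
      _ = 1 / 6 := by field_simp
  set L := Real.log (1 / δ) with hL
  have hLlow : 1 / 2 ≤ L := by
    have h2 : Real.log 2 ≤ L := Real.log_le_log two_pos (by rw [le_div_iff₀ hδ]; linarith)
    linarith [Real.log_two_gt_d9]
  set n := ⌈tauUp η c κ δ ε⌉₊ with hn
  have hny : 8 * L / y ^ 2 ≤ n := by
    have h1 : tauUp η c κ δ ε ≤ n := Nat.le_ceil _
    refine le_trans ?_ h1
    refine le_trans (le_of_eq ?_) (le_max_right _ _)
    rw [rpow_two_mul hε, hyd, mul_pow]
  have hnτ : tauZero η c κ ε ≤ n := by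
    have h1 : tauUp η c κ δ ε ≤ n := Nat.le_ceil _
    exact_mod_cast (le_max_left _ _).trans h1
  have hny' : 8 * L ≤ n * y ^ 2 := by rwa [div_le_iff₀ (by positivity)] at hny
  -- From `n * y² ≥ 8 * L ≥ 4` and `y ≤ 1/6`. This size makes the shifts between `n - 1`, `n` and `n
  -- + 1` harmless.
  have hn144 : (144 : ℝ) ≤ n := by
    have : y ^ 2 ≤ (1 / 6) ^ 2 := pow_le_pow_left₀ hy.le hy6 2
    nlinarith [Nat.cast_nonneg (α := ℝ) n]
  have hn2 : 144 ≤ n := by exact_mod_cast hn144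
  refine ⟨by omega, ?_⟩
  obtain ⟨m, hm⟩ : ∃ m, n = m + 1 := ⟨n - 1, by omega⟩
  rw [hm, Nat.add_sub_cancel]
  have hmR : (n : ℝ) = m + 1 := by rw [hm]; push_cast; ring
  rw [hmR] at hny' hn144
  have hm0 : (0 : ℝ) < m := by linarith
  -- `n ≥ τ_0` need not be strict, so the estimate is made at `n + 1 = m + 2` and transferred to `m`
  -- by monotonicity.
  have hbar : barrier η m ≤ (m + 2) * (y / 2) := by
    refine (barrier_mono hη₀ hη₁ (by omega : m ≤ m + 2)).trans ?_
    have := barrier_lt_of_tauZero_lt hη₀ hη₁ hy (s := m + 2) (by omega)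
    push_cast at this
    exact this.le
  set D := utility d θs (cp θ) - utility d θs (cm θ) with hD
  have hDgap : 8 * Real.log 2 * y ≤ |D / γ| := by
    rw [abs_div, abs_of_pos hγ, le_div_iff₀ hγ]
    refine le_trans ?_ (hgap θ hθ hθa)
    have h1 : ε ^ κ ≤ |θ - θs| ^ κ := Real.rpow_le_rpow hε.le hθε.le hκ.le
    calc 8 * Real.log 2 * y * γ = (8 * γ * Real.log 2) * c * ε ^ κ := by rw [hyd]; ring
      _ ≤ lam * ε ^ κ := by
        gcongr
        rw [le_div_iff₀ (by positivity)] at hc1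
        linarith
      _ ≤ _ := by gcongr
  have hmean := two_mul_le_abs_logistic hy.le hy6 hDgap
  set μ := 1 - 2 * (1 / (1 + Real.exp (D / γ))) with hμ
  -- Drift `2 m y` minus boundary `m y / 2` leaves `3/2 m y`; the rest absorbs the shift from `m` to
  -- `m + 2`.
  have hgapm : (7 / 5) * (m * y) ≤ m * |μ| - barrier η m := by
    have h1 : m * (2 * y) ≤ m * |μ| := by gcongr
    nlinarith
  have hμi : ∀ i, ∫ ω, answers d θs cm cp ξ ω k θ i ∂P = μ := fun i => by
    have := integral_of_signs (P := P) (h.measurable_response (d := d) (θs := θs) (cm := cm)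
      (cp := cp) k i θ) (fun ω => response_eq_or _ _ _ _)
    rw [h.prob_response_neg_one hγ] at this
    exact this
  have hmy : 0 < m * y := by positivity
  refine (prob_abs_walk_lt_le (X := fun i ω => answers d θs cm cp ξ ω k θ i)
    (fun i => h.measurable_response k i θ) (h.iIndepFun_response k θ)
    (fun i ω => response_eq_or _ _ _ _) hμi (by linarith)).trans ?_
  have hexp : -(m * |μ| - barrier η m) ^ 2 / (2 * m) ≤ -L := by
    rw [div_le_iff₀ (by positivity)]
    have h1 : ((7 / 5) * (m * y)) ^ 2 ≤ (m * |μ| - barrier η m) ^ 2 :=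
      pow_le_pow_left₀ (by positivity) hgapm 2
    have h2 : 4 * L ≤ m * y ^ 2 := by nlinarith [sq_nonneg y]
    nlinarith
  calc _ ≤ Real.exp (-L) := Real.exp_le_exp.2 hexp
    _ = δ := by rw [hL, one_div, Real.log_inv, neg_neg, Real.exp_log hδ]

/-- After `T` moves, the query point is at a distance from `θ*` between `ε` and `a`, and the walk
has not left the boundary at time `m`. -/
def slowEvent (β p η : ℝ) (ρ₀ : ℝ → ℝ) (Z : Ω → ℕ → ℝ → ℕ → ℝ) (θs a ε : ℝ) (T : Ω → ℕ) (m : ℕ) :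
    Set Ω :=
  ⋃ k : ℕ, ⋃ w : {w : List Bool // w.length = k ∧
      ε < |wordQuery β p ρ₀ w - θs| ∧ |wordQuery β p ρ₀ w - θs| ≤ a},
    ({ω | T ω = k} ∩ wordEvent β p η ρ₀ Z w) ∩
      {ω | |walk (Z ω k (wordQuery β p ρ₀ w)) m| < barrier η m}

lemma measurableSet_abs_walk_lt (k : ℕ) (θ : ℝ) (m : ℕ) (b : ℝ) : MeasurableSet[testInfo ξ k]
    {ω | |walk (answers d θs cm cp ξ ω k θ) m| < b} :=
  measurable_responses_testInfo (ξ := ξ) (d := d) (θs := θs) (cm := cm) (cp := cp) k θ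
    (measurableSet_lt (measurable_walk m).abs (measurable_const (a := b)))

lemma measurableSet_time_inter_wordEvent {T : Ω → ℕ}
    (hT : ∀ k, MeasurableSet[pastInfo ξ k] {ω | T ω = k}) {k : ℕ} {w : List Bool}
    (hw : w.length = k) : MeasurableSet[pastInfo ξ k]
      ({ω | T ω = k} ∩ wordEvent β p η ρ₀ (answers d θs cm cp ξ) w) := by
  subst hw
  exact (hT _).inter (measurableSet_wordEvent w)

lemma measurableSet_slowEvent (h : IsNoise P γ ξ) {T : Ω → ℕ}
    (hT : ∀ k, MeasurableSet[pastInfo ξ k] {ω | T ω = k}) (a ε : ℝ) (m : ℕ) :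
    MeasurableSet (slowEvent β p η ρ₀ (answers d θs cm cp ξ) θs a ε T m) :=
  MeasurableSet.iUnion fun k => MeasurableSet.iUnion fun w =>
    (h.pastInfo_le _ _ (measurableSet_time_inter_wordEvent hT w.2.1)).inter
      (h.testInfo_le k _ (measurableSet_abs_walk_lt _ _ _ _))

/-- The event `T = k` and the word belong to the past of test `k`, whereas the walk is produced by
test `k` itself, so each piece gains a factor `δ` by independence. Distinct words of length `k` and
distinct values of `T` give disjoint events, hence the factors add up to at most `δ`, without a
union bound over `k`. -/
lemma prob_slowEvent_le (h : IsNoise P γ ξ) {T : Ω → ℕ}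
    (hT : ∀ k, MeasurableSet[pastInfo ξ k] {ω | T ω = k}) {a ε δ : ℝ} {m : ℕ} (hδ : 0 ≤ δ)
    (hslow : ∀ k w, ε < |wordQuery β p ρ₀ w - θs| → |wordQuery β p ρ₀ w - θs| ≤ a →
      P.real {ω | |walk (answers d θs cm cp ξ ω k (wordQuery β p ρ₀ w)) m| < barrier η m} ≤ δ) :
    P.real (slowEvent β p η ρ₀ (answers d θs cm cp ξ) θs a ε T m) ≤ δ := by
  classical
  refine ENNReal.toReal_le_of_le_ofReal hδ ?_
  have hTm : ∀ k, MeasurableSet {ω | T ω = k} := fun k => h.pastInfo_le k _ (hT k)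
  have hk : ∀ k, P (⋃ w : {w : List Bool // w.length = k ∧
      ε < |wordQuery β p ρ₀ w - θs| ∧ |wordQuery β p ρ₀ w - θs| ≤ a},
      ({ω | T ω = k} ∩ wordEvent β p η ρ₀ (answers d θs cm cp ξ) w) ∩
      {ω | |walk (answers d θs cm cp ξ ω k (wordQuery β p ρ₀ w)) m| < barrier η m})
      ≤ ENNReal.ofReal δ * P {ω | T ω = k} := by
    intro k
    set A : List Bool → Set Ω := fun w =>
      {ω | T ω = k} ∩ wordEvent β p η ρ₀ (answers d θs cm cp ξ) w with hA
    set B : List Bool → Set Ω := fun w =>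
      {ω | |walk (answers d θs cm cp ξ ω k (wordQuery β p ρ₀ w)) m| < barrier η m} with hB
    set s := (words k).filter (fun w => ε < |wordQuery β p ρ₀ w - θs| ∧
      |wordQuery β p ρ₀ w - θs| ≤ a) with hs
    have hAm : ∀ w ∈ s, MeasurableSet[pastInfo ξ k] (A w) := fun w hw =>
      measurableSet_time_inter_wordEvent hT (mem_words.1 (Finset.mem_filter.1 hw).1)
    have h1 : P.real (⋃ w ∈ s, (A w ∩ B w)) ≤ δ * P.real {ω | T ω = k} := by
      calc P.real (⋃ w ∈ s, (A w ∩ B w)) ≤ ∑ w ∈ s, P.real (A w ∩ B w) :=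
            measureReal_biUnion_finset_le _ _
        _ ≤ ∑ w ∈ s, δ * P.real (A w) := by
          refine Finset.sum_le_sum fun w hw => ?_
          rw [h.prob_inter (hAm w hw) (measurableSet_abs_walk_lt _ _ _ _), mul_comm]
          obtain ⟨_, h2, h3⟩ := Finset.mem_filter.1 hw
          exact mul_le_mul_of_nonneg_right (hslow k w h2 h3) measureReal_nonneg
        _ = δ * ∑ w ∈ s, P.real (A w) := (Finset.mul_sum _ _ _).symm
        _ = δ * P.real (⋃ w ∈ s, A w) := by
          rw [measureReal_biUnion_finset _ fun w hw => h.pastInfo_le k _ (hAm w hw)]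
          intro w hw w' hw' hne
          rw [Function.onFun, Set.disjoint_left]
          intro ω hω hω'
          refine hne (eq_of_mem_wordEvent ?_ hω.2 hω'.2)
          rw [mem_words.1 (Finset.mem_filter.1 hw).1, mem_words.1 (Finset.mem_filter.1 hw').1]
        _ ≤ δ * P.real {ω | T ω = k} := by
          refine mul_le_mul_of_nonneg_left (measureReal_mono ?_) hδ
          exact Set.iUnion₂_subset fun w _ => Set.inter_subset_left
    have hsub : (⋃ w : {w : List Bool // w.length = k ∧
        ε < |wordQuery β p ρ₀ w - θs| ∧ |wordQuery β p ρ₀ w - θs| ≤ a}, A w ∩ B w)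
        ⊆ ⋃ w ∈ s, (A w ∩ B w) :=
      Set.iUnion_subset fun w => Set.subset_biUnion_of_mem (u := fun w => A w ∩ B w)
        (Finset.mem_coe.2 (Finset.mem_filter.2 ⟨mem_words.2 w.2.1, w.2.2⟩))
    refine (measure_mono hsub).trans ?_
    rw [← ofReal_measureReal (measure_ne_top P _), ← ofReal_measureReal (measure_ne_top P _),
      ← ENNReal.ofReal_mul hδ]
    exact ENNReal.ofReal_le_ofReal h1
  refine (measure_iUnion_le _).trans ((ENNReal.tsum_le_tsum hk).trans ?_)
  rw [ENNReal.tsum_mul_left, ← measure_iUnion ?_ hTm]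
  · exact mul_le_of_le_one_right zero_le prob_le_one
  · intro i j hij
    rw [Function.onFun, Set.disjoint_left]
    intro ω (h1 : T ω = i) (h2 : T ω = j)
    exact hij (h1.symm.trans h2)

end Vertical

/-! ### The number of horizontal moves -/

/-- Ensures `w₀ ≤ w₁` for the error interval, as `exists_isWeight` requires. -/
lemma half_pow_le {η : ℝ} (hη₀ : 0 < η) (hη₁ : η < 1) {m : ℕ} (hm : 1 ≤ m) (hb : barrier η m ≤ m) :
    (1 / 2 : ℝ) ^ m ≤ η / 2 := by
  have hm1 : (1 : ℝ) ≤ m := by exact_mod_cast hm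
  have h1 : 2 * m * (Real.log (m + 1) - Real.log η) ≤ (m : ℝ) ^ 2 := by
    rw [← barrier_sq hη₀ hη₁]
    exact pow_le_pow_left₀ (barrier_nonneg η m) hb 2
  have h2 : 2 * (Real.log (m + 1) - Real.log η) ≤ m := by
    have : 2 * (Real.log (m + 1) - Real.log η) * m ≤ m * m := by linarith
    exact le_of_mul_le_mul_right this (by linarith)
  have h3 : Real.log 2 ≤ Real.log (m + 1) := Real.log_le_log two_pos (by linarith)
  rw [← Real.log_le_log_iff (by positivity) (by positivity), Real.log_pow,
    Real.log_div hη₀.ne' two_ne_zero, one_div, Real.log_inv]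
  nlinarith [Real.log_two_gt_d9]

/-- The rate for which `tauRight` moves make a geometric series small. -/
lemma exists_rate {r C : ℝ} (hr : 0 < r) (hr1 : r < 1) (hC : 0 < C) : ∃ r₂ : ℝ, 0 < r₂ ∧
    ∀ δ M : ℝ, 0 < δ → δ < 1 → 0 < M → M ≤ 1 → ∀ n : ℕ,
      4 * Real.log (8 / (δ / 2 * M)) / r₂ ≤ n → 2 * (C / M ^ 2) * r ^ n / (1 - r) ≤ δ / 2 := by
  have hΛ : 0 < -Real.log r := by linarith [Real.log_neg hr hr1]
  have h1r : 0 < 1 - r := by linarith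
  obtain ⟨J, hJ⟩ := pow_unbounded_of_one_lt (C / (1 - r)) (by norm_num : (1 : ℝ) < 16)
  -- This choice turns the hypothesis on `n` into `r^n ≤ x^(2+J)` with `x = δ M / 16`. The factor
  -- `x²` cancels `M²`, and `x^J ≤ 16^(-J)` cancels `C / (1 - r)`; so `r₂` depends on `r` and `C`
  -- only.
  refine ⟨4 * (-Real.log r) / (2 + J), by positivity, ?_⟩
  intro δ M hδ hδ1 hM hM1 n hn
  set x := δ * M / 16 with hx
  have hx0 : 0 < x := by positivity
  have hx1 : x ≤ 1 / 16 := by rw [hx]; nlinarith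
  have e1 : Real.log (8 / (δ / 2 * M)) = -Real.log x := by
    rw [← Real.log_inv, hx]; congr 1; field_simp; norm_num
  rw [e1, div_le_iff₀ (by positivity)] at hn
  have hn2 : n * Real.log r ≤ (2 + J) * Real.log x := by
    have e2 : (n : ℝ) * (4 * -Real.log r / (2 + J)) = 4 * (n * -Real.log r) / (2 + J) := by ring
    rw [e2, le_div_iff₀ (by positivity)] at hn
    linarith
  have hrn : r ^ n ≤ x ^ (2 + J) := by
    rw [← Real.log_le_log_iff (by positivity) (by positivity), Real.log_pow, Real.log_pow]
    push_cast
    exact hn2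
  have hxJ : x ^ J ≤ (1 - r) / C := by
    calc x ^ J ≤ (1 / 16) ^ J := pow_le_pow_left₀ hx0.le hx1 J
      _ = 1 / 16 ^ J := by rw [one_div_pow]
      _ ≤ 1 / (C / (1 - r)) := one_div_le_one_div_of_le (by positivity) hJ.le
      _ = (1 - r) / C := by rw [one_div_div]
  calc 2 * (C / M ^ 2) * r ^ n / (1 - r) ≤ 2 * (C / M ^ 2) * (x ^ 2 * ((1 - r) / C)) / (1 - r) := by
        rw [pow_add] at hrn
        have : r ^ n ≤ x ^ 2 * ((1 - r) / C) := hrn.trans (by gcongr)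
        gcongr
    _ = δ ^ 2 / 128 := by rw [hx]; field_simp; norm_num
    _ ≤ δ / 2 := by nlinarith

/-- If the prior mass assumption asks for more than the total mass, every point is near `θ*`. -/
lemma abs_sub_le_of_one_lt {β θs a ς : ℝ} {ρ₀ : ℝ → ℝ} (hβ : 0 < β) (hρ : IsPrior β ρ₀)
    (hθs : θs ∈ Set.Icc (-β) β) (ha : 0 < a) (hmass : PriorMass β θs a ς ρ₀) (h : 1 < a ^ ς) {θ : ℝ}
    (hθ : θ ∈ Set.Icc (-β) β) : |θ - θs| ≤ a := by
  have h1 : θs + β ≤ a := by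
    by_contra hc
    have hx : θs - a ∈ Set.Icc (-β) β := ⟨by linarith, by linarith [hθs.2]⟩
    have := hmass.1 (not_le.1 hc)
    rw [integral_prior_eq_sub hρ hx hθs] at this
    linarith [hρ.mass_nonneg hx, hρ.mass_le_one hβ hθs]
  have h2 : β - θs ≤ a := by
    by_contra hc
    have hx : θs + a ∈ Set.Icc (-β) β := ⟨by linarith [hθs.1], by linarith⟩
    have := hmass.2 (not_le.1 hc)
    rw [integral_prior_eq_sub hρ hθs hx] at this
    linarith [hρ.mass_nonneg hθs, hρ.mass_le_one hβ hx]
  rw [abs_le]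
  constructor <;> linarith [hθ.1, hθ.2]

end MAPB

/-! ### The two failure events combined -/

theorem mainTheorem5 (p η Δ γ : ℝ) (hη₀ : 0 < η) (hη₁ : η < 1)
    (hp₀ : 1 / 2 < p) (hp₁ : p < 1 - η / 2) (hΔ : 0 < Δ) (hγ : 0 < γ) :
    ∃ r₁ r₂ rR α β₁ β₂ : ℝ,
      0 < r₁ ∧ 0 < r₂ ∧ 0 < rR ∧ 0 < α ∧ 0 < β₁ ∧ 0 < β₂ ∧
      ∀ a lam κ : ℝ, 0 < a → 0 < lam → 0 < κ → κ ≤ 1 →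
        (∀ (β θs ς : ℝ) (d : ℝ → ℝ → ℝ) (cm cp ρ₀ : ℝ → ℝ),
          0 < β → θs ∈ Set.Icc (-β) β → ς ≤ 1 →
          MAPB.IsDistance d → MAPB.IsComparisonPair d Δ β cm cp →
          MAPB.IsPrior β ρ₀ → MAPB.PriorMass β θs a ς ρ₀ →
          MAPB.UtilityGap d β θs a lam κ cm cp →
          ∀ (Ω : Type*) [MeasurableSpace Ω] (P : MeasureTheory.Measure Ω)
            [MeasureTheory.IsProbabilityMeasure P] (ξ : ℕ × ℕ × Bool → Ω → ℝ),
            MAPB.IsNoise P γ ξ →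
          ∀ T : Ω → ℕ, (∀ k, MeasurableSet[MAPB.pastInfo ξ k] {ω | T ω = k}) →
          ∀ δ ε : ℝ, 0 < δ → δ < 1 → 0 < ε →
            1 - δ ≤ P.real {ω |
              let Z : ℕ → ℝ → ℕ → ℝ := MAPB.response d θs cm cp (fun j => ξ j ω)
              MAPB.MakesMoves β p η ρ₀ Z (T ω) →
              MAPB.tauRight ς r₁ r₂ rR α β₁ β₂ (δ / 2) a ≤ (T ω : ℝ) →
              (⌈MAPB.tauUp η (MAPB.gapConst γ lam a κ) κ (δ / 2) ε⌉₊ : ℕ∞) ≤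
                MAPB.verticalMoves β p η ρ₀ Z (T ω) →
              |MAPB.queryPoint β p η ρ₀ Z (T ω) - θs| ≤ ε}) ∧
        (∃ C : ℝ, 0 < C ∧ ∀ δ ε : ℝ, 0 < δ → δ < 1 → 0 < ε → ε ≤ 1 / 2 →
          MAPB.tauUp η (MAPB.gapConst γ lam a κ) κ δ ε ≤
            C * (Real.log (1 / δ) + Real.log (1 / ε)) * ε ^ (-(2 * κ))) := by
  open MAPB in
  obtain ⟨m, hm, hb⟩ := exists_barrier_le hη₀ hη₁
  have hw : (1 / (1 + Real.exp (Δ / γ))) ^ m ≤ η / 2 :=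
    (pow_le_pow_left₀ (by positivity) (one_div_one_add_exp_le_half (by positivity)) m).trans
      (half_pow_le hη₀ hη₁ hm hb)
  obtain ⟨r, C, G, hC, hG⟩ := exists_isWeight hp₀ (by positivity) hw (by linarith)
  obtain ⟨r₂, hr₂, hrate⟩ := exists_rate hG.r_pos hG.r_lt_one hC
  -- Only the second entry of the maximum `τ^→` is needed, so every constant other than `r₂` can be
  -- `1`.
  refine ⟨1, r₂, 1, 1, 1, 1, one_pos, hr₂, one_pos, one_pos, one_pos, one_pos, ?_⟩
  intro a lam κ ha hlam hκ _
  refine ⟨?_, exists_tauUp_le hη₀ hη₁ (gapConst_pos hγ hlam ha) hκ⟩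
  intro β θs ς d cm cp ρ₀ hβ hθs _ hd hc hρ hmass hgap Ω _ P _ ξ h T hT δ ε hδ hδ1 hε
  have hp1 : p < 1 := by linarith
  have hq := wordQuery_mem hβ (by linarith) hp1 hρ
  set n := ⌈tauRight ς 1 r₂ 1 1 1 1 (δ / 2) a⌉₊ with hn
  set N := ⌈tauUp η (gapConst γ lam a κ) κ (δ / 2) ε⌉₊ with hN
  set far := farEvent β p η ρ₀ (answers d θs cm cp ξ) θs a n with hfar
  set slow := slowEvent β p η ρ₀ (answers d θs cm cp ξ) θs a ε T (N - 1) with hslow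
  have hfar_le : P.real far ≤ δ / 2 := by
    -- `exists_rate` needs a mass bound of at most `1`. If `a ^ ς > 1`, both sides of `θ*` must be
    -- exempt from the prior assumption and no query point is far.
    rcases le_or_gt (a ^ ς) 1 with h1 | h1
    · refine (prob_farEvent_le h hγ hη₀ hη₁ hd hc hβ hθs hp₀ hp₁ hρ hm hb hC.le hG ha hmass n).trans ?_
      refine hrate δ (a ^ ς) hδ hδ1 (Real.rpow_pos_of_pos ha ς) h1 n ?_
      refine le_trans ?_ (Nat.le_ceil _)
      have : 4 * Real.log (8 / (δ / 2 * a ^ ς)) / (r₂ * 1) ≤ tauRight ς 1 r₂ 1 1 1 1 (δ / 2) a :=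
        (le_max_right _ _).trans (le_max_left _ _)
      rwa [mul_one] at this
    · have : far = ∅ := by
        refine Set.iUnion_eq_empty.2 fun k => Set.iUnion_eq_empty.2 fun w => ?_
        exact absurd w.2.2 (not_lt.2 (abs_sub_le_of_one_lt hβ hρ hθs ha hmass h1 (hq w.1)))
      rw [this, measureReal_empty]
      linarith
  have hslow_le : P.real slow ≤ δ / 2 :=
    prob_slowEvent_le h hT (by linarith) fun k w h1 h2 =>
      (prob_abs_walk_lt_barrier_le h hγ hη₀ hη₁ ha hlam hκ hgap (by linarith) (by linarith) hε (hq w)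
        h1 h2 k).2
  have hmeas : MeasurableSet (far ∪ slow) :=
    (measurableSet_farEvent h a n).union (measurableSet_slowEvent h hT a ε (N - 1))
  have hcompl : 1 - δ ≤ P.real (far ∪ slow)ᶜ := by
    rw [probReal_compl_eq_one_sub hmeas]
    linarith [measureReal_union_le (μ := P) far slow]
  refine hcompl.trans (measureReal_mono ?_)
  intro ω hω hmoves hτ hv
  rw [Set.mem_compl_iff, Set.mem_union, not_or] at hω
  obtain ⟨w, hwk, hwω⟩ := exists_wordEvent (Z := answers d θs cm cp ξ) hη₀ hη₁ hmoves
  have hlen := mem_words.1 hwk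
  have hquery : queryPoint β p η ρ₀ (answers d θs cm cp ξ ω) (T ω) = wordQuery β p ρ₀ w := by
    rw [← hlen]; exact queryPoint_of_mem_wordEvent hwω
  change |queryPoint β p η ρ₀ (answers d θs cm cp ξ ω) (T ω) - θs| ≤ ε
  change (N : ℕ∞) ≤ verticalMoves β p η ρ₀ (answers d θs cm cp ξ ω) (T ω) at hv
  rw [verticalMoves, hquery] at hv
  rw [hquery]
  by_contra hε'
  rw [not_le] at hε'
  have hnear : |wordQuery β p ρ₀ w - θs| ≤ a := by
    by_contra hfa
    refine hω.1 (Set.mem_iUnion.2 ⟨T ω - n, Set.mem_iUnion.2 ⟨⟨w, ?_, not_le.1 hfa⟩, hwω⟩⟩)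
    have : n ≤ T ω := Nat.ceil_le.2 hτ
    omega
  have hN2 := (prob_abs_walk_lt_barrier_le h hγ hη₀ hη₁ ha hlam hκ hgap (by linarith : 0 < δ / 2)
    (by linarith) hε (hq w) hε' hnear (T ω)).1
  refine hω.2 (Set.mem_iUnion.2 ⟨T ω, Set.mem_iUnion.2 ⟨⟨w, hlen, hε', hnear⟩, ⟨rfl, hwω⟩, ?_⟩⟩)
  -- A stopping time of at least `N` only says that the walk is inside the boundary at times before
  -- `N`, hence the time `N - 1`; `N ≥ 2` makes it an admissible time.
  exact abs_walk_lt_of_lt_testTime hv (by omega) (by omega)
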